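/- Let $\Omega=\{-1,+1\}^{\mathbb Z^2}$ with the product topology and product $\sigma$-algebra; for $\Delta\subset\mathbb Z^2$ let $\mathcal F_\Delta$ be the $\sigma$-algebra generated by the spins in $\Delta$. Let $J>0$, $1<\alpha_1\le 2$, and consider the ferromagnetic Ising model on $\mathbb Z^2$ with pair couplings, for $i\neq j$, $$J(i,j)=J\,\mathbf 1_{|i-j|=1}\mathbf 1_{i_1=j_1}+J\,|i_1-j_1|^{-\alpha_1}\,\mathbf 1_{i_2=j_2},$$ and its Gibbs specification at inverse temperature $\beta$: for finite $\Lambda\subset\mathbb Z^2$, $\gamma_\Lambda(\cdot\,|\,\omega)$ gives to $\sigma_\Lambda\omega_{\Lambda^c}$ a probability proportional to $\exp\big(\beta\sum_{\{i,j\}\cap\Lambda\ne\emptyset}J(i,j)\sigma_i\sigma_j\big)$, where $\sigma=\omega$ off $\Lambda$. Let $\mathcal G(\gamma)$ be the set of probability measures $\mu$ on $\Omega$ with $\mu[A|\mathcal F_{\Lambda^c}]=\gamma_\Lambda(A|\cdot)$ $\mu$-a.s. for all finite $\Lambda$ and all events $A$. Let $T:\Omega\to\Omega$, $(T\omega)_i=\omega_{2i}$,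 be the decimation, and write $T\mu$ for the image measure. A specification (a consistent family of proper probability kernels $(\gamma_\Lambda)_\Lambda$, $\Lambda$ finite, with $\gamma_\Lambda(A|\cdot)$ $\mathcal F_{\Lambda^c}$-measurable) is quasilocal if $\gamma_\Lambda f$ is quasilocal (that is, continuous) for every finite $\Lambda$ and every local $f$, and non-null if $\gamma_\Lambda(A|\omega)>0$ for all $\omega$ and all $A\in\mathcal F_\Lambda$ of positive measure under the symmetric product measure. A probability measure is quasilocal if it is consistent with some quasilocal specification, and Gibbs if it is consistent with some non-null quasilocal specification. A configuration $\omega$ is a point of essential discontinuity of $\nu$ if there are a finite $\Lambda_0$, a local function $f$ and $\delta>0$ such that for every finite $\Lambda\supset\Lambda_0$ there are two open sets $N_1,N_2$ of positive $\nu$-measure, consisting of configurations equal to $\omega$ on $\Lambda$, with $|\nu[f|\mathcal F_{\Lambda_0^c}](\omega^1)-\nu[f|\mathcal F_{\Lambda_0^c}](\omega^2)|>\delta$ for $\nu$-a.e. $\omega^1\in N_1$ and $\nu$-a.e. $\omega^2\in N_2$. **Theorem.** There is $\beta_c=\beta_c(J,\alpha_1)\in(0,\infty)$ such that for every $\beta>\beta_c$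 the following holds. The plus phase $\mu^+=\lim_{\Lambda\uparrow\mathbb Z^2}\gamma_\Lambda(\cdot\,|\,+)$ (weak limit) exists and belongs to $\mathcal G(\gamma)$, and the decimated measure $\nu^+=T\mu^+$ is not quasilocal, hence not Gibbs; the alternating configuration $(\omega'_{\rm alt})_i=(-1)^{i_1+i_2}$ is a point of essential discontinuity of $\nu^+$. The same holds for $T\mu$ for every $\mu\in\mathcal G(\gamma)$: the alternating configuration is a point of essential discontinuity of $T\mu$, and $T\mu$ is neither quasilocal nor Gibbs. -/

import Mathlib

open MeasureTheory Filter Topology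

namespace Ising

/-- The lattice `ℤ²`. -/
abbrev Site := ℤ × ℤ

/-- Configurations of Ising spins on `ℤ²`, with the product topology and the product σ-algebra.
The single-spin space `{-1, +1}` is `Bool`, with `true` standing for `+1`. -/
abbrev Config := Site → Bool

/-- The numerical value `±1` of a spin. -/
def spin (b : Bool) : ℝ := if b then 1 else -1

/-- The all-plus configuration. -/
def plusConfig : Config := fun _ => true

/-- The alternating configuration `i ↦ (-1)^(i₁ + i₂)`. -/
def altConfig : Config := fun i => decide (Even (i.1 + i.2))

/-- The σ-algebra `𝓕_Δ` generated by the spins in `Δ`. -/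
abbrev sigmaOn (Δ : Set Site) : MeasurableSpace Config :=
  cylinderEvents (X := fun _ : Site => Bool) Δ

/-- The a priori single-spin measure `(δ₋₁ + δ₊₁) / 2`. -/
noncomputable def rho₀ : Measure Bool :=
  (2⁻¹ : ENNReal) • Measure.dirac false + (2⁻¹ : ENNReal) • Measure.dirac true

/-- The a priori product measure on configurations. -/
noncomputable def rho : Measure Config := Measure.infinitePi fun _ : Site => rho₀

/-! ### Specifications, quasilocality, Gibbs measures -/

/-- A family of candidate conditional distributions `γ_Λ(dσ | ω)`, `Λ` finite, written
`γ Λ ω : Measure Config`. -/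
abbrev KernelFamily := Finset Site → Config → Measure Config

/-- (Local) specification: probability kernels that are measurable with respect to the outside,
proper and consistent. -/
structure IsSpecification (γ : KernelFamily) : Prop where
  isProbability : ∀ Λ ω, IsProbabilityMeasure (γ Λ ω)
  measurable : ∀ (Λ : Finset Site) (A : Set Config), MeasurableSet A →
    Measurable[sigmaOn (Λ : Set Site)ᶜ] fun ω => γ Λ ω A
  proper : ∀ (Λ : Finset Site) (B : Set Config), MeasurableSet[sigmaOn (Λ : Set Site)ᶜ] B →
    ∀ ω, γ Λ ω B = B.indicator 1 ω
  consistent : ∀ Λ Λ' : Finset Site, Λ ⊆ Λ' → ∀ A : Set Config, MeasurableSet A →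
    ∀ ω, ∫⁻ ω', γ Λ ω' A ∂(γ Λ' ω) = γ Λ' ω A

/-- DLR equations: `μ[A | 𝓕_{Λᶜ}] = γ_Λ(A | ·)` `μ`-almost surely, for all finite `Λ` and all
events `A`. -/
def IsConsistent (μ : Measure Config) (γ : KernelFamily) : Prop :=
  ∀ (Λ : Finset Site) (A : Set Config), MeasurableSet A →
    μ[A.indicator (fun _ => (1 : ℝ)) | sigmaOn (Λ : Set Site)ᶜ] =ᵐ[μ] fun ω => (γ Λ ω).real A

/-- `𝓖(γ)`: the probability measures consistent with `γ`. -/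
def DLR (γ : KernelFamily) : Set (Measure Config) :=
  {μ | IsProbabilityMeasure μ ∧ IsConsistent μ γ}

/-- Local functions: those that depend on finitely many spins. -/
def IsLocal (f : Config → ℝ) : Prop :=
  ∃ Λ : Finset Site, DependsOn f (Λ : Set Site)

/-- Quasilocal functions: `sup {|f ω - f σ| : σ = ω on Λ}` tends to `0` as `Λ ↑ ℤ²`. -/
def IsQuasilocalFun (f : Config → ℝ) : Prop :=
  ∀ ε > 0, ∃ Λ : Finset Site, ∀ σ ω : Config, (∀ i ∈ Λ, σ i = ω i) → |f ω - f σ| ≤ ε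

/-- A family of kernels is quasilocal if it maps local functions to quasilocal functions. -/
def IsQuasilocalFamily (γ : KernelFamily) : Prop :=
  ∀ (Λ : Finset Site) (f : Config → ℝ), IsLocal f → IsQuasilocalFun fun ω => ∫ σ, f σ ∂(γ Λ ω)

/-- Non-nullness with respect to the a priori measure. -/
def IsNonNull (γ : KernelFamily) : Prop :=
  ∀ (Λ : Finset Site) (A : Set Config), MeasurableSet[sigmaOn (Λ : Set Site)] A → 0 < rho A →
    ∀ ω, 0 < γ Λ ω A

/-- A measure is quasilocal if it is consistent with some quasilocal specification. -/
def IsQuasilocal (μ : Measure Config) : Prop :=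
  ∃ γ : KernelFamily, IsSpecification γ ∧ IsQuasilocalFamily γ ∧ μ ∈ DLR γ

/-- A measure is Gibbs if it is consistent with some non-null quasilocal specification. -/
def IsGibbs (μ : Measure Config) : Prop :=
  ∃ γ : KernelFamily, IsSpecification γ ∧ IsNonNull γ ∧ IsQuasilocalFamily γ ∧ μ ∈ DLR γ

/-- The basic neighbourhood `𝓝_Λ(ω)` of configurations that coincide with `ω` on `Λ`. -/
def nbhd (Λ : Finset Site) (ω : Config) : Set Config := {σ | ∀ i ∈ Λ, σ i = ω i}

/-- `ω` is a point of essential discontinuity of `ν`: for some finite `Λ₀`, some local `f` and some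
`δ > 0`, every neighbourhood `𝓝_Λ(ω)` with `Λ ⊇ Λ₀` contains two open sets of positive measure
between which the conditional expectation of `f` given the spins outside `Λ₀` jumps by more than
`δ`. The requirement is made for almost all pairs of points, so that it does not depend on the
version of the conditional expectation. -/
def IsEssentialDiscontinuity (ν : Measure Config) (ω : Config) : Prop :=
  ∃ (Λ₀ : Finset Site) (f : Config → ℝ) (δ : ℝ), IsLocal f ∧ 0 < δ ∧
    ∀ Λ : Finset Site, Λ₀ ⊆ Λ → ∃ N₁ N₂ : Set Config,
      IsOpen N₁ ∧ N₁ ⊆ nbhd Λ ω ∧ 0 < ν N₁ ∧ IsOpen N₂ ∧ N₂ ⊆ nbhd Λ ω ∧ 0 < ν N₂ ∧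
      ∀ᵐ ω₁ ∂(ν.restrict N₁), ∀ᵐ ω₂ ∂(ν.restrict N₂),
        δ < |(ν[f | sigmaOn (Λ₀ : Set Site)ᶜ]) ω₁ - (ν[f | sigmaOn (Λ₀ : Set Site)ᶜ]) ω₂|

/-! ### The Ising model with vertical nearest-neighbour and horizontal long-range couplings -/

/-- The couplings `J 1{|i - j| = 1} 1{i₁ = j₁} + J |i₁ - j₁|^(-α) 1{i₂ = j₂}` for `i ≠ j`,
and `0` for `i = j`. -/
noncomputable def coupling (J α : ℝ) (i j : Site) : ℝ :=
  (if i.1 = j.1 ∧ |i.2 - j.2| = 1 then J else 0) +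
    (if i.2 = j.2 ∧ i.1 ≠ j.1 then J * (|i.1 - j.1| : ℝ) ^ (-α) else 0)

/-- The Hamiltonian in the finite volume `Λ`: minus the sum of `J(i,j) σ_i σ_j` over the unordered
pairs `{i, j}` that meet `Λ`. The factor `1/2` compensates that the pairs inside `Λ` are listed
twice. The boundary condition is the restriction of `σ` to the complement of `Λ`. -/
noncomputable def hamiltonian (J α : ℝ) (Λ : Finset Site) (σ : Config) : ℝ :=
  -((1 / 2) * ∑ i ∈ Λ, ∑ j ∈ Λ, coupling J α i j * spin (σ i) * spin (σ j) +
    ∑ i ∈ Λ, ∑' j : {j : Site // j ∉ Λ}, coupling J α i j * spin (σ i) * spin (σ j))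

/-- The configuration `τ_Λ ω_{Λᶜ}`. -/
def glue (Λ : Finset Site) (τ : Λ → Bool) (ω : Config) : Config :=
  fun i => if h : i ∈ Λ then τ ⟨i, h⟩ else ω i

/-- The partition function (with respect to the counting measure on `{-1, +1}^Λ`). -/
noncomputable def partitionFn (J α β : ℝ) (Λ : Finset Site) (ω : Config) : ℝ :=
  ∑ τ : Λ → Bool, Real.exp (-β * hamiltonian J α Λ (glue Λ τ ω))

/-- The Gibbs specification at inverse temperature `β`:
`γ_Λ(dσ | ω) = Z⁻¹ exp (-β H_Λ(σ_Λ ω_{Λᶜ})) (ρ_Λ ⊗ δ_{ω_{Λᶜ}})(dσ)`, where the constant density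
`2^(-|Λ|)` of the a priori measure `ρ_Λ` has cancelled with the same factor of the normalization. -/
noncomputable def isingKernel (J α β : ℝ) : KernelFamily := fun Λ ω =>
  ∑ τ : Λ → Bool,
    ENNReal.ofReal (Real.exp (-β * hamiltonian J α Λ (glue Λ τ ω)) / partitionFn J α β Λ ω) •
      Measure.dirac (glue Λ τ ω)

/-- The plus phase: the probability measure that is the weak limit, as `Λ ↑ ℤ²` along the finite
sets directed by inclusion, of the finite-volume measures with plus boundary condition. -/
def IsPlusPhase (J α β : ℝ) (μ : Measure Config) : Prop :=
  IsProbabilityMeasure μ ∧ ∀ f : C(Config, ℝ),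
    Tendsto (fun Λ : Finset Site => ∫ σ, f σ ∂(isingKernel J α β Λ plusConfig)) atTop
      (𝓝 (∫ σ, f σ ∂μ))

/-! ### Decimation -/

/-- The decimation map `(T ω)_i = ω_{2i}`. -/
def decimation (ω : Config) : Config := fun i => ω (2 * i.1, 2 * i.2)

/-- The decimated measure `T μ`. -/
noncomputable def decimate (μ : Measure Config) : Measure Config := μ.map decimation

end Ising

namespace Ising

/-! ### Spins and finite-volume sums -/

/-! Conditioning the decimated measure on its spins off the origin fixes the original spins at the
sites with two even coordinates, except the origin. The other ("hidden") sites then carry a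
ferromagnetic Ising model in the field of the fixed spins. Let the fixed spins alternate on a finite
set `L` and all equal +1, or all equal -1, on the rest of a large box. Seen from a hidden site with
an odd coordinate, reflection in that coordinate pairs alternating spins of opposite sign. So plus
surroundings create a nonnegative field at the hidden sites, however large `L` is
(`altField_nonneg`). At low temperature the hidden spins order along the surroundings and bias the
origin by an amount that does not depend on `L`.

Order: the columns with odd first coordinate contain no fixed site and carry a nearest-neighbour
model with couplings at least `K`, by `φ (2, 0)` and `φ (0, 1)`. A Peierls argument gives
magnetization at least 1/2 there, and the Griffiths inequalities pass it on to the full system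
(`half_le_gibbsAv_spin`).

Bias: by `kernelAv_origin` the odds of a minus at the origin are a Boltzmann factor times `⟨exp
(-X)⟩` with `X = ∑ 2 φ(x) σ_x`. With minus surroundings a global flip turns this moment into `⟨exp
X⟩`, and `⟨exp X⟩ - ⟨exp (-X)⟩ = 2 ⟨sinh X⟩ ≥ 2 ⟨X⟩ ≥ 2 φ (1, 0)` in a magnetized state
(`le_boxAv_expLin_sub`).

The spins beyond the box are not controlled; their worst effect is a negative boundary field,
`outerField`. For almost every `t ∈ [0, 1]`, in the field `t * evenField`, plus and minus boundary
fields give the same limiting magnetization: the difference, integrated over `t`, is a surface term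
divided by a volume (`exists_tendsto_magGap`). This persists under summable changes of the field
(`tendsto_boxAv_perturbed`). The fields of the two patterns fall below `evenField` by a summable
amount only, so their minimum with `t * evenField` is a nonnegative field to which both arguments
apply. FKG monotonicity then returns to the actual fields (`exp_moment_jump`).

The resulting jump is uniform over all configurations with the prescribed fixed spins, so the DLR
equations carry it to the conditional expectations of the decimated measure. A quasilocal
specification would give a continuous version, which is impossible. The plus phase exists by FKG
monotonicity and compactness, and continuity of the kernels puts it in `DLR`. -/

lemma spin_eq_or (b : Bool) : spin b = 1 ∨ spin b = -1 := by cases b <;> simp [spin]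

@[simp] lemma spin_true : spin true = 1 := by simp [spin]

@[simp] lemma spin_false : spin false = -1 := by simp [spin]

lemma spin_mono : Monotone spin := by
  intro a b hab
  cases a <;> cases b
  · exact le_rfl
  · norm_num [spin]
  · exact absurd hab (by decide)
  · exact le_rfl

lemma abs_spin (b : Bool) : |spin b| = 1 := by cases b <;> simp

lemma spin_le_one (b : Bool) : spin b ≤ 1 := by cases b <;> simp

lemma neg_one_le_spin (b : Bool) : -1 ≤ spin b := by cases b <;> simp

lemma spin_mul_self (b : Bool) : spin b * spin b = 1 := by cases b <;> simp

lemma glue_eq_updateFinset (Λ : Finset Site) (τ : Λ → Bool) (ω : Config) :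
    glue Λ τ ω = Function.updateFinset ω Λ τ := rfl

lemma glue_of_mem {Λ : Finset Site} {i : Site} (hi : i ∈ Λ) (τ : Λ → Bool) (ω : Config) :
    glue Λ τ ω i = τ ⟨i, hi⟩ := by simp [glue, hi]

lemma glue_of_notMem {Λ : Finset Site} {i : Site} (hi : i ∉ Λ) (τ : Λ → Bool) (ω : Config) :
    glue Λ τ ω i = ω i := by simp [glue, hi]

lemma glue_mono (Λ : Finset Site) {τ τ' : Λ → Bool} {ω ω' : Config} (h : τ ≤ τ') (h' : ω ≤ ω') :
    glue Λ τ ω ≤ glue Λ τ' ω' := by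
  intro i
  by_cases hi : i ∈ Λ
  · simpa [glue, hi] using h ⟨i, hi⟩
  · simpa [glue, hi] using h' i

/-- The sum of `f` over the spins in `Λ`, the spins outside being those of `ω`. -/
noncomputable def spinSum (Λ : Finset Site) (f : Config → ℝ) (ω : Config) : ℝ :=
  ∑ τ : Λ → Bool, f (glue Λ τ ω)

lemma spinSum_congr {Λ : Finset Site} {f g : Config → ℝ} {ω : Config}
    (h : ∀ τ : Λ → Bool, f (glue Λ τ ω) = g (glue Λ τ ω)) : spinSum Λ f ω = spinSum Λ g ω :=
  Finset.sum_congr rfl fun τ _ => h τ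

lemma spinSum_add (Λ : Finset Site) (f g : Config → ℝ) (ω : Config) :
    spinSum Λ (fun σ => f σ + g σ) ω = spinSum Λ f ω + spinSum Λ g ω :=
  Finset.sum_add_distrib

lemma spinSum_sub (Λ : Finset Site) (f g : Config → ℝ) (ω : Config) :
    spinSum Λ (fun σ => f σ - g σ) ω = spinSum Λ f ω - spinSum Λ g ω :=
  Finset.sum_sub_distrib _ _

lemma spinSum_const_mul (Λ : Finset Site) (a : ℝ) (f : Config → ℝ) (ω : Config) :
    spinSum Λ (fun σ => a * f σ) ω = a * spinSum Λ f ω :=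
  (Finset.mul_sum _ _ _).symm

lemma spinSum_mono {Λ : Finset Site} {f g : Config → ℝ} {ω : Config}
    (h : ∀ τ : Λ → Bool, f (glue Λ τ ω) ≤ g (glue Λ τ ω)) : spinSum Λ f ω ≤ spinSum Λ g ω :=
  Finset.sum_le_sum fun τ _ => h τ

lemma spinSum_pos {Λ : Finset Site} {f : Config → ℝ} {ω : Config}
    (h : ∀ τ : Λ → Bool, 0 < f (glue Λ τ ω)) : 0 < spinSum Λ f ω :=
  Finset.sum_pos (fun τ _ => h τ) Finset.univ_nonempty

lemma spinSum_nonneg {Λ : Finset Site} {f : Config → ℝ} {ω : Config}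
    (h : ∀ τ : Λ → Bool, 0 ≤ f (glue Λ τ ω)) : 0 ≤ spinSum Λ f ω :=
  Finset.sum_nonneg fun τ _ => h τ

lemma spinSum_union {Λ Δ : Finset Site} (h : Disjoint Δ Λ) (f : Config → ℝ) (ω : Config) :
    spinSum (Δ ∪ Λ) f ω = spinSum Δ (spinSum Λ f) ω := by
  unfold spinSum
  rw [← (Equiv.piFinsetUnion (fun _ : Site => Bool) h).sum_comp, Fintype.sum_prod_type]
  refine Finset.sum_congr rfl fun y _ => Finset.sum_congr rfl fun z _ => ?_
  rw [glue_eq_updateFinset, glue_eq_updateFinset, glue_eq_updateFinset,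
    Function.updateFinset_updateFinset h]

lemma spinSum_sdiff {Λ Λ' : Finset Site} (h : Λ ⊆ Λ') (f : Config → ℝ) (ω : Config) :
    spinSum Λ' f ω = spinSum (Λ' \ Λ) (spinSum Λ f) ω := by
  rw [← spinSum_union Finset.sdiff_disjoint, Finset.sdiff_union_of_subset h]

lemma glue_glue (Λ : Finset Site) (τ τ' : Λ → Bool) (ω : Config) :
    glue Λ τ (glue Λ τ' ω) = glue Λ τ ω := by
  ext i; by_cases hi : i ∈ Λ <;> simp [glue, hi]

lemma spinSum_glue (Λ : Finset Site) (τ : Λ → Bool) (f : Config → ℝ) (ω : Config) :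
    spinSum Λ f (glue Λ τ ω) = spinSum Λ f ω := by
  simp only [spinSum, glue_glue]

/-! ### Finite-volume Gibbs states -/

/-- Minus the energy of the spins in `Λ` under pair couplings `c` and the magnetic field `v`. -/
noncomputable def energy (Λ : Finset Site) (c : Site → Site → ℝ) (v : Site → ℝ) (σ : Config) : ℝ :=
  (1 / 2) * ∑ i ∈ Λ, ∑ j ∈ Λ, c i j * spin (σ i) * spin (σ j) + ∑ i ∈ Λ, v i * spin (σ i)

/-- The Boltzmann weight. -/
noncomputable def weight (Λ : Finset Site) (c : Site → Site → ℝ) (v : Site → ℝ) (σ : Config) : ℝ :=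
  Real.exp (energy Λ c v σ)

/-- The expectation of `f` in the finite-volume Gibbs state with couplings `c` and field `v`, the
spins outside `Λ` being those of `ω`. -/
noncomputable def gibbsAv (Λ : Finset Site) (c : Site → Site → ℝ) (v : Site → ℝ) (ω : Config)
    (f : Config → ℝ) : ℝ :=
  spinSum Λ (fun σ => f σ * weight Λ c v σ) ω / spinSum Λ (weight Λ c v) ω

variable {Λ Λ' : Finset Site} {c c' : Site → Site → ℝ} {v v' : Site → ℝ} {ω : Config}
  {f g : Config → ℝ}

lemma weight_pos (σ : Config) : 0 < weight Λ c v σ := Real.exp_pos _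

lemma partition_pos : 0 < spinSum Λ (weight Λ c v) ω := spinSum_pos fun _ => weight_pos _

lemma energy_congr {σ σ' : Config} (hv : ∀ i ∈ Λ, v i = v' i) (h : ∀ i ∈ Λ, σ i = σ' i) :
    energy Λ c v σ = energy Λ c v' σ' := by
  unfold energy
  congr 1
  · congr 1
    exact Finset.sum_congr rfl fun i hi => Finset.sum_congr rfl fun j hj => by rw [h i hi, h j hj]
  · exact Finset.sum_congr rfl fun i hi => by rw [h i hi, hv i hi]

lemma gibbsAv_congr (hv : ∀ i ∈ Λ, v i = v' i)
    (h : ∀ τ : Λ → Bool, f (glue Λ τ ω) = g (glue Λ τ ω)) :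
    gibbsAv Λ c v ω f = gibbsAv Λ c v' ω g := by
  have hw : weight Λ c v = weight Λ c v' := by
    ext σ; simp only [weight]; rw [energy_congr hv fun _ _ => rfl]
  unfold gibbsAv
  rw [hw]
  congr 1
  exact spinSum_congr fun τ => by rw [h]

lemma gibbsAv_base (hf : DependsOn f (Λ : Set Site)) (ω ω' : Config) :
    gibbsAv Λ c v ω f = gibbsAv Λ c v ω' f := by
  have hw : ∀ τ : Λ → Bool, weight Λ c v (glue Λ τ ω) = weight Λ c v (glue Λ τ ω') := fun τ =>
    congrArg Real.exp (energy_congr (fun _ _ => rfl)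
      fun i hi => by rw [glue_of_mem hi, glue_of_mem hi])
  have hf' : ∀ τ : Λ → Bool, f (glue Λ τ ω) = f (glue Λ τ ω') := fun τ =>
    hf fun i hi => by rw [glue_of_mem hi, glue_of_mem hi]
  simp only [gibbsAv, spinSum, hw, hf']

lemma gibbsAv_add : gibbsAv Λ c v ω (fun σ => f σ + g σ) =
    gibbsAv Λ c v ω f + gibbsAv Λ c v ω g := by
  unfold gibbsAv
  rw [← add_div, ← spinSum_add]
  simp only [add_mul]

lemma gibbsAv_sub : gibbsAv Λ c v ω (fun σ => f σ - g σ) =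
    gibbsAv Λ c v ω f - gibbsAv Λ c v ω g := by
  unfold gibbsAv
  rw [← sub_div, ← spinSum_sub]
  simp only [sub_mul]

lemma gibbsAv_const_mul (a : ℝ) : gibbsAv Λ c v ω (fun σ => a * f σ) =
    a * gibbsAv Λ c v ω f := by
  unfold gibbsAv
  rw [← mul_div_assoc, ← spinSum_const_mul]
  simp only [mul_assoc]

lemma gibbsAv_const (a : ℝ) : gibbsAv Λ c v ω (fun _ => a) = a := by
  unfold gibbsAv
  rw [spinSum_const_mul, mul_div_assoc, div_self partition_pos.ne', mul_one]

lemma gibbsAv_sum {ι : Type*} (s : Finset ι) (F : ι → Config → ℝ) :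
    gibbsAv Λ c v ω (fun σ => ∑ i ∈ s, F i σ) = ∑ i ∈ s, gibbsAv Λ c v ω (F i) := by
  classical
  induction s using Finset.induction_on with
  | empty => simpa using gibbsAv_const (Λ := Λ) (c := c) (v := v) (ω := ω) 0
  | insert a s ha ih => simp only [Finset.sum_insert ha, gibbsAv_add, ih]

lemma gibbsAv_mono (h : ∀ τ : Λ → Bool, f (glue Λ τ ω) ≤ g (glue Λ τ ω)) :
    gibbsAv Λ c v ω f ≤ gibbsAv Λ c v ω g := by
  unfold gibbsAv
  refine div_le_div_of_nonneg_right (spinSum_mono fun τ => ?_) partition_pos.le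
  exact mul_le_mul_of_nonneg_right (h τ) (weight_pos _).le

lemma gibbsAv_nonneg (h : ∀ τ : Λ → Bool, 0 ≤ f (glue Λ τ ω)) : 0 ≤ gibbsAv Λ c v ω f := by
  simpa [gibbsAv_const] using gibbsAv_mono (c := c) (v := v) (f := fun _ => 0) h

lemma gibbsAv_le_const {a : ℝ} (h : ∀ τ : Λ → Bool, f (glue Λ τ ω) ≤ a) :
    gibbsAv Λ c v ω f ≤ a := by
  simpa [gibbsAv_const] using gibbsAv_mono (c := c) (v := v) (g := fun _ => a) h

lemma const_le_gibbsAv {a : ℝ} (h : ∀ τ : Λ → Bool, a ≤ f (glue Λ τ ω)) :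
    a ≤ gibbsAv Λ c v ω f := by
  simpa [gibbsAv_const] using gibbsAv_mono (c := c) (v := v) (f := fun _ => a) h

lemma abs_gibbsAv_le {a : ℝ} (h : ∀ τ : Λ → Bool, |f (glue Λ τ ω)| ≤ a) :
    |gibbsAv Λ c v ω f| ≤ a :=
  abs_le.2 ⟨const_le_gibbsAv fun τ => (abs_le.1 (h τ)).1,
    gibbsAv_le_const fun τ => (abs_le.1 (h τ)).2⟩

/-- Changing the field amounts to tilting the state. -/
lemma gibbsAv_field_change :
    gibbsAv Λ c v' ω f =
      gibbsAv Λ c v ω (fun σ => f σ * Real.exp (∑ i ∈ Λ, (v' i - v i) * spin (σ i))) /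
        gibbsAv Λ c v ω (fun σ => Real.exp (∑ i ∈ Λ, (v' i - v i) * spin (σ i))) := by
  have hw : ∀ σ, weight Λ c v' σ =
      Real.exp (∑ i ∈ Λ, (v' i - v i) * spin (σ i)) * weight Λ c v σ := fun σ => by
    rw [weight, weight, ← Real.exp_add]
    congr 1
    unfold energy
    simp only [sub_mul, Finset.sum_sub_distrib]
    ring
  unfold gibbsAv
  rw [div_div_div_cancel_right₀ partition_pos.ne']
  simp only [funext hw, mul_assoc]

/-! ### Consistency -/

/-- The field felt by the spins in `Λ` when the spins in `Λ' \ Λ` are frozen. -/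
noncomputable def innerField (Λ Λ' : Finset Site) (c : Site → Site → ℝ) (v : Site → ℝ)
    (σ : Config) (i : Site) : ℝ :=
  v i + ∑ j ∈ Λ' \ Λ, c i j * spin (σ j)

lemma energy_of_subset (hc : ∀ i j, c i j = c j i) (h : Λ ⊆ Λ') (σ : Config) :
    energy Λ' c v σ = energy Λ c (innerField Λ Λ' c v σ) σ + energy (Λ' \ Λ) c v σ := by
  have hs : ∀ F : Site → ℝ, ∑ i ∈ Λ', F i = ∑ i ∈ Λ, F i + ∑ i ∈ Λ' \ Λ, F i := fun F => by
    rw [add_comm, Finset.sum_sdiff h]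
  unfold energy innerField
  have e1 : ∑ i ∈ Λ' \ Λ, ∑ j ∈ Λ, c i j * spin (σ i) * spin (σ j) =
      ∑ i ∈ Λ, ∑ j ∈ Λ' \ Λ, c i j * spin (σ i) * spin (σ j) := by
    rw [Finset.sum_comm]
    exact Finset.sum_congr rfl fun i _ => Finset.sum_congr rfl fun j _ => by rw [hc j i]; ring
  have e2 : ∑ i ∈ Λ, (v i + ∑ j ∈ Λ' \ Λ, c i j * spin (σ j)) * spin (σ i) =
      ∑ i ∈ Λ, v i * spin (σ i) + ∑ i ∈ Λ, ∑ j ∈ Λ' \ Λ, c i j * spin (σ i) * spin (σ j) := by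
    rw [← Finset.sum_add_distrib]
    refine Finset.sum_congr rfl fun i _ => ?_
    rw [add_mul, Finset.sum_mul]
    congr 1
    exact Finset.sum_congr rfl fun j _ => by ring
  rw [e2]
  simp only [hs, Finset.sum_add_distrib, e1]
  ring

lemma innerField_glue (τ : Λ → Bool) (σ : Config) :
    innerField Λ Λ' c v (glue Λ τ σ) = innerField Λ Λ' c v σ := by
  ext i
  unfold innerField
  congr 1
  refine Finset.sum_congr rfl fun j hj => ?_
  rw [glue_of_notMem (Finset.mem_sdiff.1 hj).2]

lemma weight_glue_of_subset (hc : ∀ i j, c i j = c j i) (h : Λ ⊆ Λ') (τ : Λ → Bool) (σ : Config) :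
    weight Λ' c v (glue Λ τ σ) =
      weight (Λ' \ Λ) c v σ * weight Λ c (innerField Λ Λ' c v σ) (glue Λ τ σ) := by
  rw [weight, weight, weight, energy_of_subset hc h, Real.exp_add, innerField_glue, mul_comm]
  congr 2
  exact energy_congr (fun _ _ => rfl) fun i hi => glue_of_notMem (Finset.mem_sdiff.1 hi).2 _ _

/-- Consistency of the finite-volume Gibbs states. -/
lemma gibbsAv_tower (hc : ∀ i j, c i j = c j i) (h : Λ ⊆ Λ') :
    gibbsAv Λ' c v ω f =
      gibbsAv Λ' c v ω (fun σ => gibbsAv Λ c (innerField Λ Λ' c v σ) σ f) := by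
  unfold gibbsAv
  congr 1
  rw [spinSum_sdiff h, spinSum_sdiff h]
  refine spinSum_congr fun ρ => ?_
  set σ := glue (Λ' \ Λ) ρ ω
  have h1 : ∀ F : Config → ℝ, spinSum Λ (fun σ => F σ * weight Λ' c v σ) σ =
      weight (Λ' \ Λ) c v σ * spinSum Λ (fun σ' => F σ' *
        weight Λ c (innerField Λ Λ' c v σ) σ') σ := fun F => by
    rw [← spinSum_const_mul]
    refine spinSum_congr fun τ => ?_
    rw [weight_glue_of_subset hc h]
    ring
  rw [h1, h1]
  congr 1
  -- The inner expectation is constant in the spins of `Λ`, so averaging it against the inner weight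
  -- gives back `A / Z * Z`.
  set A := spinSum Λ (fun σ' => f σ' * weight Λ c (innerField Λ Λ' c v σ) σ') σ with hA
  set Z := spinSum Λ (weight Λ c (innerField Λ Λ' c v σ)) σ with hZ
  have hZ0 : Z ≠ 0 := partition_pos.ne'
  calc A = A / Z * Z := by field_simp
    _ = _ := by
      rw [hZ, ← spinSum_const_mul]
      refine spinSum_congr fun τ => ?_
      rw [innerField_glue, spinSum_glue, spinSum_glue]

/-! ### The FKG inequality -/

/-- The field part of the energy is modular, and each product of two spins is supermodular, so
nonnegative couplings give the FKG lattice condition. -/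
lemma weight_supermodular (hc : ∀ i ∈ Λ, ∀ j ∈ Λ, 0 ≤ c i j) (σ σ' : Config) :
    weight Λ c v σ * weight Λ c v σ' ≤ weight Λ c v (σ ⊓ σ') * weight Λ c v (σ ⊔ σ') := by
  simp only [weight]
  rw [← Real.exp_add, ← Real.exp_add, Real.exp_le_exp]
  have h1 : ∀ i j, spin (σ i) * spin (σ j) + spin (σ' i) * spin (σ' j) ≤
      spin ((σ ⊓ σ') i) * spin ((σ ⊓ σ') j) + spin ((σ ⊔ σ') i) * spin ((σ ⊔ σ') j) := by
    intro i j
    simp only [Pi.inf_apply, Pi.sup_apply]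
    cases σ i <;> cases σ j <;> cases σ' i <;> cases σ' j <;> norm_num [spin]
  have h2 : ∀ i, spin (σ i) + spin (σ' i) = spin ((σ ⊓ σ') i) + spin ((σ ⊔ σ') i) := by
    intro i
    simp only [Pi.inf_apply, Pi.sup_apply]
    cases σ i <;> cases σ' i <;> norm_num [spin]
  have e1 : ∑ i ∈ Λ, v i * spin (σ i) + ∑ i ∈ Λ, v i * spin (σ' i) =
      ∑ i ∈ Λ, v i * spin ((σ ⊓ σ') i) + ∑ i ∈ Λ, v i * spin ((σ ⊔ σ') i) := by
    simp only [← Finset.sum_add_distrib, ← mul_add, h2]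
  have e2 : ∑ i ∈ Λ, ∑ j ∈ Λ, c i j * spin (σ i) * spin (σ j) +
      ∑ i ∈ Λ, ∑ j ∈ Λ, c i j * spin (σ' i) * spin (σ' j) ≤
      ∑ i ∈ Λ, ∑ j ∈ Λ, c i j * spin ((σ ⊓ σ') i) * spin ((σ ⊓ σ') j) +
      ∑ i ∈ Λ, ∑ j ∈ Λ, c i j * spin ((σ ⊔ σ') i) * spin ((σ ⊔ σ') j) := by
    simp only [← Finset.sum_add_distrib, mul_assoc, ← mul_add]
    exact Finset.sum_le_sum fun i hi => Finset.sum_le_sum fun j hj =>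
      mul_le_mul_of_nonneg_left (h1 i j) (hc i hi j hj)
  unfold energy
  linarith

/-- Monotonicity is asked only in the spins of `Λ` with `ω` frozen outside. This lets the inequality
be used for functions that also depend on outer spins. -/
lemma fkg_gibbsAv (hc : ∀ i ∈ Λ, ∀ j ∈ Λ, 0 ≤ c i j)
    (hf : Monotone fun τ : Λ → Bool => f (glue Λ τ ω))
    (hg : Monotone fun τ : Λ → Bool => g (glue Λ τ ω)) :
    gibbsAv Λ c v ω f * gibbsAv Λ c v ω g ≤ gibbsAv Λ c v ω (fun σ => f σ * g σ) := by
  -- shift the functions so that they become nonnegative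
  set a := f (glue Λ ⊥ ω)
  set b := g (glue Λ ⊥ ω)
  have key := fkg (μ := fun τ : Λ → Bool => weight Λ c v (glue Λ τ ω))
    (f := fun τ : Λ → Bool => f (glue Λ τ ω) - a) (g := fun τ : Λ → Bool => g (glue Λ τ ω) - b)
    (fun τ => (weight_pos _).le) (fun τ => sub_nonneg.2 (hf bot_le))
    (fun τ => sub_nonneg.2 (hg bot_le)) (fun _ _ h => sub_le_sub_right (hf h) _)
    (fun _ _ h => sub_le_sub_right (hg h) _) (fun τ τ' => by
      have h1 : glue Λ (τ ⊓ τ') ω = glue Λ τ ω ⊓ glue Λ τ' ω := by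
        ext i; by_cases hi : i ∈ Λ <;> simp [glue, hi]
      have h2 : glue Λ (τ ⊔ τ') ω = glue Λ τ ω ⊔ glue Λ τ' ω := by
        ext i; by_cases hi : i ∈ Λ <;> simp [glue, hi]
      simpa only [h1, h2] using weight_supermodular (v := v) hc (glue Λ τ ω) (glue Λ τ' ω))
  have hZ := partition_pos (Λ := Λ) (c := c) (v := v) (ω := ω)
  have e : ∀ F : Config → ℝ, ∑ τ : Λ → Bool, weight Λ c v (glue Λ τ ω) * F (glue Λ τ ω) =
      spinSum Λ (weight Λ c v) ω * gibbsAv Λ c v ω F := fun F => by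
    rw [gibbsAv, mul_div_cancel₀ _ hZ.ne', spinSum]
    exact Finset.sum_congr rfl fun τ _ => mul_comm _ _
  have e1 := e (fun σ => f σ - a)
  have e2 := e (fun σ => g σ - b)
  have e3 := e (fun σ => (f σ - a) * (g σ - b))
  rw [e1, e2, e3] at key
  change _ ≤ spinSum Λ (weight Λ c v) ω * _ at key
  have key2 : gibbsAv Λ c v ω (fun σ => f σ - a) * gibbsAv Λ c v ω (fun σ => g σ - b) ≤
      gibbsAv Λ c v ω (fun σ => (f σ - a) * (g σ - b)) := by
    have hZ2 := mul_pos hZ hZ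
    nlinarith [key]
  have e4 : (fun σ => (f σ - a) * (g σ - b)) =
      fun σ => (f σ * g σ - a * g σ) - (b * f σ - a * b) := by ext σ; ring
  rw [e4] at key2
  simp only [gibbsAv_sub, gibbsAv_const, gibbsAv_const_mul] at key2
  nlinarith [key2]

/-- Monotonicity in the field. -/
lemma gibbsAv_mono_field (hc : ∀ i ∈ Λ, ∀ j ∈ Λ, 0 ≤ c i j) (hv : ∀ i ∈ Λ, v i ≤ v' i)
    (hf : Monotone fun τ : Λ → Bool => f (glue Λ τ ω)) :
    gibbsAv Λ c v ω f ≤ gibbsAv Λ c v' ω f := by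
  -- Raising the field tilts the state by an increasing density, so the claim is positive
  -- correlation of `f` with that density.
  rw [gibbsAv_field_change (v' := v') (v := v), le_div_iff₀]
  · refine fkg_gibbsAv hc hf fun τ τ' h => ?_
    refine Real.exp_le_exp.2 (Finset.sum_le_sum fun i hi => ?_)
    exact mul_le_mul_of_nonneg_left (spin_mono (glue_mono Λ h le_rfl i)) (sub_nonneg.2 (hv i hi))
  · exact lt_of_lt_of_le (Real.exp_pos (-∑ i ∈ Λ, |v' i - v i|)) (const_le_gibbsAv fun τ => by
      refine Real.exp_le_exp.2 ?_
      rw [← Finset.sum_neg_distrib]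
      refine Finset.sum_le_sum fun i _ => ?_
      have := neg_abs_le ((v' i - v i) * spin (glue Λ τ ω i))
      rwa [abs_mul, abs_spin, mul_one] at this)

/-- Volume monotonicity, upper bound. -/
lemma gibbsAv_volume_le (hc0 : ∀ i j, 0 ≤ c i j) (hc : ∀ i j, c i j = c j i) (h : Λ ⊆ Λ')
    (hv : ∀ i ∈ Λ, v' i + ∑ j ∈ Λ' \ Λ, c i j ≤ v i)
    (hf : Monotone f) (hfΛ : DependsOn f (Λ : Set Site)) :
    gibbsAv Λ' c v' ω f ≤ gibbsAv Λ c v ω f := by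
  rw [gibbsAv_tower hc h]
  refine gibbsAv_le_const fun ρ => ?_
  refine le_trans (gibbsAv_mono_field (v' := v) (fun i _ j _ => hc0 i j) (fun i hi => ?_)
    fun τ τ' hτ => hf (glue_mono Λ hτ le_rfl)) (le_of_eq ?_)
  · refine le_trans ?_ (hv i hi)
    unfold innerField
    gcongr with j hj
    exact mul_le_of_le_one_right (hc0 i j) (spin_le_one _)
  · exact gibbsAv_base hfΛ _ _

/-- Volume monotonicity, lower bound. -/
lemma le_gibbsAv_volume (hc0 : ∀ i j, 0 ≤ c i j) (hc : ∀ i j, c i j = c j i) (h : Λ ⊆ Λ')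
    (hv : ∀ i ∈ Λ, v i ≤ v' i - ∑ j ∈ Λ' \ Λ, c i j)
    (hf : Monotone f) (hfΛ : DependsOn f (Λ : Set Site)) :
    gibbsAv Λ c v ω f ≤ gibbsAv Λ' c v' ω f := by
  rw [gibbsAv_tower (Λ' := Λ') hc h]
  refine const_le_gibbsAv fun ρ => ?_
  refine le_trans (le_of_eq ?_) (gibbsAv_mono_field (v := v) (fun i _ j _ => hc0 i j)
    (fun i hi => ?_) fun τ τ' hτ => hf (glue_mono Λ hτ le_rfl))
  · exact gibbsAv_base hfΛ _ _
  · refine (hv i hi).trans ?_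
    unfold innerField
    rw [sub_eq_add_neg, ← Finset.sum_neg_distrib]
    gcongr with j hj
    nlinarith [hc0 i j, neg_one_le_spin (glue Λ' ρ ω j)]

/-- A function that is Lipschitz in the spins has nearly the same expectation in two states whose
magnetizations nearly agree. -/
lemma abs_gibbsAv_sub_le (hc : ∀ i ∈ Λ, ∀ j ∈ Λ, 0 ≤ c i j) (hv : ∀ i ∈ Λ, v i ≤ v' i)
    {δ : Site → ℝ}
    (hf : ∀ σ σ', |f σ - f σ'| ≤ ∑ x ∈ Λ, δ x * |spin (σ x) - spin (σ' x)|) :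
    |gibbsAv Λ c v' ω f - gibbsAv Λ c v ω f| ≤
      ∑ x ∈ Λ, δ x * (gibbsAv Λ c v' ω (fun σ => spin (σ x)) -
        gibbsAv Λ c v ω (fun σ => spin (σ x))) := by
  have habs : ∀ σ σ' : Config, σ ≤ σ' → |f σ - f σ'| ≤
      ∑ x ∈ Λ, δ x * spin (σ' x) - ∑ x ∈ Λ, δ x * spin (σ x) := fun σ σ' h => by
    refine (hf σ σ').trans (le_of_eq ?_)
    rw [← Finset.sum_sub_distrib]
    refine Finset.sum_congr rfl fun x _ => ?_
    rw [abs_sub_comm, abs_of_nonneg (sub_nonneg.2 (spin_mono (h x))), mul_sub]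
  -- Both `∑ δ x σ_x + f` and `∑ δ x σ_x - f` are increasing, because along ordered configurations
  -- `f` varies no faster than the sum. Monotonicity in the field for each gives one half of the
  -- bound.
  have h1 := gibbsAv_mono_field (ω := ω) hc hv
    (f := fun σ => ∑ x ∈ Λ, δ x * spin (σ x) + f σ) (fun τ τ' h => by
      have := abs_le.1 (habs _ _ (glue_mono Λ h (le_refl ω)))
      dsimp only
      linarith [this.2])
  have h2 := gibbsAv_mono_field (ω := ω) hc hv
    (f := fun σ => ∑ x ∈ Λ, δ x * spin (σ x) - f σ) (fun τ τ' h => by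
      have := abs_le.1 (habs _ _ (glue_mono Λ h (le_refl ω)))
      dsimp only
      linarith [this.1])
  simp only [gibbsAv_add, gibbsAv_sub, gibbsAv_sum, gibbsAv_const_mul] at h1 h2
  simp only [mul_sub, Finset.sum_sub_distrib]
  rw [abs_le]
  constructor <;> linarith

/-! ### The Griffiths inequalities -/

/-- The pointwise product of two spin configurations. -/
def spinMul (σ τ : Config) : Config := fun i => σ i == τ i

/-- Characters of the group of spin configurations. -/
structure IsChar (χ : Config → ℝ) : Prop where
  eq_or : ∀ σ, χ σ = 1 ∨ χ σ = -1
  map_mul : ∀ σ τ, χ (spinMul σ τ) = χ σ * χ τ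

lemma IsChar.mul {χ ψ : Config → ℝ} (hχ : IsChar χ) (hψ : IsChar ψ) :
    IsChar fun σ => χ σ * ψ σ where
  eq_or σ := by rcases hχ.eq_or σ with h | h <;> rcases hψ.eq_or σ with h' | h' <;> simp [h, h']
  map_mul σ τ := by rw [hχ.map_mul, hψ.map_mul]; ring

lemma isChar_one : IsChar fun _ => 1 where
  eq_or _ := Or.inl rfl
  map_mul _ _ := by norm_num

lemma isChar_spin (i : Site) : IsChar fun σ => spin (σ i) where
  eq_or σ := spin_eq_or _
  map_mul σ τ := by
    simp only [spinMul]
    cases σ i <;> cases τ i <;> simp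

/-- The cone of nonnegative combinations of characters. -/
noncomputable def charCone : AddSubmonoid (Config → ℝ) :=
  AddSubmonoid.closure {f | ∃ a : ℝ, 0 ≤ a ∧ ∃ χ, IsChar χ ∧ f = fun σ => a * χ σ}

lemma mem_charCone_of_isChar {a : ℝ} (ha : 0 ≤ a) {χ : Config → ℝ} (hχ : IsChar χ) :
    (fun σ => a * χ σ) ∈ charCone :=
  AddSubmonoid.subset_closure ⟨a, ha, χ, hχ, rfl⟩

lemma spin_mem_charCone (i : Site) : (fun σ => spin (σ i)) ∈ charCone := by
  simpa using mem_charCone_of_isChar zero_le_one (isChar_spin i)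

lemma const_mem_charCone {a : ℝ} (ha : 0 ≤ a) : (fun _ => a) ∈ charCone := by
  simpa using mem_charCone_of_isChar ha isChar_one

lemma charCone_mul {f g : Config → ℝ} (hf : f ∈ charCone) (hg : g ∈ charCone) :
    f * g ∈ charCone := by
  induction hf using AddSubmonoid.closure_induction with
  | mem f hf =>
    obtain ⟨a, ha, χ, hχ, rfl⟩ := hf
    induction hg using AddSubmonoid.closure_induction with
    | mem g hg =>
      obtain ⟨b, hb, ψ, hψ, rfl⟩ := hg
      convert mem_charCone_of_isChar (mul_nonneg ha hb) (hχ.mul hψ) using 1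
      ext σ; simp only [Pi.mul_apply]; ring
    | zero => simp [charCone.zero_mem]
    | add g g' _ _ h h' => rw [mul_add]; exact add_mem h h'
  | zero => simp [charCone.zero_mem]
  | add f f' _ _ h h' => rw [add_mul]; exact add_mem h h'

lemma charCone_const_mul {a : ℝ} (ha : 0 ≤ a) {f : Config → ℝ} (hf : f ∈ charCone) :
    (fun σ => a * f σ) ∈ charCone := charCone_mul (const_mem_charCone ha) hf

lemma charCone_pow {f : Config → ℝ} (hf : f ∈ charCone) (n : ℕ) : f ^ n ∈ charCone := by
  induction n with
  | zero => rw [pow_zero]; exact const_mem_charCone zero_le_one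
  | succ n ih => rw [pow_succ]; exact charCone_mul ih hf

lemma charCone_sum {ι : Type*} {s : Finset ι} {F : ι → Config → ℝ}
    (h : ∀ i ∈ s, F i ∈ charCone) : (fun σ => ∑ i ∈ s, F i σ) ∈ charCone := by
  convert sum_mem h using 1
  ext σ; simp

/-- A character takes only the values ±1, so `exp (a χ) = cosh a + χ sinh a`; sums in the exponent
become products. -/
lemma charCone_exp {f : Config → ℝ} (hf : f ∈ charCone) :
    (fun σ => Real.exp (f σ)) ∈ charCone := by
  induction hf using AddSubmonoid.closure_induction with
  | mem f hf =>
    obtain ⟨a, ha, χ, hχ, rfl⟩ := hf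
    have : (fun σ => Real.exp (a * χ σ)) =
        (fun _ => Real.cosh a) + fun σ => Real.sinh a * χ σ := by
      ext σ
      rcases hχ.eq_or σ with h | h
      · simp [h, Real.cosh_add_sinh]
      · simp [h, ← Real.cosh_sub_sinh, sub_eq_add_neg]
    rw [this]
    exact add_mem (const_mem_charCone (Real.cosh_pos a).le)
      (mem_charCone_of_isChar (Real.sinh_nonneg_iff.2 ha) hχ)
  | zero => simpa using const_mem_charCone zero_le_one
  | add f f' _ _ h h' =>
    convert charCone_mul h h' using 1
    ext σ; simp [Real.exp_add]

/-- Translation by `ρ` multiplies a character by `χ ρ = ±1`, so the coefficients acquire the factor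
`1 + χ ρ ≥ 0`. Together with the corresponding difference, with factor `1 - χ ρ`, this is what the
duplicated system needs. -/
lemma charCone_add_translate {f : Config → ℝ} (hf : f ∈ charCone) (ρ : Config) :
    (fun σ => f σ + f (spinMul σ ρ)) ∈ charCone := by
  induction hf using AddSubmonoid.closure_induction with
  | mem f hf =>
    obtain ⟨a, ha, χ, hχ, rfl⟩ := hf
    convert mem_charCone_of_isChar (a := a * (1 + χ ρ)) (mul_nonneg ha ?_) hχ using 1
    · ext σ; simp only [hχ.map_mul]; ring
    · rcases hχ.eq_or ρ with h | h <;> norm_num [h]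
  | zero => simpa using const_mem_charCone le_rfl
  | add f f' _ _ h h' =>
    convert add_mem h h' using 1
    ext σ; simp only [Pi.add_apply]; ring

lemma charCone_sub_translate {f : Config → ℝ} (hf : f ∈ charCone) (ρ : Config) :
    (fun σ => f σ - f (spinMul σ ρ)) ∈ charCone := by
  induction hf using AddSubmonoid.closure_induction with
  | mem f hf =>
    obtain ⟨a, ha, χ, hχ, rfl⟩ := hf
    convert mem_charCone_of_isChar (a := a * (1 - χ ρ)) (mul_nonneg ha ?_) hχ using 1
    · ext σ; simp only [hχ.map_mul]; ring
    · rcases hχ.eq_or ρ with h | h <;> norm_num [h]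
  | zero => simpa using const_mem_charCone le_rfl
  | add f f' _ _ h h' =>
    convert add_mem h h' using 1
    ext σ; simp only [Pi.add_apply]; ring

/-- Multiplication by a fixed spin configuration in a finite volume. -/
def spinMulEquiv {ι : Type*} (τ : ι → Bool) : (ι → Bool) ≃ (ι → Bool) :=
  Function.Involutive.toPerm (fun ρ i => τ i == ρ i) fun ρ => by
    ext i; change (τ i == (τ i == ρ i)) = ρ i; cases τ i <;> cases ρ i <;> rfl

lemma glue_spinMulEquiv (Λ : Finset Site) (τ ρ : Λ → Bool) :
    glue Λ (spinMulEquiv τ ρ) plusConfig =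
      spinMul (glue Λ τ plusConfig) (glue Λ ρ plusConfig) := by
  ext i
  by_cases hi : i ∈ Λ
  · simp only [glue, spinMul, hi, dif_pos]
    rfl
  · simp [glue, spinMul, hi, plusConfig]

/-- The first Griffiths inequality. -/
lemma spinSum_nonneg_of_mem_charCone {Λ : Finset Site} {f : Config → ℝ} (hf : f ∈ charCone) :
    0 ≤ spinSum Λ f plusConfig := by
  induction hf using AddSubmonoid.closure_induction with
  | mem f hf =>
    obtain ⟨a, ha, χ, hχ, rfl⟩ := hf
    rw [spinSum_const_mul]
    refine mul_nonneg ha ?_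
    -- Either the character is identically 1 on the volume, or translating by some `τ` with value -1
    -- shows that its sum equals its own negative.
    by_cases h : ∀ τ : Λ → Bool, χ (glue Λ τ plusConfig) = 1
    · exact spinSum_nonneg fun τ => by rw [h τ]; norm_num
    · push Not at h
      obtain ⟨τ, hτ⟩ := h
      have hτ' := (hχ.eq_or (glue Λ τ plusConfig)).resolve_left hτ
      have : spinSum Λ χ plusConfig = -spinSum Λ χ plusConfig := by
        conv_lhs => rw [spinSum, ← Equiv.sum_comp (spinMulEquiv τ)]
        simp only [glue_spinMulEquiv, hχ.map_mul, hτ', ← Finset.mul_sum]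
        simp [spinSum]
      linarith
  | zero => simp [spinSum]
  | add f f' _ _ h h' =>
    have := spinSum_add Λ f f' plusConfig
    change 0 ≤ spinSum Λ (fun σ => f σ + f' σ) plusConfig
    linarith

/-- The second Griffiths inequality. -/
lemma spinSum_mul_le_of_mem_charCone {Λ : Finset Site} {f g h : Config → ℝ} (hf : f ∈ charCone)
    (hg : g ∈ charCone) (hh : h ∈ charCone) :
    spinSum Λ (fun σ => f σ * Real.exp (h σ)) plusConfig *
        spinSum Λ (fun σ => g σ * Real.exp (h σ)) plusConfig ≤
      spinSum Λ (fun σ => f σ * g σ * Real.exp (h σ)) plusConfig *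
        spinSum Λ (fun σ => Real.exp (h σ)) plusConfig := by
  set G : (Λ → Bool) → Config := fun τ => glue Λ τ plusConfig
  -- Ginibre's duplication: the second copy is written as the first one times `ρ`. For fixed `ρ` the
  -- summand is then an element of the cone in the first copy.
  have key : ∀ ρ : Λ → Bool, 0 ≤ ∑ τ : Λ → Bool, f (G τ) * (g (G τ) - g (spinMul (G τ) (G ρ))) *
      Real.exp (h (G τ) + h (spinMul (G τ) (G ρ))) := fun ρ =>
    spinSum_nonneg_of_mem_charCone (Λ := Λ) (charCone_mul
      (charCone_mul hf (charCone_sub_translate hg (G ρ)))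
      (charCone_exp (charCone_add_translate hh (G ρ))))
  have tot : 0 ≤ ∑ τ : Λ → Bool, ∑ τ' : Λ → Bool, f (G τ) * (g (G τ) - g (G τ')) *
      Real.exp (h (G τ) + h (G τ')) := by
    have : ∀ τ : Λ → Bool, ∑ τ' : Λ → Bool, f (G τ) * (g (G τ) - g (G τ')) *
        Real.exp (h (G τ) + h (G τ')) = ∑ ρ : Λ → Bool, f (G τ) *
        (g (G τ) - g (spinMul (G τ) (G ρ))) *
        Real.exp (h (G τ) + h (spinMul (G τ) (G ρ))) := fun τ => by
      rw [← Equiv.sum_comp (spinMulEquiv τ)]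
      simp only [G, glue_spinMulEquiv]
    simp only [this]
    rw [Finset.sum_comm]
    exact Finset.sum_nonneg fun ρ _ => key ρ
  have e : ∑ τ : Λ → Bool, ∑ τ' : Λ → Bool, f (G τ) * (g (G τ) - g (G τ')) *
      Real.exp (h (G τ) + h (G τ')) =
      spinSum Λ (fun σ => f σ * g σ * Real.exp (h σ)) plusConfig *
        spinSum Λ (fun σ => Real.exp (h σ)) plusConfig -
      spinSum Λ (fun σ => f σ * Real.exp (h σ)) plusConfig *
        spinSum Λ (fun σ => g σ * Real.exp (h σ)) plusConfig := by
    simp only [spinSum, Finset.sum_mul_sum, ← Finset.sum_sub_distrib]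
    refine Finset.sum_congr rfl fun τ _ => Finset.sum_congr rfl fun τ' _ => ?_
    simp only [G, Real.exp_add]
    ring
  linarith

variable {Λ : Finset Site} {c c' : Site → Site → ℝ} {v v' : Site → ℝ} {f : Config → ℝ}

lemma energy_mem_charCone (hc : ∀ i ∈ Λ, ∀ j ∈ Λ, 0 ≤ c i j) (hv : ∀ i ∈ Λ, 0 ≤ v i) :
    energy Λ c v ∈ charCone := by
  have h1 : (fun σ : Config => (1 / 2 : ℝ) *
      ∑ i ∈ Λ, ∑ j ∈ Λ, c i j * spin (σ i) * spin (σ j)) ∈ charCone := by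
    refine charCone_const_mul (by norm_num) (charCone_sum fun i hi => charCone_sum fun j hj => ?_)
    simpa only [mul_assoc] using
      mem_charCone_of_isChar (hc i hi j hj) ((isChar_spin i).mul (isChar_spin j))
  have h2 : (fun σ : Config => ∑ i ∈ Λ, v i * spin (σ i)) ∈ charCone :=
    charCone_sum fun i hi => mem_charCone_of_isChar (hv i hi) (isChar_spin i)
  exact add_mem h1 h2

/-- The first Griffiths inequality for Gibbs states. -/
lemma gibbsAv_nonneg_of_mem_charCone (hc : ∀ i ∈ Λ, ∀ j ∈ Λ, 0 ≤ c i j)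
    (hv : ∀ i ∈ Λ, 0 ≤ v i) (hf : f ∈ charCone) : 0 ≤ gibbsAv Λ c v plusConfig f :=
  div_nonneg (spinSum_nonneg_of_mem_charCone
    (charCone_mul hf (charCone_exp (energy_mem_charCone hc hv)))) partition_pos.le

/-- Expectations of elements of the cone increase with the couplings and the field. -/
lemma gibbsAv_mono_coupling (hc' : ∀ i ∈ Λ, ∀ j ∈ Λ, 0 ≤ c' i j) (hv' : ∀ i ∈ Λ, 0 ≤ v' i)
    (hc : ∀ i ∈ Λ, ∀ j ∈ Λ, c' i j ≤ c i j) (hv : ∀ i ∈ Λ, v' i ≤ v i) (hf : f ∈ charCone) :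
    gibbsAv Λ c' v' plusConfig f ≤ gibbsAv Λ c v plusConfig f := by
  have hE : ∀ σ, energy Λ c v σ = energy Λ c' v' σ +
      energy Λ (fun i j => c i j - c' i j) (fun i => v i - v' i) σ := fun σ => by
    unfold energy
    simp only [sub_mul, Finset.sum_sub_distrib]
    ring
  -- The added couplings and fields enter as the factor `exp (energy difference)`, which lies in the
  -- cone; the claim is its nonnegative correlation with `f`.
  have key := spinSum_mul_le_of_mem_charCone (Λ := Λ) hf (charCone_exp (energy_mem_charCone
    (Λ := Λ) (c := fun i j => c i j - c' i j) (v := fun i => v i - v' i)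
    (fun i hi j hj => sub_nonneg.2 (hc i hi j hj)) fun i hi => sub_nonneg.2 (hv i hi)))
    (energy_mem_charCone (Λ := Λ) hc' hv')
  have hw : weight Λ c v = fun σ => Real.exp (energy Λ (fun i j => c i j - c' i j)
      (fun i => v i - v' i) σ) * Real.exp (energy Λ c' v' σ) := by
    ext σ; rw [weight, hE, Real.exp_add, mul_comm]
  unfold gibbsAv
  rw [div_le_div_iff₀ partition_pos partition_pos]
  simp only [hw, ← mul_assoc]
  exact key

/-- For `X` in the cone, `⟨sinh X⟩ ≥ ⟨X⟩`. -/
lemma gibbsAv_le_gibbsAv_sinh (hc : ∀ i ∈ Λ, ∀ j ∈ Λ, 0 ≤ c i j) (hv : ∀ i ∈ Λ, 0 ≤ v i)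
    (hf : f ∈ charCone) :
    gibbsAv Λ c v plusConfig f ≤ gibbsAv Λ c v plusConfig (fun σ => Real.sinh (f σ)) := by
  have hs : HasSum (fun n : ℕ => gibbsAv Λ c v plusConfig
      (fun σ => f σ ^ (2 * n + 1) / (2 * n + 1).factorial))
      (gibbsAv Λ c v plusConfig (fun σ => Real.sinh (f σ))) := by
    unfold gibbsAv
    refine HasSum.div_const ?_ _
    unfold spinSum
    exact hasSum_sum fun τ _ => (Real.hasSum_sinh _).mul_right _
  -- All terms of the sinh series have nonnegative expectation, and the term of order 0 is `f`
  -- itself.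
  have h0 := le_hasSum hs 0 fun n _ => gibbsAv_nonneg_of_mem_charCone hc hv (by
    have := charCone_const_mul (a := ((2 * n + 1).factorial : ℝ)⁻¹) (by positivity)
      (charCone_pow hf (2 * n + 1))
    simpa only [div_eq_inv_mul, Pi.pow_apply] using this)
  simpa using h0

/-! ### Contours on the square lattice

An edge of `ℤ²` is encoded by its lower left endpoint and its direction (`true` for horizontal). -/

/-- The edges of `ℤ²`. -/
abbrev Edge := Site × Bool

/-- The upper right endpoint of an edge. -/
def Edge.head (e : Edge) : Site :=
  if e.2 then (e.1.1 + 1, e.1.2) else (e.1.1, e.1.2 + 1)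

@[simp] lemma Edge.head_true (p : Site) : Edge.head (p, true) = (p.1 + 1, p.2) := by
  simp [Edge.head]

@[simp] lemma Edge.head_false (p : Site) : Edge.head (p, false) = (p.1, p.2 + 1) := by
  simp [Edge.head]

/-- The edge boundary of a finite set of sites. -/
def edgeCut (C : Finset Site) : Finset Edge :=
  (C.biUnion fun p => {(p, true), (p, false), ((p.1 - 1, p.2), true),
    ((p.1, p.2 - 1), false)}).filter fun e => ¬ (e.1 ∈ C ↔ e.head ∈ C)

lemma mem_edgeCut {C : Finset Site} {e : Edge} : e ∈ edgeCut C ↔ ¬ (e.1 ∈ C ↔ e.head ∈ C) := by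
  simp only [edgeCut, Finset.mem_filter, and_iff_right_iff_imp]
  intro h
  obtain ⟨⟨a, b⟩, d⟩ := e
  rw [Finset.mem_biUnion]
  by_cases hC : (a, b) ∈ C
  · exact ⟨_, hC, by cases d <;> simp⟩
  · have h2 : Edge.head ((a, b), d) ∈ C := by tauto
    exact ⟨_, h2, by cases d <;> simp⟩

/-- The indicator function of a set of edges modulo 2. -/
def edgeInd (Q : Finset Edge) (e : Edge) : ZMod 2 := if e ∈ Q then 1 else 0

/-- The indicator function of a set of sites modulo 2. -/
def siteInd (C : Finset Site) (p : Site) : ZMod 2 := if p ∈ C then 1 else 0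

lemma edgeInd_edgeCut (C : Finset Site) (e : Edge) :
    edgeInd (edgeCut C) e = siteInd C e.head - siteInd C e.1 := by
  simp only [edgeInd, siteInd, mem_edgeCut]
  by_cases h1 : e.1 ∈ C <;> by_cases h2 : e.head ∈ C <;> simp [h1, h2]

/-- A set of edges meets every plaquette in an even number of edges. -/
def IsPlaquetteEven (Q : Finset Edge) : Prop :=
  ∀ p : Site, edgeInd Q (p, true) + edgeInd Q ((p.1 + 1, p.2), false) =
    edgeInd Q (p, false) + edgeInd Q ((p.1, p.2 + 1), true)

lemma isPlaquetteEven_edgeCut (C : Finset Site) : IsPlaquetteEven (edgeCut C) := by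
  intro p
  simp only [edgeInd_edgeCut, Edge.head_true, Edge.head_false]
  ring

/-- The parity of the number of horizontal edges of `Q` to the left of `p` and right of `A`. -/
noncomputable def leftParity (A : ℤ) (Q : Finset Edge) (p : Site) : ZMod 2 :=
  ∑ a ∈ Finset.Ico A p.1, edgeInd Q ((a, p.2), true)

variable {A₀ A₁ B₀ B₁ : ℤ}

/-- The rectangle `[A₀, A₁] × [B₀, B₁]`. -/
noncomputable def rect (A₀ A₁ B₀ B₁ : ℤ) : Finset Site := Finset.Icc A₀ A₁ ×ˢ Finset.Icc B₀ B₁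

lemma mem_rect {p : Site} :
    p ∈ rect A₀ A₁ B₀ B₁ ↔ (A₀ ≤ p.1 ∧ p.1 ≤ A₁) ∧ (B₀ ≤ p.2 ∧ p.2 ≤ B₁) := by
  simp [rect]

/-- The edges of `Q` have an endpoint in the rectangle. -/
def TouchesRect (A₀ A₁ B₀ B₁ : ℤ) (Q : Finset Edge) : Prop :=
  ∀ e ∈ Q, e.1 ∈ rect A₀ A₁ B₀ B₁ ∨ e.head ∈ rect A₀ A₁ B₀ B₁

lemma touchesRect_edgeCut {C : Finset Site} (hC : C ⊆ rect A₀ A₁ B₀ B₁) :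
    TouchesRect A₀ A₁ B₀ B₁ (edgeCut C) := by
  intro e he
  rw [mem_edgeCut] at he
  by_cases h : e.1 ∈ C
  · exact Or.inl (hC h)
  · exact Or.inr (hC (by tauto))

/-- The sum telescopes along the row; the starting column `A₀ - 1` lies outside `C`. So a finite set
can be recovered from its edge boundary. -/
lemma leftParity_edgeCut {C : Finset Site} (hC : C ⊆ rect A₀ A₁ B₀ B₁) (p : Site) :
    leftParity (A₀ - 1) (edgeCut C) p = siteInd C p := by
  have h0 : ∀ a b : ℤ, a < A₀ → siteInd C (a, b) = 0 := fun a b ha => by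
    simp only [siteInd]
    rw [if_neg]
    intro h
    have := mem_rect.1 (hC h)
    simp at this
    omega
  obtain ⟨a, b⟩ := p
  rcases lt_or_ge a A₀ with h | h
  · rw [h0 a b h, leftParity, Finset.Ico_eq_empty (by simp; omega), Finset.sum_empty]
  · simp only [leftParity, edgeInd_edgeCut, Edge.head_true]
    have : ∀ a, A₀ - 1 ≤ a → ∑ a' ∈ Finset.Ico (A₀ - 1) a,
        (siteInd C (a' + 1, b) - siteInd C (a', b)) = siteInd C (a, b) := by
      intro a ha
      induction a, ha using Int.leInduction with
      | base => rw [Finset.Ico_self, Finset.sum_empty, h0 _ _ (by omega)]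
      | succ n hn ih =>
        have : Finset.Ico (A₀ - 1) (n + 1) = insert n (Finset.Ico (A₀ - 1) n) := by
          ext x; simp; omega
        rw [this, Finset.sum_insert (by simp), ih]
        ring
    exact this a (by omega)

lemma leftParity_add_one {Q : Finset Edge} (hQ : TouchesRect A₀ A₁ B₀ B₁ Q) (a b : ℤ) :
    leftParity (A₀ - 1) Q (a + 1, b) =
      leftParity (A₀ - 1) Q (a, b) + edgeInd Q ((a, b), true) := by
  simp only [leftParity]
  rcases lt_or_ge a (A₀ - 1) with h | h
  · have : edgeInd Q ((a, b), true) = 0 := if_neg fun he => by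
      rcases hQ _ he with h | h <;> rw [mem_rect] at h <;> simp at h <;> omega
    rw [this, Finset.Ico_eq_empty (by omega), Finset.Ico_eq_empty (by omega)]
    simp
  · have : Finset.Ico (A₀ - 1) (a + 1) = insert a (Finset.Ico (A₀ - 1) a) := by
      ext x; simp; omega
    rw [this, Finset.sum_insert (by simp), add_comm]

/-- Induction along the row, starting left of the rectangle where all terms vanish; evenness of one
plaquette advances the identity by one column. -/
lemma leftParity_up {Q : Finset Edge} (hQ : TouchesRect A₀ A₁ B₀ B₁ Q) (hev : IsPlaquetteEven Q)
    (a b : ℤ) :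
    leftParity (A₀ - 1) Q (a, b + 1) =
      leftParity (A₀ - 1) Q (a, b) + edgeInd Q ((a, b), false) := by
  have h0 : ∀ a b, a ≤ A₀ - 1 → leftParity (A₀ - 1) Q (a, b) = 0 := fun a b ha => by
    rw [leftParity, Finset.Ico_eq_empty (by simp; omega), Finset.sum_empty]
  rcases le_or_gt a (A₀ - 1) with h | h
  · have : edgeInd Q ((a, b), false) = 0 := if_neg fun he => by
      rcases hQ _ he with h | h <;> rw [mem_rect] at h <;> simp at h <;> omega
    rw [this, h0 _ _ h, h0 _ _ h, add_zero]
  · have : ∀ a, A₀ - 1 ≤ a → leftParity (A₀ - 1) Q (a, b + 1) =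
      leftParity (A₀ - 1) Q (a, b) + edgeInd Q ((a, b), false) := by
      intro a ha
      induction a, ha using Int.leInduction with
      | base =>
        have : edgeInd Q ((A₀ - 1, b), false) = 0 := if_neg fun he => by
          rcases hQ _ he with h | h <;> rw [mem_rect] at h <;> simp at h
        rw [this, h0 _ _ le_rfl, h0 _ _ le_rfl, add_zero]
      | succ n hn ih =>
        rw [leftParity_add_one hQ, leftParity_add_one hQ, ih]
        have := hev (n, b)
        simp only at this
        rw [add_assoc, ← this]
        ring
    exact this a h.le

/-- A set of edges that meets every plaquette evenly is the boundary of a finite set of sites. -/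
lemma exists_edgeCut_eq {Q : Finset Edge} (hQ : TouchesRect A₀ A₁ B₀ B₁ Q)
    (hev : IsPlaquetteEven Q) :
    ∃ C ⊆ rect A₀ A₁ B₀ B₁, edgeCut C = Q ∧ ∀ p, leftParity (A₀ - 1) Q p = siteInd C p := by
  have hz : ∀ z : ZMod 2, z ≠ 0 → z = 1 := by decide
  have hsupp : ∀ p, leftParity (A₀ - 1) Q p ≠ 0 → p ∈ rect A₀ A₁ B₀ B₁ := by
    have hrow : ∀ p, leftParity (A₀ - 1) Q p ≠ 0 → A₀ ≤ p.1 ∧ B₀ ≤ p.2 ∧ p.2 ≤ B₁ := by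
      intro p hp
      obtain ⟨a, ha, hne⟩ := Finset.exists_ne_zero_of_sum_ne_zero hp
      have he : ((a, p.2), true) ∈ Q := by
        by_contra h; exact hne (if_neg h)
      rw [Finset.mem_Ico] at ha
      rcases hQ _ he with h | h <;> rw [mem_rect] at h <;> simp at h <;> omega
    rintro ⟨a, b⟩ hp
    have h1 := hrow _ hp
    rw [mem_rect]
    simp only at h1 ⊢
    refine ⟨⟨h1.1, ?_⟩, h1.2⟩
    by_contra ha
    -- To the right of `A₁` there are no vertical edges of `Q`, so a nonzero parity would propagate
    -- upwards into the row `B₁ + 1`, which contains no horizontal edge of `Q`.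
    have hcol : ∀ b', b ≤ b' → leftParity (A₀ - 1) Q (a, b') ≠ 0 := by
      intro b' hb'
      induction b', hb' using Int.leInduction with
      | base => exact hp
      | succ n hn ih =>
        rw [leftParity_up hQ hev]
        have : edgeInd Q ((a, n), false) = 0 := if_neg fun he => by
          rcases hQ _ he with h | h <;> rw [mem_rect] at h <;> simp at h <;> omega
        rwa [this, add_zero]
    have := hrow _ (hcol (B₁ + 1) (by omega))
    simp at this
  let C := (rect A₀ A₁ B₀ B₁).filter fun p => leftParity (A₀ - 1) Q p ≠ 0
  have hC : ∀ p, leftParity (A₀ - 1) Q p = siteInd C p := fun p => by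
    by_cases h : leftParity (A₀ - 1) Q p = 0
    · simp [siteInd, C, h]
    · rw [siteInd, if_pos (Finset.mem_filter.2 ⟨hsupp p h, h⟩), hz _ h]
  refine ⟨C, Finset.filter_subset _ _, ?_, hC⟩
  ext e
  have h1 : edgeInd (edgeCut C) e = edgeInd Q e := by
    rw [edgeInd_edgeCut, ← hC, ← hC]
    obtain ⟨⟨a, b⟩, d⟩ := e
    cases d
    · rw [Edge.head_false]; simp only; rw [leftParity_up hQ hev]; ring
    · rw [Edge.head_true]; simp only; rw [leftParity_add_one hQ]; ring
  by_cases h2 : e ∈ edgeCut C <;> by_cases h3 : e ∈ Q <;> simp_all [edgeInd]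

/-- Two edges are near if their base points differ by at most one in each coordinate. -/
def Edge.Near (e e' : Edge) : Prop := |e.1.1 - e'.1.1| ≤ 1 ∧ |e.1.2 - e'.1.2| ≤ 1

/-- A set of edges that is connected with respect to nearness. -/
def NearConnected (Q : Finset Edge) : Prop :=
  ∀ P ⊆ Q, P.Nonempty → (Q \ P).Nonempty → ∃ e ∈ P, ∃ e' ∈ Q \ P, e.Near e'

/-- Every site of `M` is enclosed by a connected contour contained in the boundary of `M`. -/
lemma exists_contour {M : Finset Site} (hM : M ⊆ rect A₀ A₁ B₀ B₁) {x : Site} (hx : x ∈ M) :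
    ∃ C ⊆ rect A₀ A₁ B₀ B₁, x ∈ C ∧ edgeCut C ⊆ edgeCut M ∧ NearConnected (edgeCut C) := by
  classical
  -- Among the sets containing `x` whose boundary lies in that of `M`, one with the shortest
  -- boundary has a connected boundary. Otherwise the boundary splits into two parts, each itself
  -- the boundary of a set, and one of these sets contains `x` and has a shorter boundary.
  let 𝒮 := (rect A₀ A₁ B₀ B₁).powerset.filter fun C => x ∈ C ∧ edgeCut C ⊆ edgeCut M
  have hne : 𝒮.Nonempty := ⟨M, by simp [𝒮, hM, hx]⟩
  obtain ⟨C, hC, hmin⟩ := Finset.exists_min_image 𝒮 (fun C => (edgeCut C).card) hne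
  simp only [𝒮, Finset.mem_filter, Finset.mem_powerset] at hC hmin
  obtain ⟨hCr, hxC, hCM⟩ := hC
  refine ⟨C, hCr, hxC, hCM, ?_⟩
  intro P hP hP1 hP2
  by_contra hcon
  push Not at hcon
  have htouch := touchesRect_edgeCut hCr
  have hev := isPlaquetteEven_edgeCut C
  -- each of the two parts is plaquette-even
  have hsum : ∀ e, edgeInd P e + edgeInd (edgeCut C \ P) e = edgeInd (edgeCut C) e := fun e => by
    by_cases h1 : e ∈ P
    · simp [edgeInd, h1, hP h1]
    · simp [edgeInd, h1]
  -- The four edges of a plaquette are pairwise near, so the boundary edges among them all belong to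
  -- the same part.
  have hloc : ∀ p : Site, (∀ e ∈ ({(p, true), ((p.1 + 1, p.2), false), (p, false),
      ((p.1, p.2 + 1), true)} : Finset Edge), edgeInd P e = 0) ∨
      ∀ e ∈ ({(p, true), ((p.1 + 1, p.2), false), (p, false),
      ((p.1, p.2 + 1), true)} : Finset Edge), edgeInd P e = edgeInd (edgeCut C) e := by
    intro p
    by_contra hcon2
    push Not at hcon2
    obtain ⟨⟨e, he, he1⟩, e', he', he1'⟩ := hcon2
    have heP : e ∈ P := by by_contra h; exact he1 (if_neg h)
    have heP' : e' ∈ edgeCut C \ P := by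
      by_contra h
      have := hsum e'
      rw [show edgeInd (edgeCut C \ P) e' = 0 from if_neg h, add_zero] at this
      exact he1' this
    refine hcon e heP e' heP' ?_
    simp only [Finset.mem_insert, Finset.mem_singleton] at he he'
    rcases he with rfl | rfl | rfl | rfl <;> rcases he' with rfl | rfl | rfl | rfl <;>
      simp [Edge.Near]
  have hevP : IsPlaquetteEven P := by
    intro p
    rcases hloc p with h | h
    · rw [h _ (by simp), h _ (by simp), h _ (by simp), h _ (by simp)]
    · rw [h _ (by simp), h _ (by simp), h _ (by simp), h _ (by simp)]
      exact hev p
  have hevP' : IsPlaquetteEven (edgeCut C \ P) := by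
    intro p
    have h1 := hev p
    have h2 := hevP p
    simp only [← hsum] at h1
    linear_combination h1 - h2
  obtain ⟨C₁, hC₁, hcut₁, hpar₁⟩ := exists_edgeCut_eq
    (fun e he => htouch e (hP he)) hevP
  obtain ⟨C₂, hC₂, hcut₂, hpar₂⟩ := exists_edgeCut_eq
    (fun e he => htouch e (Finset.sdiff_subset he)) hevP'
  have hxsum : siteInd C₁ x + siteInd C₂ x = siteInd C x := by
    rw [← hpar₁, ← hpar₂, ← leftParity_edgeCut hCr]
    simp only [leftParity, ← Finset.sum_add_distrib, hsum]
  -- The two parities at `x` add up to 1 modulo 2.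
  have hxor : x ∈ C₁ ∨ x ∈ C₂ := by
    by_contra h
    push Not at h
    simp [siteInd, h.1, h.2, hxC] at hxsum
  rcases hxor with h | h
  · have := hmin C₁ ⟨hC₁, h, by rw [hcut₁]; exact hP.trans hCM⟩
    rw [hcut₁] at this
    have h3 := Finset.card_sdiff_add_card_eq_card hP
    have h4 := hP2.card_pos
    omega
  · have := hmin C₂ ⟨hC₂, h, by rw [hcut₂]; exact Finset.sdiff_subset.trans hCM⟩
    rw [hcut₂] at this
    have h3 := Finset.card_sdiff_add_card_eq_card hP
    have h4 := hP1.card_pos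
    omega

/-! ### Counting contours -/

/-- The labels of the steps of a walk on edges. -/
abbrev StepLabel := Fin 3 × Fin 3 × Bool

/-- The edge reached from `e` by the step `l`. -/
def Edge.step (e : Edge) (l : StepLabel) : Edge :=
  ((e.1.1 + (l.1 : ℤ) - 1, e.1.2 + (l.2.1 : ℤ) - 1), l.2.2)

lemma Edge.Near.exists_step {e e' : Edge} (h : e.Near e') : ∃ l, e.step l = e' := by
  obtain ⟨⟨a, b⟩, d⟩ := e
  obtain ⟨⟨a', b'⟩, d'⟩ := e'
  obtain ⟨h1, h2⟩ := h
  rw [abs_le] at h1 h2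
  simp only at h1 h2
  refine ⟨(⟨(a' - a + 1).toNat, by omega⟩, ⟨(b' - b + 1).toNat, by omega⟩, d'), ?_⟩
  simp only [Edge.step, Prod.mk.injEq, and_true]
  omega

lemma Edge.Near.symm {e e' : Edge} (h : e.Near e') : e'.Near e := by
  simpa only [Edge.Near, abs_sub_comm] using h

/-- The set of edges visited by a walk. -/
def visited : Edge → List StepLabel → Finset Edge
  | e, [] => {e}
  | e, l :: ls => insert e (visited (e.step l) ls)

lemma mem_visited_self (e : Edge) (ls : List StepLabel) : e ∈ visited e ls := by
  cases ls <;> simp [visited]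

/-- At a visit to `u` the walk makes an excursion to `u'` and back: two more steps, one more edge.
-/
lemma exists_detour {e u u' : Edge} {ls : List StepLabel} (hu : u ∈ visited e ls)
    (h : u.Near u') :
    ∃ ls' : List StepLabel, ls'.length = ls.length + 2 ∧
      visited e ls' = insert u' (visited e ls) := by
  by_cases hue : u = e
  · subst hue
    obtain ⟨l, hl⟩ := h.exists_step
    obtain ⟨l', hl'⟩ := h.symm.exists_step
    refine ⟨l :: l' :: ls, by simp, ?_⟩
    simp only [visited, hl, hl']
    rw [Finset.insert_comm, Finset.insert_eq_of_mem (mem_visited_self u ls)]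
  · induction ls generalizing e with
    | nil => simp [visited] at hu; exact absurd hu hue
    | cons l ls ih =>
      simp only [visited, Finset.mem_insert, hue, false_or] at hu
      by_cases hue' : u = e.step l
      · subst hue'
        obtain ⟨k, hk⟩ := h.exists_step
        obtain ⟨k', hk'⟩ := h.symm.exists_step
        refine ⟨l :: k :: k' :: ls, by simp, ?_⟩
        simp only [visited, hk, hk']
        rw [Finset.insert_comm (e.step l), Finset.insert_eq_of_mem (mem_visited_self _ ls),
          Finset.insert_comm]
      · obtain ⟨ls', hlen, hv⟩ := ih hu hue'
        refine ⟨l :: ls', by simp [hlen], ?_⟩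
        simp only [visited, hv]
        rw [Finset.insert_comm]

/-- A connected set of `n` edges is visited by a walk of `2 (n - 1)` steps. -/
lemma NearConnected.exists_walk {Q : Finset Edge} (hQ : NearConnected Q) {e : Edge} (he : e ∈ Q) :
    ∃ ls : List StepLabel, ls.length = 2 * (Q.card - 1) ∧ visited e ls = Q := by
  have key : ∀ k, k + 1 ≤ Q.card → ∃ ls : List StepLabel, ls.length = 2 * k ∧
      visited e ls ⊆ Q ∧ (visited e ls).card = k + 1 := by
    intro k
    induction k with
    | zero => exact fun _ => ⟨[], by simp [visited, he]⟩
    | succ k ih =>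
      intro hk
      obtain ⟨ls, hlen, hsub, hcard⟩ := ih (by omega)
      have hne : (Q \ visited e ls).Nonempty := by
        rw [← Finset.card_pos, Finset.card_sdiff_of_subset hsub]
        omega
      obtain ⟨u, hu, u', hu', hnear⟩ := hQ _ hsub ⟨e, mem_visited_self e ls⟩ hne
      obtain ⟨ls', hlen', hv⟩ := exists_detour hu hnear
      rw [Finset.mem_sdiff] at hu'
      refine ⟨ls', by omega, ?_, ?_⟩
      · rw [hv]; exact Finset.insert_subset hu'.1 hsub
      · rw [hv, Finset.card_insert_of_notMem hu'.2, hcard]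
  have hpos : 0 < Q.card := Finset.card_pos.2 ⟨e, he⟩
  obtain ⟨ls, hlen, hsub, hcard⟩ := key (Q.card - 1) (by omega)
  exact ⟨ls, hlen, Finset.eq_of_subset_of_card_le hsub (by omega)⟩

/-- A value `t` missed by the first coordinates would separate the edges left of `t` from the
others, since a near step moves by at most one; so every value between the two given ones is
attained. -/
lemma NearConnected.card_ge {Q : Finset Edge} (hQ : NearConnected Q) {e e' : Edge} (he : e ∈ Q)
    (he' : e' ∈ Q) : (Finset.Icc e.1.1 e'.1.1).card ≤ Q.card := by
  refine (Finset.card_le_card (t := Q.image fun e => e.1.1) fun t ht => ?_).trans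
    Finset.card_image_le
  rw [Finset.mem_Icc] at ht
  by_contra hcon
  have hne : ∀ u ∈ Q, u.1.1 ≠ t := fun u hu h => hcon (Finset.mem_image.2 ⟨u, hu, h⟩)
  have h1 := hne e he
  have h2 := hne e' he'
  obtain ⟨u, hu, u', hu', hnear⟩ := hQ (Q.filter fun u => u.1.1 < t) (Finset.filter_subset _ _)
    ⟨e, Finset.mem_filter.2 ⟨he, by omega⟩⟩
    ⟨e', by simp only [Finset.mem_sdiff, Finset.mem_filter, he', true_and]; omega⟩
  simp only [Finset.mem_sdiff, Finset.mem_filter, not_and] at hu hu'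
  have h3 := hu'.2 hu'.1
  have h4 := hne u' hu'.1
  have h5 := (abs_le.1 hnear.1).1
  omega

/-- A connected contour around `x` contains a horizontal edge to the left of `x`, at a distance less
than its length. -/
lemma exists_left_edge {C : Finset Site} {x : Site} (hx : x ∈ C)
    (hconn : NearConnected (edgeCut C)) :
    ∃ k < (edgeCut C).card, ((x.1 - 1 - (k : ℤ), x.2), true) ∈ edgeCut C := by
  obtain ⟨x1, x2⟩ := x
  let row := (C.filter fun p => p.2 = x2).image Prod.fst
  have hrow : ∀ a, a ∈ row ↔ (a, x2) ∈ C := fun a => by simp [row]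
  have hne : row.Nonempty := ⟨x1, (hrow _).2 hx⟩
  have hl := (hrow _).1 (row.min'_mem hne)
  have hr := (hrow _).1 (row.max'_mem hne)
  have hl1 : row.min' hne ≤ x1 := row.min'_le _ ((hrow _).2 hx)
  have hr1 : x1 ≤ row.max' hne := row.le_max' _ ((hrow _).2 hx)
  set l := row.min' hne with hldef
  set r := row.max' hne with hrdef
  have hl2 : (l - 1, x2) ∉ C := fun h => by
    have := row.min'_le _ ((hrow _).2 h)
    omega
  have hr2 : (r + 1, x2) ∉ C := fun h => by
    have := row.le_max' _ ((hrow _).2 h)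
    omega
  have el : ((l - 1, x2), true) ∈ edgeCut C := by rw [mem_edgeCut]; simp [hl2, hl]
  have er : ((r, x2), true) ∈ edgeCut C := by rw [mem_edgeCut]; simp [hr2, hr]
  -- The row of `x` is entered just left of its leftmost site `l` and left at its rightmost site
  -- `r`. The contour therefore has at least `r - l + 2` edges, more than the distance `x1 - l`.
  have hcard := hconn.card_ge el er
  simp only [Int.card_Icc] at hcard
  refine ⟨(x1 - l).toNat, by omega, ?_⟩
  convert el using 3
  simp only
  omega

lemma edgeCut_injOn : Set.InjOn edgeCut {C | C ⊆ rect A₀ A₁ B₀ B₁} := by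
  intro C hC C' hC' h
  ext p
  have h1 := leftParity_edgeCut hC p
  rw [h, leftParity_edgeCut hC' p] at h1
  by_cases h2 : p ∈ C <;> by_cases h3 : p ∈ C' <;> simp_all [siteInd]

/-- A contour is determined by the offset, less than `n`, of a horizontal edge to the left of `x`,
and by a walk of `2 (n - 1)` steps from it with 18 labels per step. -/
lemma card_contours_le (𝒞 : Finset (Finset Site)) (x : Site) (n : ℕ)
    (h : ∀ C ∈ 𝒞, C ⊆ rect A₀ A₁ B₀ B₁ ∧ x ∈ C ∧ NearConnected (edgeCut C) ∧
      (edgeCut C).card = n) :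
    𝒞.card ≤ n * 18 ^ (2 * n) := by
  classical
  have hcard : (Finset.univ : Finset (List.Vector StepLabel (2 * (n - 1)))).card ≤
      18 ^ (2 * n) := by
    rw [Finset.card_univ, card_vector]
    simp only [Fintype.card_prod, Fintype.card_fin, Fintype.card_bool]
    exact Nat.pow_le_pow_right (by norm_num) (by omega)
  calc 𝒞.card = (𝒞.image edgeCut).card :=
        (Finset.card_image_of_injOn (edgeCut_injOn.mono fun C hC => (h C hC).1)).symm
    _ ≤ ((Finset.range n ×ˢ (Finset.univ : Finset (List.Vector StepLabel (2 * (n - 1))))).image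
          fun q => visited ((x.1 - 1 - (q.1 : ℤ), x.2), true) q.2.toList).card := by
        refine Finset.card_le_card fun Q hQ => ?_
        obtain ⟨C, hC, rfl⟩ := Finset.mem_image.1 hQ
        obtain ⟨-, hx, hconn, hn⟩ := h C hC
        obtain ⟨k, hk, hmem⟩ := exists_left_edge hx hconn
        obtain ⟨ls, hlen, hv⟩ := hconn.exists_walk hmem
        refine Finset.mem_image.2 ⟨(k, ⟨ls, by rw [hlen, hn]⟩), ?_, hv⟩
        exact Finset.mem_product.2 ⟨Finset.mem_range.2 (hn ▸ hk), Finset.mem_univ _⟩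
    _ ≤ _ := Finset.card_image_le
    _ ≤ n * 18 ^ (2 * n) := by
        rw [Finset.card_product, Finset.card_range]
        exact Nat.mul_le_mul_left _ hcard

/-- The sum of the weights of all contours around a site. -/
lemma sum_contours_le (𝒞 : Finset (Finset Site)) (x : Site)
    (h : ∀ C ∈ 𝒞, C ⊆ rect A₀ A₁ B₀ B₁ ∧ x ∈ C ∧ NearConnected (edgeCut C))
    {z : ℝ} (hz0 : 0 ≤ z) (hz : 3240 * z ≤ 1) :
    ∑ C ∈ 𝒞, z ^ (edgeCut C).card ≤ 1 / 4 := by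
  classical
  set r : ℝ := 324 * z with hr
  -- Here 324 is 18², the cost of two steps per edge, and 3240 makes `r ≤ 1/10`; then `∑ n r ^ n = r
  -- / (1 - r)² ≤ 1/4`.
  have hr0 : 0 ≤ r := by positivity
  have hr1 : r ≤ 1 / 10 := by linarith
  have hnorm : ‖r‖ < 1 := by rw [Real.norm_eq_abs, abs_of_nonneg hr0]; linarith
  have hs := hasSum_coe_mul_geometric_of_norm_lt_one hnorm
  have hfib : ∀ n, ∑ C ∈ 𝒞 with (edgeCut C).card = n, z ^ (edgeCut C).card ≤ n * r ^ n := by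
    intro n
    calc ∑ C ∈ 𝒞 with (edgeCut C).card = n, z ^ (edgeCut C).card
        = ∑ C ∈ 𝒞 with (edgeCut C).card = n, z ^ n :=
          Finset.sum_congr rfl fun C hC => by rw [(Finset.mem_filter.1 hC).2]
      _ = ((𝒞.filter fun C => (edgeCut C).card = n).card : ℝ) * z ^ n := by
          rw [Finset.sum_const, nsmul_eq_mul]
      _ ≤ ((n * 18 ^ (2 * n) : ℕ) : ℝ) * z ^ n := by
          gcongr
          refine card_contours_le (A₀ := A₀) (A₁ := A₁) (B₀ := B₀) (B₁ := B₁) _ x n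
            fun C hC => ?_
          rw [Finset.mem_filter] at hC
          obtain ⟨h1, h2, h3⟩ := h C hC.1
          exact ⟨h1, h2, h3, hC.2⟩
      _ = n * r ^ n := by
          push_cast
          rw [hr, mul_pow, pow_mul]
          norm_num
          ring
  calc ∑ C ∈ 𝒞, z ^ (edgeCut C).card
      = ∑ n ∈ 𝒞.image (fun C => (edgeCut C).card),
          ∑ C ∈ 𝒞 with (edgeCut C).card = n, z ^ (edgeCut C).card :=
        (Finset.sum_fiberwise_of_maps_to (fun C hC => Finset.mem_image_of_mem _ hC) _).symm
    _ ≤ ∑ n ∈ 𝒞.image (fun C => (edgeCut C).card), (n : ℝ) * r ^ n :=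
        Finset.sum_le_sum fun n _ => hfib n
    _ ≤ r / (1 - r) ^ 2 := sum_le_hasSum _ (fun n _ => by positivity) hs
    _ ≤ 1 / 4 := by
        rw [div_le_div_iff₀ (by nlinarith) (by norm_num)]
        nlinarith

/-! ### The Peierls argument -/

/-- The sublattice of the sites with odd first coordinate, parametrized by `ℤ²`. -/
def oddCol (p : Site) : Site := (2 * p.1 + 1, p.2)

lemma oddCol_injective : Function.Injective oddCol := by
  rintro ⟨a, b⟩ ⟨a', b'⟩ h
  simp only [oddCol, Prod.mk.injEq] at h ⊢
  omega

/-- The four lattice directions. -/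
def dirs : Finset Site := {(1, 0), (-1, 0), (0, 1), (0, -1)}

/-- Minus the energy of the nearest-neighbour Ising model on the sublattice `oddCol`, where the
edges that leave the rectangle have half the strength. -/
noncomputable def peierlsEnergy (R : Finset Site) (K : ℝ) (σ : Config) : ℝ :=
  ∑ p ∈ R, ∑ d ∈ dirs, K / 2 * (spin (σ (oddCol p)) * spin (σ (oddCol (p + d))))

/-- The configuration that is `-1` exactly on `oddCol '' C`. -/
noncomputable def flipConfig (C : Finset Site) : Config :=
  fun i => decide (i ∉ C.image oddCol)

lemma flipConfig_oddCol (C : Finset Site) (p : Site) :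
    flipConfig C (oddCol p) = decide (p ∉ C) := by
  simp [flipConfig, oddCol_injective.eq_iff]

variable {A₀ A₁ B₀ B₁ : ℤ} {K : ℝ}

/-- Flipping `C` turns every unequal pair across the contour into an equal one, a gain of `K` for
each ordered pair based in `R`. Every cut edge yields at least one such pair, because one of its
endpoints is in `C ⊆ R`; edges leaving `R` yield only one. -/
lemma peierlsEnergy_flip (hK : 0 ≤ K) {C R : Finset Site} (hC : C ⊆ R)
    {σ : Config} (hσ : ∀ e ∈ edgeCut C, σ (oddCol e.1) ≠ σ (oddCol e.head)) :
    peierlsEnergy R K σ + K * (edgeCut C).card ≤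
      peierlsEnergy R K (spinMul σ (flipConfig C)) := by
  classical
  -- pairs (site, direction) crossing the boundary of `C`
  set cross := (R ×ˢ dirs).filter fun q => ¬ (q.1 ∈ C ↔ q.1 + q.2 ∈ C) with hcross
  have hcard : (edgeCut C).card ≤ cross.card := by
    -- Each cut edge is oriented outwards from its endpoint in `C`.
    refine Finset.card_le_card_of_injOn
      (fun e => if e.1 ∈ C then (e.1, e.head - e.1) else (e.head, e.1 - e.head)) ?_ ?_
    · rintro ⟨⟨a, b⟩, d⟩ he
      have h1 := mem_edgeCut.1 he
      simp only [hcross, Finset.coe_filter, Set.mem_ofPred_eq, Finset.mem_product]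
      split_ifs with h
      · refine ⟨⟨hC h, ?_⟩, ?_⟩
        · cases d <;> simp [dirs]
        · simpa using h1
      · have h2 : Edge.head ((a, b), d) ∈ C := by tauto
        refine ⟨⟨hC h2, ?_⟩, ?_⟩
        · cases d <;> simp [dirs]
        · simp [h2]; exact h
    · rintro ⟨⟨a, b⟩, d⟩ he ⟨⟨a', b'⟩, d'⟩ he' h
      have h1 := mem_edgeCut.1 he
      have h1' := mem_edgeCut.1 he'
      simp only at h
      split_ifs at h <;> cases d <;> cases d' <;> simp_all
  have hnn : ∀ p d, d ∈ dirs → ¬ (p ∈ C ↔ p + d ∈ C) →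
      spin (σ (oddCol p)) * spin (σ (oddCol (p + d))) = -1 := by
    have hopp : ∀ b b' : Bool, b ≠ b' → spin b * spin b' = -1 := by
      intro b b' h; cases b <;> cases b' <;> simp_all
    rintro ⟨a, b⟩ d hd hne
    simp only [dirs, Finset.mem_insert, Finset.mem_singleton] at hd
    rcases hd with rfl | rfl | rfl | rfl
    · have := hσ ((a, b), true) (by rw [mem_edgeCut]; simpa using hne)
      exact hopp _ _ (by simpa using this)
    · have := hσ ((a - 1, b), true) (by
        rw [mem_edgeCut]; simp only [Edge.head_true]
        simp only [Prod.mk_add_mk, add_zero] at hne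
        rw [show a - 1 + 1 = a by ring]; tauto)
      simp only [Edge.head_true] at this
      rw [show a - 1 + 1 = a by ring] at this
      exact hopp _ _ (by simpa [sub_eq_add_neg] using this.symm)
    · have := hσ ((a, b), false) (by rw [mem_edgeCut]; simpa using hne)
      exact hopp _ _ (by simpa using this)
    · have := hσ ((a, b - 1), false) (by
        rw [mem_edgeCut]; simp only [Edge.head_false]
        simp only [Prod.mk_add_mk, add_zero] at hne
        rw [show b - 1 + 1 = b by ring]; tauto)
      simp only [Edge.head_false] at this
      rw [show b - 1 + 1 = b by ring] at this
      exact hopp _ _ (by simpa [sub_eq_add_neg] using this.symm)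
  have hdiff : peierlsEnergy R K (spinMul σ (flipConfig C)) - peierlsEnergy R K σ =
      ∑ q ∈ R ×ˢ dirs, if ¬ (q.1 ∈ C ↔ q.1 + q.2 ∈ C) then K else 0 := by
    unfold peierlsEnergy
    rw [Finset.sum_product, ← Finset.sum_sub_distrib]
    refine Finset.sum_congr rfl fun p _ => ?_
    rw [← Finset.sum_sub_distrib]
    refine Finset.sum_congr rfl fun d hd => ?_
    simp only [(isChar_spin _).map_mul, flipConfig_oddCol]
    by_cases h1 : p ∈ C <;> by_cases h2 : p + d ∈ C
    · simp [h1, h2]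
    · have := hnn p d hd (by tauto)
      simp only [h1, h2]
      simp only [not_true, decide_false, spin_false, not_false_eq_true, decide_true, spin_true]
      rw [if_pos (by tauto)]
      linear_combination (-K) * this
    · have := hnn p d hd (by tauto)
      simp only [h1, h2]
      simp only [not_true, decide_false, spin_false, not_false_eq_true, decide_true, spin_true]
      rw [if_pos (by tauto)]
      linear_combination (-K) * this
    · simp [h1, h2]
  rw [← Finset.sum_filter, Finset.sum_const, nsmul_eq_mul] at hdiff
  have : K * ((edgeCut C).card : ℝ) ≤ K * (cross.card : ℝ) :=
    mul_le_mul_of_nonneg_left (by exact_mod_cast hcard) hK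
  linarith [hdiff, mul_comm K (cross.card : ℝ)]

/-- The weight of the configurations in which the contour of `C` separates unequal spins. -/
lemma spinSum_contour_le (hK : 0 ≤ K) {Λ C R : Finset Site} (hC : C ⊆ R)
    (hR : ∀ p ∈ R, oddCol p ∈ Λ) :
    spinSum Λ (fun σ => Set.indicator
      {σ : Config | ∀ e ∈ edgeCut C, σ (oddCol e.1) ≠ σ (oddCol e.head)}
      (fun σ => Real.exp (peierlsEnergy R K σ)) σ) plusConfig ≤
    Real.exp (-K) ^ (edgeCut C).card *
      spinSum Λ (fun σ => Real.exp (peierlsEnergy R K σ)) plusConfig := by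
  have hglue : glue Λ (fun i => flipConfig C i) plusConfig = flipConfig C := by
    ext i
    by_cases hi : i ∈ Λ
    · simp [glue, hi]
    · have : i ∉ C.image oddCol := fun h => by
        obtain ⟨p, hp, rfl⟩ := Finset.mem_image.1 h
        exact hi (hR p (hC hp))
      rw [glue_of_notMem hi, flipConfig, decide_eq_true this, plusConfig]
  have hS : spinSum Λ (fun σ => Real.exp (peierlsEnergy R K σ)) plusConfig =
      spinSum Λ (fun σ => Real.exp (peierlsEnergy R K (spinMul σ (flipConfig C)))) plusConfig := by
    unfold spinSum
    rw [← Equiv.sum_comp (spinMulEquiv fun i : Λ => flipConfig C i)]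
    refine Finset.sum_congr rfl fun τ _ => ?_
    rw [glue_spinMulEquiv, hglue]
    have : ∀ σ σ', spinMul σ σ' = spinMul σ' σ := fun σ σ' => by
      ext i; simp only [spinMul]; cases σ i <;> cases σ' i <;> rfl
    rw [this]
  rw [hS, ← spinSum_const_mul]
  refine spinSum_mono fun τ => ?_
  by_cases h : glue Λ τ plusConfig ∈
      {σ : Config | ∀ e ∈ edgeCut C, σ (oddCol e.1) ≠ σ (oddCol e.head)}
  · rw [Set.indicator_of_mem h, ← Real.exp_nat_mul, ← Real.exp_add, Real.exp_le_exp]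
    have := peierlsEnergy_flip hK hC h
    linarith
  · rw [Set.indicator_of_notMem h]
    positivity

/-- The Peierls bound for the nearest-neighbour model. -/
lemma peierls_bound (hK0 : 0 ≤ K) (hK : 3240 * Real.exp (-K) ≤ 1) {Λ : Finset Site}
    (hR : ∀ p, p ∈ rect A₀ A₁ B₀ B₁ ↔ oddCol p ∈ Λ) (x : Site) :
    1 / 2 * spinSum Λ (fun σ => Real.exp (peierlsEnergy (rect A₀ A₁ B₀ B₁) K σ)) plusConfig ≤
      spinSum Λ (fun σ => spin (σ (oddCol x)) *
        Real.exp (peierlsEnergy (rect A₀ A₁ B₀ B₁) K σ)) plusConfig := by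
  classical
  set R := rect A₀ A₁ B₀ B₁
  set E : Config → ℝ := fun σ => Real.exp (peierlsEnergy R K σ)
  set 𝒞 := R.powerset.filter fun C => x ∈ C ∧ NearConnected (edgeCut C)
  set D : Finset Site → Set Config := fun C =>
    {σ : Config | ∀ e ∈ edgeCut C, σ (oddCol e.1) ≠ σ (oddCol e.head)}
  have hsum := sum_contours_le (A₀ := A₀) (A₁ := A₁) (B₀ := B₀) (B₁ := B₁) 𝒞 x (fun C hC => by
    simpa [𝒞] using hC) (Real.exp_pos (-K)).le hK
  -- If the spin at `x` is minus, the finite set of minus sites has a connected contour around `x`,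
  -- so `σ_x ≥ 1 - 2 ∑ 1{contour}`. The contour weights sum to at most 1/4, which leaves 1/2.
  have hpt : ∀ τ : Λ → Bool, E (glue Λ τ plusConfig) -
      2 * ∑ C ∈ 𝒞, (D C).indicator E (glue Λ τ plusConfig) ≤
      spin (glue Λ τ plusConfig (oddCol x)) * E (glue Λ τ plusConfig) := by
    intro τ
    set σ := glue Λ τ plusConfig with hσ
    have hE : 0 < E σ := Real.exp_pos _
    have hnn : ∀ C ∈ 𝒞, 0 ≤ (D C).indicator E σ := fun C _ =>
      Set.indicator_nonneg (fun _ _ => (Real.exp_pos _).le) _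
    cases hb : σ (oddCol x)
    · set M := R.filter fun p => σ (oddCol p) = false with hM
      have hMiff : ∀ p, p ∈ M ↔ σ (oddCol p) = false := fun p => by
        rw [hM, Finset.mem_filter, and_iff_right_iff_imp]
        intro h
        by_contra hp
        rw [hR] at hp
        rw [hσ, glue_of_notMem hp] at h
        simp [plusConfig] at h
      obtain ⟨C, hCR, hxC, hcut, hconn⟩ := exists_contour
        (Finset.filter_subset _ _ : M ⊆ R) ((hMiff x).2 hb)
      have hCmem : C ∈ 𝒞 := by simp [𝒞, hxC, hconn]; exact hCR
      have hDC : σ ∈ D C := fun e he heq => by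
        have := mem_edgeCut.1 (hcut he)
        rw [hMiff, hMiff, heq] at this
        exact this Iff.rfl
      have := Finset.single_le_sum hnn hCmem
      rw [Set.indicator_of_mem hDC] at this
      rw [spin_false]
      linarith
    · have := Finset.sum_nonneg hnn
      rw [spin_true]
      linarith
  have h1 := spinSum_mono (Λ := Λ) (ω := plusConfig)
    (f := fun σ => E σ - 2 * ∑ C ∈ 𝒞, (D C).indicator E σ)
    (g := fun σ => spin (σ (oddCol x)) * E σ) hpt
  rw [spinSum_sub, spinSum_const_mul] at h1
  have h2 : spinSum Λ (fun σ => ∑ C ∈ 𝒞, (D C).indicator E σ) plusConfig =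
      ∑ C ∈ 𝒞, spinSum Λ (fun σ => (D C).indicator E σ) plusConfig := by
    unfold spinSum; exact Finset.sum_comm
  have hZ : 0 ≤ spinSum Λ E plusConfig := spinSum_nonneg fun _ => (Real.exp_pos _).le
  have h3 : ∑ C ∈ 𝒞, spinSum Λ (fun σ => (D C).indicator E σ) plusConfig ≤
      1 / 4 * spinSum Λ E plusConfig := by
    refine le_trans (Finset.sum_le_sum fun C hC => spinSum_contour_le hK0 (R := R) ?_
      fun p hp => (hR p).1 hp) ?_
    · simp only [𝒞, Finset.mem_filter, Finset.mem_powerset] at hC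
      exact hC.1
    · rw [← Finset.sum_mul]
      exact mul_le_mul_of_nonneg_right hsum hZ
  change 1 / 2 * spinSum Λ E plusConfig ≤ spinSum Λ (fun σ => spin (σ (oddCol x)) * E σ) plusConfig
  linarith

/-- Positive magnetization at low temperature, for ferromagnetic systems that dominate the
nearest-neighbour model on the odd columns. -/
lemma half_le_gibbsAv_spin (hK0 : 0 ≤ K) (hK : 3240 * Real.exp (-K) ≤ 1) {Λ : Finset Site}
    (hR : ∀ p, p ∈ rect A₀ A₁ B₀ B₁ ↔ oddCol p ∈ Λ) {c : Site → Site → ℝ} {v : Site → ℝ}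
    (hc0 : ∀ i j, 0 ≤ c i j) (hv0 : ∀ i ∈ Λ, 0 ≤ v i)
    (hc : ∀ p, ∀ d ∈ dirs, K ≤ c (oddCol p) (oddCol (p + d)))
    (hv : ∀ p ∈ rect A₀ A₁ B₀ B₁, ∀ d ∈ dirs, oddCol (p + d) ∉ Λ → 2 * K ≤ v (oddCol p))
    (x : Site) :
    1 / 2 ≤ gibbsAv Λ c v plusConfig (fun σ => spin (σ (oddCol x))) := by
  classical
  set R := rect A₀ A₁ B₀ B₁
  -- The nearest-neighbour model on the odd columns written as couplings and a field on all of `Λ`: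
  -- an edge leaving `Λ` meets a plus spin and becomes a field `K / 2`. A site has four directions,
  -- hence the requirement `2 * K ≤ v`.
  let c' : Site → Site → ℝ := fun i j => ∑ p ∈ R, ∑ d ∈ dirs,
    if i = oddCol p ∧ j = oddCol (p + d) then K else 0
  let v' : Site → ℝ := fun i => ∑ p ∈ R, ∑ d ∈ dirs,
    if i = oddCol p ∧ oddCol (p + d) ∉ Λ then K / 2 else 0
  have hE : ∀ τ : Λ → Bool, energy Λ c' v' (glue Λ τ plusConfig) =
      peierlsEnergy R K (glue Λ τ plusConfig) := by
    intro τ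
    set σ := glue Λ τ plusConfig with hσ
    unfold energy peierlsEnergy
    have e1 : ∑ i ∈ Λ, ∑ j ∈ Λ, c' i j * spin (σ i) * spin (σ j) = ∑ p ∈ R, ∑ d ∈ dirs,
        if oddCol (p + d) ∈ Λ then K * spin (σ (oddCol p)) * spin (σ (oddCol (p + d))) else 0 := by
      simp only [c', Finset.sum_mul]
      rw [Finset.sum_congr rfl fun i _ => Finset.sum_comm, Finset.sum_comm]
      refine Finset.sum_congr rfl fun p hp => ?_
      rw [Finset.sum_congr rfl fun i _ => Finset.sum_comm, Finset.sum_comm]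
      refine Finset.sum_congr rfl fun d _ => ?_
      rw [Finset.sum_eq_single (oddCol p)]
      · simp only [true_and, ite_mul, zero_mul]
        rw [Finset.sum_ite_eq']
      · intro i _ hi
        simp [hi]
      · intro h; exact absurd ((hR p).1 hp) h
    have e2 : ∑ i ∈ Λ, v' i * spin (σ i) = ∑ p ∈ R, ∑ d ∈ dirs,
        if oddCol (p + d) ∉ Λ then K / 2 * spin (σ (oddCol p)) else 0 := by
      simp only [v', Finset.sum_mul]
      rw [Finset.sum_comm]
      refine Finset.sum_congr rfl fun p hp => ?_
      rw [Finset.sum_comm]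
      refine Finset.sum_congr rfl fun d _ => ?_
      rw [Finset.sum_eq_single (oddCol p)]
      · simp only [true_and, ite_mul, zero_mul]
      · intro i _ hi
        simp [hi]
      · intro h; exact absurd ((hR p).1 hp) h
    rw [e1, e2, Finset.mul_sum, ← Finset.sum_add_distrib]
    refine Finset.sum_congr rfl fun p _ => ?_
    rw [Finset.mul_sum, ← Finset.sum_add_distrib]
    refine Finset.sum_congr rfl fun d _ => ?_
    by_cases h : oddCol (p + d) ∈ Λ
    · simp only [h, if_true, not_true, if_false]; ring
    · have : σ (oddCol (p + d)) = true := by rw [hσ, glue_of_notMem h]; rfl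
      simp [h, this]
  have hc'0 : ∀ i j, 0 ≤ c' i j := fun i j => Finset.sum_nonneg fun p _ =>
    Finset.sum_nonneg fun d _ => by split_ifs <;> linarith
  have hv'0 : ∀ i, 0 ≤ v' i := fun i => Finset.sum_nonneg fun p _ =>
    Finset.sum_nonneg fun d _ => by split_ifs <;> linarith
  have hc'c : ∀ i j, c' i j ≤ c i j := by
    intro i j
    by_cases h : ∃ p ∈ R, ∃ d ∈ dirs, i = oddCol p ∧ j = oddCol (p + d)
    · obtain ⟨p, hp, d, hd, rfl, rfl⟩ := h
      refine le_trans (le_of_eq ?_) (hc p d hd)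
      simp only [c']
      rw [Finset.sum_eq_single p, Finset.sum_eq_single d]
      · simp
      · intro d' _ hne
        rw [if_neg]
        rintro ⟨-, h⟩
        exact hne (add_left_cancel (oddCol_injective h)).symm
      · exact fun h => absurd hd h
      · intro p' _ hne
        refine Finset.sum_eq_zero fun d' _ => if_neg ?_
        rintro ⟨h, -⟩
        exact hne (oddCol_injective h).symm
      · exact fun h => absurd hp h
    · push Not at h
      refine le_trans (le_of_eq ?_) (hc0 i j)
      exact Finset.sum_eq_zero fun p hp => Finset.sum_eq_zero fun d hd =>
        if_neg fun hh => h p hp d hd hh.1 hh.2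
  have hv'v : ∀ i ∈ Λ, v' i ≤ v i := by
    intro i hi
    by_cases h : ∃ p ∈ R, ∃ d ∈ dirs, i = oddCol p ∧ oddCol (p + d) ∉ Λ
    · obtain ⟨p, hp, d, hd, rfl, hout⟩ := h
      refine le_trans ?_ (hv p hp d hd hout)
      simp only [v']
      rw [Finset.sum_eq_single p]
      · calc ∑ d ∈ dirs, (if oddCol p = oddCol p ∧ oddCol (p + d) ∉ Λ then K / 2 else 0)
            ≤ ∑ d ∈ dirs, K / 2 := Finset.sum_le_sum fun d _ => by split_ifs <;> linarith
          _ = 2 * K := by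
            rw [Finset.sum_const, show dirs.card = 4 from by decide]
            simp; ring
      · intro p' _ hne
        refine Finset.sum_eq_zero fun d' _ => if_neg ?_
        rintro ⟨h, -⟩
        exact hne (oddCol_injective h).symm
      · exact fun h => absurd hp h
    · push Not at h
      refine le_trans (le_of_eq ?_) (hv0 i hi)
      exact Finset.sum_eq_zero fun p hp => Finset.sum_eq_zero fun d hd =>
        if_neg fun hh => hh.2 (h p hp d hd hh.1)
  refine le_trans ?_ (gibbsAv_mono_coupling (c' := c') (v' := v') (fun i _ j _ => hc'0 i j)
    (fun i _ => hv'0 i) (fun i _ j _ => hc'c i j) hv'v (spin_mem_charCone _))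
  rw [gibbsAv, le_div_iff₀ partition_pos]
  have hw : ∀ τ : Λ → Bool, weight Λ c' v' (glue Λ τ plusConfig) =
      Real.exp (peierlsEnergy R K (glue Λ τ plusConfig)) := fun τ => by rw [weight, hE]
  have key := peierls_bound hK0 hK hR x
  refine le_of_eq_of_le (congrArg _ (spinSum_congr hw)) (key.trans (le_of_eq ?_))
  exact spinSum_congr fun τ => by rw [hw]

/-! ### Translation invariant interactions and boundary fields -/

/-- Ferromagnetic translation invariant interactions `φ (j - i)` that are summable, symmetric under
reflections of both axes, and vanish when both coordinates of the displacement are odd. -/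
structure IsAxisInteraction (φ : Site → ℝ) : Prop where
  nonneg : ∀ d, 0 ≤ φ d
  reflect_fst : ∀ a b, φ (-a, b) = φ (a, b)
  reflect_snd : ∀ a b, φ (a, -b) = φ (a, b)
  summable : Summable φ
  odd_odd : ∀ a b, Odd a → Odd b → φ (a, b) = 0
  pos_fst : 0 < φ (1, 0)
  pos_snd : 0 < φ (0, 1)

/-- The pair couplings defined by a function of the displacement. -/
def pairCoupling (φ : Site → ℝ) (i j : Site) : ℝ := φ (j - i)

variable {φ : Site → ℝ}

lemma IsAxisInteraction.neg (hφ : IsAxisInteraction φ) (d : Site) : φ (-d) = φ d := by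
  obtain ⟨a, b⟩ := d
  rw [Prod.neg_mk, hφ.reflect_fst, hφ.reflect_snd]

lemma IsAxisInteraction.symm (hφ : IsAxisInteraction φ) (i j : Site) :
    pairCoupling φ i j = pairCoupling φ j i := by
  rw [pairCoupling, pairCoupling, ← hφ.neg, neg_sub]

lemma IsAxisInteraction.summable_sub (hφ : IsAxisInteraction φ) (i : Site) :
    Summable fun j => φ (j - i) :=
  hφ.summable.comp_injective (sub_left_injective (b := i))

lemma tsum_sub_eq (i : Site) : ∑' j, φ (j - i) = ∑' d, φ d :=
  (Equiv.subRight i).tsum_eq φ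

lemma IsAxisInteraction.sum_le_tsum (hφ : IsAxisInteraction φ) (D : Finset Site) (i : Site) :
    ∑ j ∈ D, φ (j - i) ≤ ∑' d, φ d := by
  rw [← tsum_sub_eq i]
  exact (hφ.summable_sub i).sum_le_tsum _ fun _ _ => hφ.nonneg _

/-- The sites whose coordinates are both even. -/
def IsEvenSite (i : Site) : Prop := Even i.1 ∧ Even i.2

instance : DecidablePred IsEvenSite := fun i => inferInstanceAs (Decidable (Even i.1 ∧ Even i.2))

/-- The sites of `D` that are not even. -/
def oddPart (D : Finset Site) : Finset Site := D.filter fun i => ¬ IsEvenSite i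

lemma mem_oddPart {D : Finset Site} {i : Site} : i ∈ oddPart D ↔ i ∈ D ∧ ¬ IsEvenSite i := by
  simp [oddPart]

lemma oddPart_mono {D D' : Finset Site} (h : D ⊆ D') : oddPart D ⊆ oddPart D' :=
  Finset.filter_subset_filter _ h

/-- The field created by plus spins at all even sites. -/
noncomputable def evenField (φ : Site → ℝ) (i : Site) : ℝ :=
  ∑' j : Site, if IsEvenSite j then φ (j - i) else 0

/-- Twice the largest field that spins outside `D` can create. -/
noncomputable def outerField (φ : Site → ℝ) (D : Finset Site) (i : Site) : ℝ :=
  2 * (∑' d, φ d - ∑ j ∈ D, φ (j - i))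

lemma IsAxisInteraction.outerField_nonneg (hφ : IsAxisInteraction φ) (D : Finset Site) (i : Site) :
    0 ≤ outerField φ D i := by
  have := hφ.sum_le_tsum D i
  unfold outerField
  linarith

lemma IsAxisInteraction.outerField_le (hφ : IsAxisInteraction φ) (D : Finset Site) (i : Site) :
    outerField φ D i ≤ 2 * ∑' d, φ d := by
  have : 0 ≤ ∑ j ∈ D, φ (j - i) := Finset.sum_nonneg fun j _ => hφ.nonneg _
  unfold outerField
  linarith

/-- When the volume grows, an added site removes `2 φ` from the boundary field and contributes a
coupling of at most `φ`. This is the hypothesis of the volume comparisons, for both signs of the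
boundary field. -/
lemma IsAxisInteraction.outerField_add_le (hφ : IsAxisInteraction φ) {D D' : Finset Site}
    (h : D ⊆ D') (i : Site) :
    outerField φ D' i + ∑ j ∈ oddPart D' \ oddPart D, pairCoupling φ i j ≤ outerField φ D i := by
  have h1 : ∑ j ∈ oddPart D' \ oddPart D, pairCoupling φ i j ≤ ∑ j ∈ D' \ D, φ (j - i) := by
    refine Finset.sum_le_sum_of_subset_of_nonneg (fun j hj => ?_) fun j _ _ => hφ.nonneg _
    simp only [Finset.mem_sdiff, mem_oddPart] at hj ⊢
    tauto
  have h2 := Finset.sum_sdiff h (f := fun j => φ (j - i))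
  have h3 : 0 ≤ ∑ j ∈ D' \ D, φ (j - i) := Finset.sum_nonneg fun j _ => hφ.nonneg _
  unfold outerField
  linarith

lemma IsAxisInteraction.le_outerField (hφ : IsAxisInteraction φ) {D : Finset Site} {i j : Site}
    (hj : j ∉ D) : 2 * φ (j - i) ≤ outerField φ D i := by
  have := hφ.sum_le_tsum (insert j D) i
  rw [Finset.sum_insert hj] at this
  unfold outerField
  linarith

lemma IsAxisInteraction.summable_even (hφ : IsAxisInteraction φ) (i : Site) :
    Summable fun j : Site => if IsEvenSite j then φ (j - i) else 0 := by
  refine Summable.of_nonneg_of_le (fun j => ?_) (fun j => ?_) (hφ.summable_sub i)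
  · split_ifs
    exacts [hφ.nonneg _, le_rfl]
  · split_ifs
    exacts [le_rfl, hφ.nonneg _]

lemma IsAxisInteraction.evenField_nonneg (hφ : IsAxisInteraction φ) (i : Site) :
    0 ≤ evenField φ i :=
  tsum_nonneg fun j => by split_ifs; exacts [hφ.nonneg _, le_rfl]

lemma IsAxisInteraction.evenField_pos (hφ : IsAxisInteraction φ) {i : Site}
    (hi : ¬ IsEvenSite i) (hi' : Even i.1 ∨ Even i.2) : 0 < evenField φ i := by
  have key : ∀ j, IsEvenSite j → 0 < φ (j - i) → 0 < evenField φ i := fun j hj hpos =>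
    (hφ.summable_even i).tsum_pos (fun j => by split_ifs; exacts [hφ.nonneg _, le_rfl]) j
      (by rw [if_pos hj]; exact hpos)
  obtain ⟨a, b⟩ := i
  simp only [IsEvenSite, not_and_or, Int.not_even_iff_odd] at hi hi'
  rcases Int.even_or_odd a with ha | ha
  · have hb : Odd b := by
      rcases hi with h | h
      · exact absurd ha (Int.not_even_iff_odd.2 h)
      · exact h
    exact key (a, b + 1) ⟨ha, hb.add_one⟩ (by simpa using hφ.pos_snd)
  · have hb : Even b := hi'.resolve_left (Int.not_even_iff_odd.2 ha)
    exact key (a + 1, b) ⟨ha.add_one, hb⟩ (by simpa using hφ.pos_fst)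

lemma evenField_add (i w : Site) : evenField φ (i + 2 • w) = evenField φ i := by
  unfold evenField
  rw [← (Equiv.addRight (2 • w)).tsum_eq]
  refine tsum_congr fun j => ?_
  simp only [Equiv.coe_addRight, add_sub_add_right_eq_sub]
  have : IsEvenSite (j + 2 • w) ↔ IsEvenSite j := by
    simp [IsEvenSite, Int.even_add]
  simp only [this]

/-- The square `[-n, n]²`. -/
noncomputable def box (n : ℕ) : Finset Site := rect (-n) n (-n) n

lemma mem_box {n : ℕ} {p : Site} : p ∈ box n ↔ |p.1| ≤ n ∧ |p.2| ≤ n := by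
  simp only [box, mem_rect, abs_le]

lemma box_mono {m n : ℕ} (h : m ≤ n) : box m ⊆ box n := fun p hp => by
  rw [mem_box] at hp ⊢
  omega

lemma card_box (n : ℕ) : (box n).card = (2 * n + 1) ^ 2 := by
  simp only [box, rect, Finset.card_product, Int.card_Icc, sq]
  congr 1 <;> omega

lemma exists_subset_box (F : Finset Site) : ∃ n, F ⊆ box n := by
  refine ⟨F.sup fun p => p.1.natAbs + p.2.natAbs, fun p hp => ?_⟩
  have := Finset.le_sup (f := fun p : Site => p.1.natAbs + p.2.natAbs) hp
  rw [mem_box, abs_le, abs_le]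
  omega

/-- The boundary field of a large square is negligible compared with its area. -/
lemma IsAxisInteraction.sum_outerField_le (hφ : IsAxisInteraction φ) {ε : ℝ} (hε : 0 < ε) :
    ∀ᶠ n : ℕ in atTop, ∑ i ∈ box n, outerField φ (box n) i ≤ ε * (2 * n + 1) ^ 2 := by
  set T := ∑' d, φ d with hT
  have hT0 : 0 ≤ T := tsum_nonneg hφ.nonneg
  -- A finite set `F ⊆ box ρ` carries all but `ε / 4` of the interaction, so sites at distance `ρ`
  -- from the boundary feel at most `ε / 2`. The remaining shell has at most `4 ρ (2 n + 1)` sites,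
  -- each feeling at most `2 T`; the choice of `N` makes this a lower-order term.
  obtain ⟨F, hF⟩ := (hφ.summable.hasSum.eventually (lt_mem_nhds
    (show T - ε / 4 < T by linarith))).exists
  obtain ⟨ρ, hρ⟩ := exists_subset_box F
  obtain ⟨N, hN⟩ := exists_nat_ge (8 * T * ρ / (ε / 2))
  filter_upwards [eventually_ge_atTop (ρ + N)] with n hn
  have hnρ : ρ ≤ n := by omega
  have hsub : box (n - ρ) ⊆ box n := box_mono (by omega)
  have hin : ∀ i ∈ box (n - ρ), outerField φ (box n) i ≤ ε / 2 := by
    intro i hi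
    have : ∑ d ∈ F, φ d ≤ ∑ j ∈ box n, φ (j - i) := by
      calc ∑ d ∈ F, φ d = ∑ j ∈ F.map (addRightEmbedding i), φ (j - i) := by
            rw [Finset.sum_map]; simp
        _ ≤ _ := by
            refine Finset.sum_le_sum_of_subset_of_nonneg (fun j hj => ?_) fun j _ _ => hφ.nonneg _
            obtain ⟨d, hd, rfl⟩ := Finset.mem_map.1 hj
            have hd' := mem_box.1 (hρ hd)
            rw [mem_box] at hi ⊢
            simp only [abs_le] at hi hd' ⊢
            simp only [addRightEmbedding_apply, Prod.fst_add, Prod.snd_add]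
            omega
    unfold outerField
    linarith
  have hcard : ((box n \ box (n - ρ)).card : ℝ) ≤ 4 * ρ * (2 * n + 1) := by
    rw [Finset.card_sdiff_of_subset hsub, card_box, card_box, Nat.cast_sub (by gcongr; omega)]
    push_cast [Nat.cast_sub hnρ]
    nlinarith [sq_nonneg (ρ : ℝ)]
  have hbig : 8 * T * ρ ≤ ε / 2 * (2 * n + 1) := by
    rw [div_le_iff₀ (by linarith)] at hN
    have : (N : ℝ) ≤ 2 * n + 1 := by
      have : (N : ℝ) ≤ n := by exact_mod_cast (by omega : N ≤ n)
      have h0 : (0 : ℝ) ≤ n := by positivity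
      linarith
    nlinarith
  rw [← Finset.sum_sdiff hsub]
  calc _ ≤ ((box n \ box (n - ρ)).card : ℝ) * (2 * T) + ((box (n - ρ)).card : ℝ) * (ε / 2) := by
        refine add_le_add ?_ ?_
        · rw [← nsmul_eq_mul]
          exact Finset.sum_le_card_nsmul _ _ _ fun i _ => hφ.outerField_le _ _
        · rw [← nsmul_eq_mul]
          exact Finset.sum_le_card_nsmul _ _ _ hin
    _ ≤ (4 * ρ * (2 * n + 1)) * (2 * T) + (2 * n + 1) ^ 2 * (ε / 2) := by
        gcongr
        rw [card_box]
        push_cast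
        gcongr
        omega
    _ ≤ ε * (2 * n + 1) ^ 2 := by nlinarith

/-! ### The difference of the magnetizations under plus and minus boundary conditions -/

/-- The magnetization at `x` of the odd sites in `D`, under the field `u` plus `s` times the
boundary field. -/
noncomputable def boundaryMag (φ : Site → ℝ) (D : Finset Site) (u : Site → ℝ) (s : ℝ) (x : Site) :
    ℝ :=
  gibbsAv (oddPart D) (pairCoupling φ) (fun i => u i + s * outerField φ D i) plusConfig
    fun σ => spin (σ x)

/-- The difference of the magnetizations at `x` under plus and minus boundary fields. -/
noncomputable def magGap (φ : Site → ℝ) (D : Finset Site) (u : Site → ℝ) (x : Site) : ℝ :=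
  boundaryMag φ D u 1 x - boundaryMag φ D u (-1) x

lemma monotone_spin_apply (x : Site) : Monotone fun σ : Config => spin (σ x) :=
  fun _ _ h => spin_mono (h x)

lemma monotone_glue_spin (Λ : Finset Site) (ω : Config) (x : Site) :
    Monotone fun τ : Λ → Bool => spin (glue Λ τ ω x) :=
  fun _ _ h => spin_mono (glue_mono Λ h le_rfl x)

variable {D D' : Finset Site} {u : Site → ℝ} {x : Site}

lemma IsAxisInteraction.magGap_nonneg (hφ : IsAxisInteraction φ) : 0 ≤ magGap φ D u x := by
  refine sub_nonneg.2 (gibbsAv_mono_field (fun i _ j _ => hφ.nonneg _) (fun i _ => ?_)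
    (monotone_glue_spin _ _ _))
  have := hφ.outerField_nonneg D i
  linarith

lemma magGap_le_two : magGap φ D u x ≤ 2 := by
  have h1 : boundaryMag φ D u 1 x ≤ 1 := gibbsAv_le_const fun _ => spin_le_one _
  have h2 : -1 ≤ boundaryMag φ D u (-1) x := const_le_gibbsAv fun _ => neg_one_le_spin _
  unfold magGap
  linarith

lemma dependsOn_spin {Λ : Finset Site} (hx : x ∈ Λ) :
    DependsOn (fun σ : Config => spin (σ x)) (Λ : Set Site) := fun σ σ' h => by
  simp only [h x hx]

/-- The boundary field dominates whatever the spins of a larger volume can produce, so the plus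
magnetization decreases and the minus magnetization increases with the volume. -/
lemma IsAxisInteraction.magGap_antitone (hφ : IsAxisInteraction φ) (h : D ⊆ D')
    (hx : x ∈ oddPart D) : magGap φ D' u x ≤ magGap φ D u x := by
  refine sub_le_sub ?_ ?_
  · refine gibbsAv_volume_le (fun i j => hφ.nonneg _) hφ.symm (oddPart_mono h) (fun i _ => ?_)
      (monotone_spin_apply x) (dependsOn_spin hx)
    linarith [hφ.outerField_add_le h i]
  · refine le_gibbsAv_volume (fun i j => hφ.nonneg _) hφ.symm (oddPart_mono h) (fun i _ => ?_)
      (monotone_spin_apply x) (dependsOn_spin hx)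
    linarith [hφ.outerField_add_le h i]

/-! ### Translations -/

lemma spinSum_translate (Λ : Finset Site) (w : Site) (f : Config → ℝ) :
    spinSum (Λ.map (addRightEmbedding w)) f plusConfig =
      spinSum Λ (fun σ => f fun i => σ (i - w)) plusConfig := by
  unfold spinSum
  let e : Λ ≃ Λ.map (addRightEmbedding w) :=
    { toFun := fun i => ⟨i + w, Finset.mem_map.2 ⟨i, i.2, rfl⟩⟩
      invFun := fun i => ⟨i - w, by
        obtain ⟨a, ha, h⟩ := Finset.mem_map.1 i.2
        rw [← h]; simpa using ha⟩
      left_inv := fun i => by simp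
      right_inv := fun i => by simp }
  rw [← Equiv.sum_comp (e.arrowCongr (Equiv.refl Bool))]
  refine Finset.sum_congr rfl fun τ _ => ?_
  congr 1
  ext i
  have hmem : i ∈ Λ.map (addRightEmbedding w) ↔ i - w ∈ Λ := by
    simp only [Finset.mem_map, addRightEmbedding_apply]
    exact ⟨fun ⟨a, ha, h⟩ => by rw [← h]; simpa using ha, fun h => ⟨_, h, by simp⟩⟩
  by_cases hi : i - w ∈ Λ
  · rw [glue_of_mem hi, glue_of_mem (hmem.2 hi)]
    rfl
  · rw [glue_of_notMem hi, glue_of_notMem (mt hmem.1 hi)]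
    rfl

lemma gibbsAv_translate (Λ : Finset Site) (w : Site) (c : Site → Site → ℝ) (v : Site → ℝ)
    (f : Config → ℝ) :
    gibbsAv (Λ.map (addRightEmbedding w)) c v plusConfig f =
      gibbsAv Λ (fun i j => c (i + w) (j + w)) (fun i => v (i + w)) plusConfig
        (fun σ => f fun i => σ (i - w)) := by
  have hw : ∀ σ : Config, weight (Λ.map (addRightEmbedding w)) c v (fun i => σ (i - w)) =
      weight Λ (fun i j => c (i + w) (j + w)) (fun i => v (i + w)) σ := fun σ => by
    simp [weight, energy, Finset.sum_map]
  unfold gibbsAv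
  rw [spinSum_translate, spinSum_translate]
  simp only [hw]

/-- Only translations by even vectors are available, because others do not preserve the sublattice
of even sites. -/
lemma magGap_translate (w : Site) (hu : ∀ i, u (i + 2 • w) = u i) :
    magGap φ (D.map (addRightEmbedding (2 • w))) u (x + 2 • w) = magGap φ D u x := by
  have hodd : oddPart (D.map (addRightEmbedding (2 • w))) =
      (oddPart D).map (addRightEmbedding (2 • w)) := by
    ext i
    simp only [mem_oddPart, Finset.mem_map, addRightEmbedding_apply]
    have : ∀ a, IsEvenSite (a + 2 • w) ↔ IsEvenSite a := fun a => by
      simp [IsEvenSite, Int.even_add]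
    constructor
    · rintro ⟨⟨a, ha, rfl⟩, h⟩
      exact ⟨a, ⟨ha, by rwa [this] at h⟩, rfl⟩
    · rintro ⟨a, ⟨ha, h⟩, rfl⟩
      exact ⟨⟨a, ha, rfl⟩, by rwa [this]⟩
  have hout : ∀ i, outerField φ (D.map (addRightEmbedding (2 • w))) (i + 2 • w) =
      outerField φ D i := fun i => by
    simp [outerField, Finset.sum_map]
  have : ∀ s, boundaryMag φ (D.map (addRightEmbedding (2 • w))) u s (x + 2 • w) =
      boundaryMag φ D u s x := fun s => by
    unfold boundaryMag
    rw [hodd, gibbsAv_translate]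
    simp only [hu, hout, pairCoupling, add_sub_add_right_eq_sub, add_sub_cancel_right]
    rfl
  rw [magGap, magGap, this, this]

/-! ### Uniqueness for almost every field strength -/

section
variable {Λ : Finset Site} {c : Site → Site → ℝ} {u v w : Site → ℝ} {ω : Config}

lemma energy_field_line (t : ℝ) (σ : Config) :
    energy Λ c (fun i => t * u i + w i) σ =
      energy Λ c w σ + t * ∑ i ∈ Λ, u i * spin (σ i) := by
  simp only [energy, add_mul, Finset.sum_add_distrib, Finset.mul_sum]
  simp only [mul_assoc]
  ring

lemma hasDerivAt_log_partition (t : ℝ) :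
    HasDerivAt (fun t => Real.log (spinSum Λ (weight Λ c fun i => t * u i + w i) ω))
      (∑ i ∈ Λ, u i * gibbsAv Λ c (fun i => t * u i + w i) ω fun σ => spin (σ i)) t := by
  have h1 : HasDerivAt (fun t => spinSum Λ (weight Λ c fun i => t * u i + w i) ω)
      (spinSum Λ (fun σ => (∑ i ∈ Λ, u i * spin (σ i)) *
        weight Λ c (fun i => t * u i + w i) σ) ω) t := by
    unfold spinSum
    refine HasDerivAt.fun_sum fun τ _ => ?_
    simp only [weight, energy_field_line]
    rw [mul_comm]
    refine HasDerivAt.exp ?_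
    simpa using (((hasDerivAt_id t).mul_const
      (∑ i ∈ Λ, u i * spin (glue Λ τ ω i))).const_add (energy Λ c w (glue Λ τ ω)))
  have h2 := h1.log partition_pos.ne'
  convert h2 using 1
  rw [← gibbsAv, gibbsAv_sum]
  simp only [gibbsAv_const_mul]

lemma log_partition_sub_le :
    Real.log (spinSum Λ (weight Λ c v) ω) - Real.log (spinSum Λ (weight Λ c w) ω) ≤
      ∑ i ∈ Λ, |v i - w i| := by
  rw [sub_le_iff_le_add, ← Real.log_exp (∑ i ∈ Λ, |v i - w i|),
    ← Real.log_mul (Real.exp_pos _).ne' partition_pos.ne', ← spinSum_const_mul]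
  refine Real.log_le_log partition_pos (spinSum_mono fun τ => ?_)
  rw [weight, weight, ← Real.exp_add, Real.exp_le_exp]
  unfold energy
  have : ∑ i ∈ Λ, v i * spin (glue Λ τ ω i) ≤
      ∑ i ∈ Λ, |v i - w i| + ∑ i ∈ Λ, w i * spin (glue Λ τ ω i) := by
    rw [← Finset.sum_add_distrib]
    refine Finset.sum_le_sum fun i _ => ?_
    have := le_abs_self ((v i - w i) * spin (glue Λ τ ω i))
    rw [abs_mul, abs_spin, mul_one] at this
    linarith
  linarith

lemma continuous_gibbsAv_field (f : Config → ℝ) :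
    Continuous fun t : ℝ => gibbsAv Λ c (fun i => t * u i + w i) ω f := by
  have hw : ∀ σ, Continuous fun t : ℝ => weight Λ c (fun i => t * u i + w i) σ := fun σ => by
    simp only [weight, energy_field_line]
    fun_prop
  unfold gibbsAv
  refine Continuous.div ?_ ?_ fun t => partition_pos.ne'
  · exact continuous_finsetSum _ fun τ _ => continuous_const.mul (hw _)
  · exact continuous_finsetSum _ fun τ _ => hw _

end

variable {φ : Site → ℝ}

lemma continuous_magGap (D : Finset Site) (u : Site → ℝ) (x : Site) :
    Continuous fun t : ℝ => magGap φ D (fun i => t * u i) x :=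
  (continuous_gibbsAv_field _).sub (continuous_gibbsAv_field _)

/-- The integrand is the derivative in `t` of `log Z⁺ - log Z⁻`. At either endpoint the two
partition functions differ only by the boundary fields, so the integral is a surface term. -/
lemma IsAxisInteraction.integral_magGap_le (hφ : IsAxisInteraction φ) (D : Finset Site)
    (u : Site → ℝ) :
    ∑ i ∈ oddPart D, u i * ∫ t in (0 : ℝ)..1, magGap φ D (fun i => t * u i) i ≤
      4 * ∑ i ∈ oddPart D, outerField φ D i := by
  set Λ := oddPart D
  let F : ℝ → ℝ → ℝ := fun s t => Real.log (spinSum Λ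
    (weight Λ (pairCoupling φ) fun i => t * u i + s * outerField φ D i) plusConfig)
  have hderiv : ∀ t, HasDerivAt (fun t => F 1 t - F (-1) t)
      (∑ i ∈ Λ, u i * magGap φ D (fun i => t * u i) i) t := fun t => by
    refine ((hasDerivAt_log_partition t).sub (hasDerivAt_log_partition t)).congr_deriv ?_
    rw [← Finset.sum_sub_distrib]
    exact Finset.sum_congr rfl fun i _ => by rw [← mul_sub]; rfl
  have hcont : Continuous fun t : ℝ => ∑ i ∈ Λ, u i * magGap φ D (fun i => t * u i) i :=
    continuous_finsetSum _ fun i _ => continuous_const.mul (continuous_magGap D u i)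
  have hftc := intervalIntegral.integral_eq_sub_of_hasDerivAt (a := 0) (b := 1)
    (fun t _ => hderiv t) (hcont.intervalIntegrable _ _)
  rw [intervalIntegral.integral_finsetSum
    (f := fun i t => u i * magGap φ D (fun i => t * u i) i) fun i _ =>
    (continuous_const.mul (continuous_magGap D u i)).intervalIntegrable _ _] at hftc
  simp only [intervalIntegral.integral_const_mul] at hftc
  rw [hftc]
  have habs : ∀ i, |2 * outerField φ D i| = 2 * outerField φ D i := fun i =>
    abs_of_nonneg (by have := hφ.outerField_nonneg D i; linarith)
  have h1 : F 1 1 - F (-1) 1 ≤ ∑ i ∈ Λ, 2 * outerField φ D i := by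
    refine log_partition_sub_le.trans (le_of_eq (Finset.sum_congr rfl fun i _ => ?_))
    rw [← habs]; congr 1; ring
  have h2 : F (-1) 0 - F 1 0 ≤ ∑ i ∈ Λ, 2 * outerField φ D i := by
    refine log_partition_sub_le.trans (le_of_eq (Finset.sum_congr rfl fun i _ => ?_))
    rw [← habs, ← abs_neg]; congr 1; ring
  rw [← Finset.mul_sum] at h1 h2
  linarith

/-- The averaged difference of the magnetizations vanishes in the limit. -/
lemma IsAxisInteraction.exists_integral_magGap_le (hφ : IsAxisInteraction φ) {x : Site}
    (hx : ¬ IsEvenSite x) (hHx : 0 < evenField φ x) {ε : ℝ} (hε : 0 < ε) :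
    ∃ n, x ∈ box n ∧
      ∫ t in (0 : ℝ)..1, magGap φ (box n) (fun i => t * evenField φ i) x ≤ ε := by
  set H := evenField φ
  obtain ⟨X, hX⟩ := exists_subset_box {x}
  have hX' := mem_box.1 (hX (Finset.mem_singleton_self x))
  -- The factor 64 is the 4 of `integral_magGap_le` times 16, the bound for the ratio of the area of
  -- `box (4 * m)` to that of `box m`.
  obtain ⟨N, hN⟩ := eventually_atTop.1
    (hφ.sum_outerField_le (ε := ε * H x / 64) (by positivity))
  set m := X + N
  have hout := hN (4 * m) (by omega)
  refine ⟨6 * m, box_mono (by omega) (hX (Finset.mem_singleton_self x)), ?_⟩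
  set I := ∫ t in (0 : ℝ)..1, magGap φ (box (6 * m)) (fun i => t * H i) x
  have hmem : ∀ w ∈ box m, x + 2 • w ∈ oddPart (box (4 * m)) := fun w hw => by
    rw [mem_oddPart, mem_box]
    rw [mem_box] at hw
    simp only [abs_le] at hw hX' ⊢
    simp only [two_nsmul, Prod.fst_add, Prod.snd_add]
    refine ⟨by push_cast; omega, ?_⟩
    simpa [IsEvenSite, Int.even_add] using hx
  -- For `w ∈ box m` the translate of `box (6 * m)` by `2 • w` still contains `box (4 * m)`. The gap
  -- at `x` in the large box is thus bounded by the gap at each of the `(2 m + 1)²` translates of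
  -- `x` in the smaller one, hence by their average.
  have hgap : ∀ w ∈ box m, ∀ t : ℝ, magGap φ (box (6 * m)) (fun i => t * H i) x ≤
      magGap φ (box (4 * m)) (fun i => t * H i) (x + 2 • w) := fun w hw t => by
    rw [← magGap_translate w (fun i => by simp only [H, evenField_add])]
    refine hφ.magGap_antitone (fun i hi => ?_) (hmem w hw)
    rw [Finset.mem_map]
    refine ⟨i - 2 • w, ?_, by simp⟩
    rw [mem_box] at hw hi ⊢
    simp only [abs_le] at hw hi ⊢
    simp only [two_nsmul, Prod.fst_sub, Prod.snd_sub, Prod.fst_add, Prod.snd_add]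
    push_cast at hi ⊢
    omega
  have hintg : ∀ i, 0 ≤ H i * ∫ t in (0 : ℝ)..1, magGap φ (box (4 * m)) (fun i => t * H i) i :=
    fun i => mul_nonneg (hφ.evenField_nonneg i)
      (intervalIntegral.integral_nonneg zero_le_one fun t _ => hφ.magGap_nonneg)
  have hinj : Set.InjOn (fun w : Site => x + 2 • w) (box m) := by
    rintro ⟨a, b⟩ _ ⟨a', b'⟩ _ h
    have := add_left_cancel h
    simp only [Prod.smul_mk, Prod.mk.injEq, nsmul_eq_mul] at this
    simp only [Prod.mk.injEq]
    push_cast at this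
    omega
  have hlow : ((2 * m + 1 : ℕ) : ℝ) ^ 2 * (H x * I) ≤
      ∑ i ∈ oddPart (box (4 * m)), H i * ∫ t in (0 : ℝ)..1,
        magGap φ (box (4 * m)) (fun i => t * H i) i := by
    calc _ = ∑ w ∈ box m, H x * I := by
          rw [Finset.sum_const, card_box, nsmul_eq_mul]; push_cast; ring
      _ ≤ ∑ w ∈ box m, H (x + 2 • w) * ∫ t in (0 : ℝ)..1,
          magGap φ (box (4 * m)) (fun i => t * H i) (x + 2 • w) := by
          refine Finset.sum_le_sum fun w hw => ?_
          rw [show H (x + 2 • w) = H x from evenField_add x w]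
          refine mul_le_mul_of_nonneg_left ?_ hHx.le
          exact intervalIntegral.integral_mono_on zero_le_one
            ((continuous_magGap _ _ _).intervalIntegrable _ _)
            ((continuous_magGap _ _ _).intervalIntegrable _ _) fun t _ => hgap w hw t
      _ = ∑ i ∈ (box m).image (fun w : Site => x + 2 • w), H i * ∫ t in (0 : ℝ)..1,
          magGap φ (box (4 * m)) (fun i => t * H i) i :=
          (Finset.sum_image (f := fun i => H i * ∫ t in (0 : ℝ)..1,
            magGap φ (box (4 * m)) (fun i => t * H i) i) hinj).symm
      _ ≤ _ := Finset.sum_le_sum_of_subset_of_nonneg (fun i hi => by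
          obtain ⟨w, hw, rfl⟩ := Finset.mem_image.1 hi
          exact hmem w hw) fun i _ _ => hintg i
  have hup := hφ.integral_magGap_le (box (4 * m)) H
  have hsub : ∑ i ∈ oddPart (box (4 * m)), outerField φ (box (4 * m)) i ≤
      ∑ i ∈ box (4 * m), outerField φ (box (4 * m)) i :=
    Finset.sum_le_sum_of_subset_of_nonneg (Finset.filter_subset _ _)
      fun i _ _ => hφ.outerField_nonneg _ _
  have hfin : ((2 * m + 1 : ℕ) : ℝ) ^ 2 * (H x * I) ≤
      4 * (ε * H x / 64 * (2 * ((4 * m : ℕ) : ℝ) + 1) ^ 2) := by linarith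
  have hm0 : (0 : ℝ) ≤ m := by positivity
  have hratio : (2 * ((4 * m : ℕ) : ℝ) + 1) ^ 2 ≤ 16 * ((2 * m + 1 : ℕ) : ℝ) ^ 2 := by
    push_cast; nlinarith
  have hpos : (0 : ℝ) < ((2 * m + 1 : ℕ) : ℝ) ^ 2 := by positivity
  have h3 : ((2 * m + 1 : ℕ) : ℝ) ^ 2 * (H x * I) ≤ ((2 * m + 1 : ℕ) : ℝ) ^ 2 * (H x * ε) := by
    have : 0 ≤ ε * H x := by positivity
    nlinarith
  exact le_of_mul_le_mul_left (le_of_mul_le_mul_left h3 hpos) hHx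

/-- For a suitable strength `t ∈ [0, 1]` of the field created by the even sites, the boundary
conditions have no influence on the magnetization in the infinite-volume limit. -/
lemma IsAxisInteraction.exists_tendsto_magGap (hφ : IsAxisInteraction φ) :
    ∃ t ∈ Set.Icc (0 : ℝ) 1, ∀ x, ¬ IsEvenSite x → 0 < evenField φ x →
      Tendsto (fun n => magGap φ (box n) (fun i => t * evenField φ i) x) atTop (𝓝 0) := by
  set H := evenField φ
  have hae : ∀ᵐ t ∂(volume.restrict (Set.Icc (0 : ℝ) 1)), ∀ x : {x // ¬ IsEvenSite x ∧ 0 < H x},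
      ∀ k : ℕ, ∃ n, (x : Site) ∈ box n ∧
        magGap φ (box n) (fun i => t * H i) x < 1 / ((k : ℝ) + 1) := by
    rw [ae_all_iff]
    rintro ⟨x, hx, hHx⟩
    rw [ae_all_iff]
    intro k
    rw [ae_iff]
    set a : ℝ := 1 / ((k : ℝ) + 1)
    have ha : 0 < a := by positivity
    set μ := volume.restrict (Set.Icc (0 : ℝ) 1)
    -- Markov's inequality: the `t` at which the gap stays at least `a` in every box have measure at
    -- most `ε`, for each `ε`.
    have hbound : ∀ ε > 0, μ.real {t | ¬ ∃ n, x ∈ box n ∧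
        magGap φ (box n) (fun i => t * H i) x < a} ≤ ε := by
      intro ε hε
      obtain ⟨n, hxn, hn⟩ := hφ.exists_integral_magGap_le hx hHx (mul_pos ha hε)
      have hmark := mul_meas_ge_le_integral_of_nonneg (μ := μ)
        (f := fun t => magGap φ (box n) (fun i => t * H i) x)
        (Eventually.of_forall fun t => hφ.magGap_nonneg)
        ((continuous_magGap _ _ _).integrableOn_Icc) a
      rw [intervalIntegral.integral_of_le zero_le_one, ← integral_Icc_eq_integral_Ioc] at hn
      have hle : μ.real {t | ¬ ∃ n, x ∈ box n ∧ magGap φ (box n) (fun i => t * H i) x < a} ≤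
          μ.real {t | a ≤ magGap φ (box n) (fun i => t * H i) x} := by
        refine measureReal_mono fun t ht => ?_
        by_contra hcon
        exact ht ⟨n, hxn, not_le.1 hcon⟩
      have : a * μ.real {t | a ≤ magGap φ (box n) (fun i => t * H i) x} ≤ a * ε := hmark.trans hn
      exact hle.trans (le_of_mul_le_mul_left this ha)
    have h0 : μ.real {t | ¬ ∃ n, x ∈ box n ∧ magGap φ (box n) (fun i => t * H i) x < a} = 0 :=
      le_antisymm (le_of_forall_pos_le_add fun ε hε => by simpa using hbound ε hε)
        measureReal_nonneg
    exact (measureReal_eq_zero_iff (by finiteness)).1 h0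
  -- The conditions are countably many, one for each site and each `k`, so almost every `t`
  -- satisfies them all; `[0, 1]` has positive measure, so such a `t` exists.
  have hne : (ae (volume.restrict (Set.Icc (0 : ℝ) 1))).NeBot := by
    rw [ae_neBot, Ne, Measure.restrict_eq_zero]
    simp
  obtain ⟨t, ht, htI⟩ := (hae.and (ae_restrict_mem measurableSet_Icc)).exists
  refine ⟨t, htI, fun x hx hHx => ?_⟩
  rw [Metric.tendsto_atTop]
  intro ε hε
  obtain ⟨k, hk⟩ := exists_nat_one_div_lt hε
  obtain ⟨n, hxn, hn⟩ := ht ⟨x, hx, hHx⟩ k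
  refine ⟨n, fun n' hn' => ?_⟩
  rw [Real.dist_eq, sub_zero, abs_of_nonneg hφ.magGap_nonneg]
  have := hφ.magGap_antitone (u := fun i => t * H i) (box_mono hn')
    (mem_oddPart.2 ⟨hxn, hx⟩)
  linarith

/-! ### Insensitivity to the boundary for summable perturbations of the field -/

variable {φ : Site → ℝ}

lemma abs_exp_sub_exp_le {a b B : ℝ} (ha : a ≤ B) (hb : b ≤ B) :
    |Real.exp a - Real.exp b| ≤ Real.exp B * |a - b| := by
  wlog hab : b ≤ a generalizing a b
  · rw [abs_sub_comm, abs_sub_comm a]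
    exact this hb ha (le_of_not_ge hab)
  rw [abs_of_nonneg (sub_nonneg.2 (Real.exp_le_exp.2 hab)), abs_of_nonneg (sub_nonneg.2 hab)]
  have h1 : Real.exp a - Real.exp b = Real.exp a * (1 - Real.exp (b - a)) := by
    rw [mul_sub, ← Real.exp_add]; ring_nf
  have h2 : 1 - Real.exp (b - a) ≤ a - b := by
    have := Real.add_one_le_exp (b - a); linarith
  rw [h1]
  have h3 : Real.exp a ≤ Real.exp B := Real.exp_le_exp.2 ha
  exact mul_le_mul h3 h2 (by
    have : Real.exp (b - a) ≤ 1 := Real.exp_le_one_iff.2 (by linarith)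
    linarith) (Real.exp_pos _).le

lemma abs_div_sub_div_le {a a' b b' A β : ℝ} (hβ : 0 < β) (hb : β ≤ b) (hb' : β ≤ b')
    (ha0 : 0 ≤ a') (ha : a' ≤ A) :
    |a / b - a' / b'| ≤ |a - a'| * β⁻¹ + |b - b'| * (A * (β⁻¹ * β⁻¹)) := by
  have hb1 := hβ.trans_le hb
  have hb2 := hβ.trans_le hb'
  have e : a / b - a' / b' = (a - a') * b⁻¹ - (b - b') * (a' * (b⁻¹ * b'⁻¹)) := by
    field_simp
    ring
  rw [e]
  refine (abs_sub _ _).trans (add_le_add ?_ ?_)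
  · rw [abs_mul, abs_of_pos (inv_pos.2 hb1)]
    gcongr
  · rw [abs_mul]
    refine mul_le_mul_of_nonneg_left ?_ (abs_nonneg _)
    rw [abs_of_nonneg (by positivity)]
    gcongr
    exact ha0.trans ha

lemma abs_linear_le (Λ : Finset Site) (l : Site → ℝ) (σ : Config) :
    |∑ x ∈ Λ, l x * spin (σ x)| ≤ ∑ x ∈ Λ, |l x| :=
  (Finset.abs_sum_le_sum_abs _ _).trans (le_of_eq (Finset.sum_congr rfl fun x _ => by
    rw [abs_mul, abs_spin, mul_one]))

/-- Expectation in the volume `oddPart (box n)` under the field `u` plus `s` times the boundary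
field. -/
noncomputable def boxAv (φ : Site → ℝ) (n : ℕ) (u : Site → ℝ) (s : ℝ) (f : Config → ℝ) : ℝ :=
  gibbsAv (oddPart (box n)) (pairCoupling φ) (fun i => u i + s * outerField φ (box n) i)
    plusConfig f

/-- The exponential of a linear function of the spins in `oddPart (box n)`. -/
noncomputable def expLin (n : ℕ) (l : Site → ℝ) (σ : Config) : ℝ :=
  Real.exp (∑ x ∈ oddPart (box n), l x * spin (σ x))

lemma sum_abs_le_tsum {l : Site → ℝ} (hl : Summable fun x => |l x|) (Λ : Finset Site) :
    ∑ x ∈ Λ, |l x| ≤ ∑' x, |l x| := hl.sum_le_tsum _ fun _ _ => abs_nonneg _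

lemma expLin_le {l : Site → ℝ} (hl : Summable fun x => |l x|) (n : ℕ) (σ : Config) :
    expLin n l σ ≤ Real.exp (∑' x, |l x|) :=
  Real.exp_le_exp.2 ((le_abs_self _).trans
    ((abs_linear_le _ _ _).trans (sum_abs_le_tsum hl _)))

lemma le_expLin {l : Site → ℝ} (hl : Summable fun x => |l x|) (n : ℕ) (σ : Config) :
    Real.exp (-∑' x, |l x|) ≤ expLin n l σ :=
  Real.exp_le_exp.2 ((neg_le_neg ((abs_linear_le _ _ _).trans (sum_abs_le_tsum hl _))).trans
    (neg_abs_le _))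

/-- The exponential is Lipschitz in the spin at `x` with constant `exp B * |l x|`, so the difference
is at most `exp B * ∑ |l x| magGap x`. This tends to 0 by dominated convergence, since each gap is
at most 2. -/
lemma IsAxisInteraction.tendsto_boxAv_expLin_sub (hφ : IsAxisInteraction φ) {u l : Site → ℝ}
    (hl : Summable fun x => |l x|)
    (hu : ∀ x, ¬ IsEvenSite x → l x ≠ 0 →
      Tendsto (fun n => magGap φ (box n) u x) atTop (𝓝 0)) :
    Tendsto (fun n => boxAv φ n u 1 (expLin n l) - boxAv φ n u (-1) (expLin n l)) atTop
      (𝓝 0) := by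
  set B := ∑' x, |l x|
  have hbound : ∀ n, |boxAv φ n u 1 (expLin n l) - boxAv φ n u (-1) (expLin n l)| ≤
      Real.exp B * ∑' x, if x ∈ oddPart (box n) then |l x| * magGap φ (box n) u x else 0 := by
    intro n
    have h1 := abs_gibbsAv_sub_le (Λ := oddPart (box n)) (c := pairCoupling φ)
      (v := fun i => u i + (-1) * outerField φ (box n) i)
      (v' := fun i => u i + 1 * outerField φ (box n) i) (ω := plusConfig)
      (f := expLin n l) (δ := fun x => Real.exp B * |l x|) (fun i _ j _ => hφ.nonneg _)
      (fun i _ => by linarith [hφ.outerField_nonneg (box n) i]) (fun σ σ' => by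
        refine (abs_exp_sub_exp_le (B := B) ?_ ?_).trans ?_
        · exact (le_abs_self _).trans ((abs_linear_le _ _ _).trans (sum_abs_le_tsum hl _))
        · exact (le_abs_self _).trans ((abs_linear_le _ _ _).trans (sum_abs_le_tsum hl _))
        · simp only [mul_assoc]
          rw [← Finset.mul_sum, ← Finset.sum_sub_distrib]
          refine mul_le_mul_of_nonneg_left ?_ (Real.exp_pos _).le
          refine (Finset.abs_sum_le_sum_abs _ _).trans (le_of_eq ?_)
          exact Finset.sum_congr rfl fun x _ => by rw [← mul_sub, abs_mul])
    refine h1.trans (le_of_eq ?_)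
    simp only [mul_assoc]
    rw [← Finset.mul_sum, tsum_eq_sum (s := oddPart (box n))
      (fun x hx => if_neg hx)]
    congr 1
    exact Finset.sum_congr rfl fun x hx => by rw [if_pos hx]; rfl
  have hlim : Tendsto (fun n => ∑' x, if x ∈ oddPart (box n) then
      |l x| * magGap φ (box n) u x else 0) atTop (𝓝 (∑' _ : Site, (0 : ℝ))) := by
    refine tendsto_tsum_of_dominated_convergence (hl.mul_right 2) (fun x => ?_)
      (Eventually.of_forall fun n x => ?_)
    · by_cases hx : IsEvenSite x
      · simp only [mem_oddPart, hx, not_true, and_false, if_false]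
        exact tendsto_const_nhds
      by_cases hlx : l x = 0
      · simp [hlx]
      have h0 := (hu x hx hlx).const_mul |l x|
      rw [mul_zero] at h0
      refine squeeze_zero (fun n => ?_) (fun n => ?_) h0
      · split_ifs
        exacts [mul_nonneg (abs_nonneg _) hφ.magGap_nonneg, le_rfl]
      · split_ifs
        exacts [le_rfl, mul_nonneg (abs_nonneg _) hφ.magGap_nonneg]
    · rw [Real.norm_eq_abs]
      split_ifs
      · rw [abs_mul, abs_abs, abs_of_nonneg hφ.magGap_nonneg]
        exact mul_le_mul_of_nonneg_left magGap_le_two (abs_nonneg _)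
      · rw [abs_zero]; positivity
  rw [tsum_zero] at hlim
  have := hlim.const_mul (Real.exp B)
  rw [mul_zero] at this
  exact squeeze_zero_norm hbound this

lemma boxAv_expLin_pos (n : ℕ) (u l : Site → ℝ) (s : ℝ) : 0 < boxAv φ n u s (expLin n l) := by
  refine lt_of_lt_of_le (Real.exp_pos (-∑ x ∈ oddPart (box n), |l x|))
    (const_le_gibbsAv fun τ => ?_)
  exact Real.exp_le_exp.2 ((neg_le_neg (abs_linear_le _ _ _)).trans (neg_abs_le _))

/-- The same conclusion for a summable perturbation of the field. -/
lemma IsAxisInteraction.tendsto_boxAv_perturbed (hφ : IsAxisInteraction φ) {u k l : Site → ℝ}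
    (hl : Summable fun x => |l x|) (hk : Summable fun x => |k x - u x|)
    (hu : ∀ x, ¬ IsEvenSite x → (l x ≠ 0 ∨ k x ≠ u x) →
      Tendsto (fun n => magGap φ (box n) u x) atTop (𝓝 0)) :
    Tendsto (fun n => boxAv φ n k 1 (expLin n l) - boxAv φ n k (-1) (expLin n l)) atTop
      (𝓝 0) := by
  have hlk : Summable fun x => |l x + (k x - u x)| :=
    Summable.of_nonneg_of_le (fun _ => abs_nonneg _) (fun _ => abs_add_le _ _) (hl.add hk)
  -- Changing the field from `u` to `k` tilts by `exp ∑ (k - u) σ`. The expectation becomes a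
  -- quotient of exponential moments in the field `u`, with denominators bounded away from 0
  -- uniformly in the box because `k - u` is summable.
  have hchange : ∀ n s, boxAv φ n k s (expLin n l) =
      boxAv φ n u s (expLin n fun x => l x + (k x - u x)) /
        boxAv φ n u s (expLin n fun x => k x - u x) := fun n s => by
    unfold boxAv
    rw [gibbsAv_field_change (v := fun i => u i + s * outerField φ (box n) i)]
    have e : (expLin n fun x => l x + (k x - u x)) =
        fun σ => expLin n l σ * expLin n (fun x => k x - u x) σ := by
      ext σ
      simp only [expLin, add_mul, Finset.sum_add_distrib, Real.exp_add]
    rw [e]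
    simp only [add_sub_add_right_eq_sub, expLin]
    rfl
  set a : ℕ → ℝ → ℝ := fun n s => boxAv φ n u s (expLin n fun x => l x + (k x - u x)) with ha
  set b : ℕ → ℝ → ℝ := fun n s => boxAv φ n u s (expLin n fun x => k x - u x) with hb
  set A := Real.exp (∑' x, |l x + (k x - u x)|)
  set β := Real.exp (-∑' x, |k x - u x|)
  have hβ : 0 < β := Real.exp_pos _
  have hbβ : ∀ n s, β ≤ b n s := fun n s => const_le_gibbsAv fun τ => le_expLin hk n _
  have haA : ∀ n s, a n s ≤ A := fun n s => gibbsAv_le_const fun τ => expLin_le hlk n _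
  have ha0 : ∀ n s, 0 ≤ a n s := fun n s => (boxAv_expLin_pos n u _ s).le
  have hta := hφ.tendsto_boxAv_expLin_sub (u := u) hlk (fun x hx hne => hu x hx (by
    by_contra h; push Not at h; simp [h.1, h.2] at hne))
  have htb := hφ.tendsto_boxAv_expLin_sub (u := u) hk (fun x hx hne => hu x hx (Or.inr (by
    intro h; simp [h] at hne)))
  have hlim := (hta.abs.mul_const β⁻¹).add (htb.abs.mul_const (A * (β⁻¹ * β⁻¹)))
  rw [abs_zero, zero_mul, zero_mul, add_zero] at hlim
  refine squeeze_zero_norm (fun n => ?_) hlim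
  rw [hchange, hchange]
  change |a n 1 / b n 1 - a n (-1) / b n (-1)| ≤
    |a n 1 - a n (-1)| * β⁻¹ + |b n 1 - b n (-1)| * (A * (β⁻¹ * β⁻¹))
  exact abs_div_sub_div_le hβ (hbβ n 1) (hbβ n (-1)) (ha0 n (-1)) (haA n (-1))

/-! ### Spontaneous magnetization near the origin -/

/-- The Peierls condition on the interaction. -/
structure IsStrong (φ : Site → ℝ) (K : ℝ) : Prop where
  nonneg : 0 ≤ K
  large : 3240 * Real.exp (-K) ≤ 1
  le_fst : K ≤ φ (2, 0)
  le_snd : K ≤ φ (0, 1)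

/-- The odd columns avoid the even sites and are contained in the hidden system; neighbouring
columns are at distance 2, which is why `φ (2, 0)` enters the Peierls condition. -/
lemma IsAxisInteraction.half_le_boxAv (hφ : IsAxisInteraction φ) {K : ℝ} (hK : IsStrong φ K)
    {k : Site → ℝ} (hk : ∀ i, ¬ IsEvenSite i → 0 ≤ k i) (n : ℕ) :
    1 / 2 ≤ boxAv φ n k 1 (fun σ => spin (σ (1, 0))) := by
  have hodd : ∀ p, ¬ IsEvenSite (oddCol p) := fun p h => by
    have := h.1
    simp only [oddCol] at this
    exact Int.not_even_iff_odd.2 (odd_two_mul_add_one p.1) this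
  have hnn : ∀ p, ∀ d ∈ dirs, K ≤ φ (oddCol (p + d) - oddCol p) := fun p d hd => by
    have : oddCol (p + d) - oddCol p = (2 * d.1, d.2) := by
      simp only [oddCol, Prod.mk_sub_mk, Prod.fst_add, Prod.snd_add]
      congr 1 <;> ring
    rw [this]
    simp only [dirs, Finset.mem_insert, Finset.mem_singleton] at hd
    rcases hd with rfl | rfl | rfl | rfl
    · exact hK.le_fst
    · simpa [hφ.reflect_fst] using hK.le_fst
    · exact hK.le_snd
    · simpa [hφ.reflect_snd] using hK.le_snd
  -- The bounds on the first coordinate solve `-n ≤ 2 a + 1 ≤ n` in integers; the site `(1, 0)` is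
  -- `oddCol (0, 0)`.
  refine half_le_gibbsAv_spin (A₀ := -((n + 1) / 2)) (A₁ := ((n : ℤ) - 1) / 2) (B₀ := -n)
    (B₁ := n) hK.nonneg hK.large (fun p => ?_) (fun i j => hφ.nonneg _) (fun i hi => ?_)
    (fun p d hd => ?_) (fun p _ d hd hout => ?_) (0, 0)
  · rw [mem_rect, mem_oddPart, mem_box]
    simp only [hodd, not_false_iff, and_true]
    simp only [oddCol, abs_le]
    omega
  · have := hk i (mem_oddPart.1 hi).2
    have := hφ.outerField_nonneg (box n) i
    linarith
  · exact hnn p d hd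
  · have hout' : oddCol (p + d) ∉ box n := fun h => hout (mem_oddPart.2 ⟨h, hodd _⟩)
    have h1 := hφ.le_outerField (i := oddCol p) hout'
    have h2 := hnn p d hd
    have h3 := hk (oddCol p) (hodd p)
    linarith

lemma sinh_eq_expLin (n : ℕ) (l : Site → ℝ) (σ : Config) :
    Real.sinh (∑ x ∈ oddPart (box n), l x * spin (σ x)) =
      1 / 2 * (expLin n l σ - expLin n (fun x => -l x) σ) := by
  simp only [expLin, neg_mul, Finset.sum_neg_distrib, Real.sinh_eq]
  ring

/-- The difference is `2 ⟨sinh X⟩`, hence at least `2 ⟨X⟩`. By the first Griffiths inequality every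
term of `⟨X⟩` is nonnegative, and the site `(1, 0)` alone contributes at least `2 φ (1, 0) * 1/2`.
-/
lemma IsAxisInteraction.le_boxAv_expLin_sub (hφ : IsAxisInteraction φ) {K : ℝ}
    (hK : IsStrong φ K) {k : Site → ℝ} (hk : ∀ i, ¬ IsEvenSite i → 0 ≤ k i) {n : ℕ}
    (hn : 1 ≤ n) :
    2 * φ (1, 0) ≤ boxAv φ n k 1 (expLin n fun x => 2 * φ x) -
      boxAv φ n k 1 (expLin n fun x => -(2 * φ x)) := by
  set X : Config → ℝ := fun σ => ∑ x ∈ oddPart (box n), 2 * φ x * spin (σ x)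
  have hX : X ∈ charCone := charCone_sum fun x _ =>
    mem_charCone_of_isChar (by have := hφ.nonneg x; linarith) (isChar_spin x)
  have hv : ∀ i ∈ oddPart (box n), 0 ≤ k i + 1 * outerField φ (box n) i := fun i hi => by
    have := hk i (mem_oddPart.1 hi).2
    have := hφ.outerField_nonneg (box n) i
    linarith
  have h1 : boxAv φ n k 1 X ≤ boxAv φ n k 1 (fun σ => Real.sinh (X σ)) :=
    gibbsAv_le_gibbsAv_sinh (fun i _ j _ => hφ.nonneg _) hv hX
  have h10 : ((1, 0) : Site) ∈ oddPart (box n) := by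
    rw [mem_oddPart, mem_box]
    refine ⟨by simp; omega, ?_⟩
    simp [IsEvenSite]
  have h2 : φ (1, 0) ≤ boxAv φ n k 1 X := by
    have e : boxAv φ n k 1 X = ∑ x ∈ oddPart (box n), 2 * φ x *
        boxAv φ n k 1 (fun σ => spin (σ x)) := by
      unfold boxAv
      simp only [X, gibbsAv_sum, gibbsAv_const_mul]
    rw [e]
    have hsingle := Finset.single_le_sum (f := fun x => 2 * φ x *
      boxAv φ n k 1 (fun σ => spin (σ x))) (fun x _ => mul_nonneg
        (by have := hφ.nonneg x; linarith) (gibbsAv_nonneg_of_mem_charCone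
          (fun i _ j _ => hφ.nonneg _) hv (spin_mem_charCone x))) h10
    have := hφ.half_le_boxAv hK hk n
    have := hφ.pos_fst
    nlinarith
  have h3 : boxAv φ n k 1 (fun σ => Real.sinh (X σ)) = 1 / 2 *
      (boxAv φ n k 1 (expLin n fun x => 2 * φ x) -
        boxAv φ n k 1 (expLin n fun x => -(2 * φ x))) := by
    unfold boxAv
    simp only [X, sinh_eq_expLin, gibbsAv_const_mul, gibbsAv_sub]
  linarith

/-! ### Fields created by alternating spins inside a finite set -/

/-- The value at the even site `j` of the pattern that is `ε` times the alternating configuration on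
`Λ` and plus elsewhere. -/
noncomputable def altPattern (ε : ℝ) (Λ : Finset Site) (j : Site) : ℝ :=
  if (j.1 / 2, j.2 / 2) ∈ Λ then ε * spin (altConfig (j.1 / 2, j.2 / 2)) else 1

/-- The field created by the pattern `altPattern ε Λ` on the even sites. -/
noncomputable def altField (φ : Site → ℝ) (ε : ℝ) (Λ : Finset Site) (i : Site) : ℝ :=
  ∑' j : Site, if IsEvenSite j then φ (j - i) * altPattern ε Λ j else 0

lemma abs_altPattern_le {ε : ℝ} (hε : |ε| = 1) (Λ : Finset Site) (j : Site) :
    |altPattern ε Λ j| ≤ 1 := by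
  unfold altPattern
  split_ifs
  · rw [abs_mul, hε, abs_spin, one_mul]
  · simp

lemma IsAxisInteraction.summable_altField (hφ : IsAxisInteraction φ) {ε : ℝ} (hε : |ε| = 1)
    (Λ : Finset Site) (i : Site) :
    Summable fun j : Site => if IsEvenSite j then φ (j - i) * altPattern ε Λ j else 0 := by
  refine Summable.of_norm_bounded (hφ.summable_sub i) fun j => ?_
  rw [Real.norm_eq_abs]
  split_ifs
  · rw [abs_mul, abs_of_nonneg (hφ.nonneg _)]
    exact mul_le_of_le_one_right (hφ.nonneg _) (abs_altPattern_le hε Λ j)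
  · rw [abs_zero]; exact hφ.nonneg _

lemma spin_altConfig_add {p q : Site} (h : Odd (p.1 + p.2 + q.1 + q.2)) :
    spin (altConfig p) + spin (altConfig q) = 0 := by
  have h' : (p.1 + p.2 + q.1 + q.2) = (p.1 + p.2) + (q.1 + q.2) := by ring
  rw [h'] at h
  unfold altConfig
  rcases Int.even_or_odd (p.1 + p.2) with h1 | h1
  · have h2 : ¬ Even (q.1 + q.2) := fun h2 => Int.not_even_iff_odd.2 h (h1.add h2)
    simp [h1, h2]
  · have h2 : Even (q.1 + q.2) := by
      by_contra h2
      exact Int.not_even_iff_odd.2 h (h1.add_odd (Int.not_even_iff_odd.1 h2))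
    simp [Int.not_even_iff_odd.2 h1, h2]

/-- Reflected even sites carry opposite alternating spins, so their fields never add up to something
negative. -/
lemma altPattern_add_nonneg {ε : ℝ} (hε : |ε| = 1) (Λ : Finset Site) {j j' : Site}
    (h : Odd (j.1 / 2 + j.2 / 2 + j'.1 / 2 + j'.2 / 2)) :
    0 ≤ altPattern ε Λ j + altPattern ε Λ j' := by
  have h1 := abs_le.1 (abs_altPattern_le hε Λ j)
  have h2 := abs_le.1 (abs_altPattern_le hε Λ j')
  by_cases hj : (j.1 / 2, j.2 / 2) ∈ Λ
  · by_cases hj' : (j'.1 / 2, j'.2 / 2) ∈ Λ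
    · have := spin_altConfig_add (p := (j.1 / 2, j.2 / 2)) (q := (j'.1 / 2, j'.2 / 2)) h
      rw [altPattern, altPattern, if_pos hj, if_pos hj', ← mul_add, this, mul_zero]
    · rw [altPattern.eq_def ε Λ j', if_neg hj']
      linarith
  · rw [altPattern.eq_def ε Λ j, if_neg hj]
    linarith

/-- Some coordinate of `i` is odd. Reflection in it preserves the even sites and the interaction
with `i`, and changes the parity of the halved coordinates, so reflected partners carry opposite
alternating spins. Averaging the field with its reflection leaves only nonnegative terms. -/
lemma IsAxisInteraction.altField_nonneg (hφ : IsAxisInteraction φ) {ε : ℝ} (hε : |ε| = 1)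
    (Λ : Finset Site) {i : Site} (hi : ¬ IsEvenSite i) : 0 ≤ altField φ ε Λ i := by
  obtain ⟨r, hr1, hr2, hr3⟩ : ∃ r : Site ≃ Site, (∀ j, IsEvenSite (r j) ↔ IsEvenSite j) ∧
      (∀ j, φ (r j - i) = φ (j - i)) ∧
      ∀ j, IsEvenSite j → Odd (j.1 / 2 + j.2 / 2 + (r j).1 / 2 + (r j).2 / 2) := by
    obtain ⟨a, b⟩ := i
    rcases Int.even_or_odd a with ha | ha
    · have hb : Odd b := by
        by_contra hb
        exact hi ⟨ha, Int.not_odd_iff_even.1 hb⟩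
      refine ⟨⟨fun j => (j.1, 2 * b - j.2), fun j => (j.1, 2 * b - j.2), fun j => by simp,
        fun j => by simp⟩, fun j => by simp [IsEvenSite, Int.even_sub], fun j => ?_, ?_⟩
      · simp only [Equiv.coe_fn_mk]
        rw [show ((j.1, 2 * b - j.2) : Site) - (a, b) = (j.1 - a, -(j.2 - b)) by
          ext <;> simp; ring, hφ.reflect_snd]
        rfl
      · rintro ⟨x, y⟩ ⟨hx, hy⟩
        simp only [Equiv.coe_fn_mk] at hx hy ⊢
        obtain ⟨x', rfl⟩ := hx
        obtain ⟨y', rfl⟩ := hy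
        obtain ⟨b', rfl⟩ := hb
        exact ⟨x' + b', by omega⟩
    · refine ⟨⟨fun j => (2 * a - j.1, j.2), fun j => (2 * a - j.1, j.2), fun j => by simp,
        fun j => by simp⟩, fun j => by simp [IsEvenSite, Int.even_sub], fun j => ?_, ?_⟩
      · simp only [Equiv.coe_fn_mk]
        rw [show ((2 * a - j.1, j.2) : Site) - (a, b) = (-(j.1 - a), j.2 - b) by
          ext <;> simp; ring, hφ.reflect_fst]
        rfl
      · rintro ⟨x, y⟩ ⟨hx, hy⟩
        simp only [Equiv.coe_fn_mk] at hx hy ⊢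
        obtain ⟨x', rfl⟩ := hx
        obtain ⟨y', rfl⟩ := hy
        obtain ⟨a', rfl⟩ := ha
        exact ⟨y' + a', by omega⟩
  have hs := hφ.summable_altField hε Λ i
  have h1 : altField φ ε Λ i = ∑' j : Site,
      if IsEvenSite j then φ (j - i) * altPattern ε Λ (r j) else 0 := by
    rw [altField, ← r.tsum_eq]
    refine tsum_congr fun j => ?_
    simp only [hr1, hr2]
  have hs' : Summable fun j : Site =>
      if IsEvenSite j then φ (j - i) * altPattern ε Λ (r j) else 0 := by
    refine (r.summable_iff.2 hs).congr fun j => ?_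
    simp only [Function.comp_apply, hr1, hr2]
  have h2 : altField φ ε Λ i + altField φ ε Λ i = ∑' j : Site,
      ((if IsEvenSite j then φ (j - i) * altPattern ε Λ j else 0) +
      if IsEvenSite j then φ (j - i) * altPattern ε Λ (r j) else 0) := by
    rw [hs.tsum_add hs', ← h1]
    rfl
  have h3 : 0 ≤ altField φ ε Λ i + altField φ ε Λ i := by
    rw [h2]
    refine tsum_nonneg fun j => ?_
    split_ifs with hj
    · rw [← mul_add]
      exact mul_nonneg (hφ.nonneg _) (altPattern_add_nonneg hε Λ (hr3 j hj))
    · simp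
  linarith

/-- The pattern differs from all plus only at the doubled points of the finite set `Λ`, by at most 2
each; the bound is summable over `i`. -/
lemma IsAxisInteraction.evenField_sub_altField_le (hφ : IsAxisInteraction φ) {ε : ℝ}
    (hε : |ε| = 1) (Λ : Finset Site) (i : Site) :
    evenField φ i - altField φ ε Λ i ≤ 2 * ∑ p ∈ Λ, φ (2 • p - i) := by
  have hs := hφ.summable_altField hε Λ i
  rw [evenField, altField, ← (hφ.summable_even i).tsum_sub hs]
  have hinj : Function.Injective fun p : Site => 2 • p := fun p q h => by
    obtain ⟨a, b⟩ := p
    obtain ⟨a', b'⟩ := q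
    simp only [two_nsmul, Prod.mk_add_mk, Prod.mk.injEq] at h ⊢
    omega
  rw [Finset.mul_sum, ← Finset.sum_image (s := Λ) (g := fun p : Site => 2 • p)
    (f := fun j => 2 * φ (j - i)) fun p _ q _ h => hinj h]
  have hzero : ∀ j ∉ Λ.image (fun p : Site => 2 • p),
      ((if IsEvenSite j then φ (j - i) else 0) -
        if IsEvenSite j then φ (j - i) * altPattern ε Λ j else 0) = 0 := by
    intro j hj
    split_ifs with hev
    · have : (j.1 / 2, j.2 / 2) ∉ Λ := fun h => hj (Finset.mem_image.2 ⟨_, h, by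
        obtain ⟨x, y⟩ := j
        obtain ⟨⟨x', hx⟩, ⟨y', hy⟩⟩ := hev
        simp only at hx hy
        simp only [two_nsmul, Prod.mk_add_mk, Prod.mk.injEq]
        omega⟩)
      rw [altPattern, if_neg this]
      ring
    · ring
  rw [tsum_eq_sum hzero]
  refine Finset.sum_le_sum fun j _ => ?_
  have := hφ.nonneg (j - i)
  split_ifs
  · have := (abs_le.1 (abs_altPattern_le hε Λ j)).1
    nlinarith
  · linarith

/-- The jump of the exponential moments between the plus and minus surroundings of an alternating
pattern. -/
lemma IsAxisInteraction.exp_moment_jump (hφ : IsAxisInteraction φ) {K : ℝ} (hK : IsStrong φ K)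
    (Λ : Finset Site) :
    ∀ᶠ n in atTop, ∀ v₁ v₂ : Site → ℝ,
      (∀ i ∈ oddPart (box n), altField φ 1 Λ i - outerField φ (box n) i ≤ v₁ i) →
      (∀ i ∈ oddPart (box n), altField φ (-1) Λ i - outerField φ (box n) i ≤ v₂ i) →
      gibbsAv (oddPart (box n)) (pairCoupling φ) v₁ plusConfig (expLin n fun x => -(2 * φ x)) +
          φ (1, 0) ≤
        gibbsAv (oddPart (box n)) (pairCoupling φ) v₂ plusConfig (expLin n fun x => 2 * φ x) := by
  obtain ⟨t, ⟨ht0, ht1⟩, ht⟩ := hφ.exists_tendsto_magGap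
  set H := evenField φ with hH
  -- A field that lies below both pattern fields, is nonnegative at the hidden sites (for the
  -- Griffiths and Peierls bounds), and differs summably from `t * H` (for insensitivity to the
  -- boundary).
  set k : Site → ℝ := fun i => min (min (altField φ 1 Λ i) (altField φ (-1) Λ i)) (t * H i)
    with hkdef
  have h1 : |(1 : ℝ)| = 1 := by simp
  have h1' : |(-1 : ℝ)| = 1 := by simp
  have hH0 : ∀ i, 0 ≤ H i := hφ.evenField_nonneg
  have hk0 : ∀ i, ¬ IsEvenSite i → 0 ≤ k i := fun i hi =>
    le_min (le_min (hφ.altField_nonneg h1 Λ hi) (hφ.altField_nonneg h1' Λ hi))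
      (mul_nonneg ht0 (hH0 i))
  have hdiff : ∀ i, |k i - t * H i| ≤ 2 * ∑ p ∈ Λ, φ (2 • p - i) := by
    intro i
    have e1 := hφ.evenField_sub_altField_le h1 Λ i
    have e2 := hφ.evenField_sub_altField_le h1' Λ i
    have hnn : 0 ≤ 2 * ∑ p ∈ Λ, φ (2 • p - i) := by
      have : 0 ≤ ∑ p ∈ Λ, φ (2 • p - i) := Finset.sum_nonneg fun p _ => hφ.nonneg _
      linarith
    have htH : t * H i ≤ H i := mul_le_of_le_one_left (hH0 i) ht1
    rw [abs_sub_comm, abs_of_nonneg (sub_nonneg.2 (min_le_right _ _))]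
    simp only [hkdef]
    rcases min_choice (min (altField φ 1 Λ i) (altField φ (-1) Λ i)) (t * H i) with h | h <;>
      rw [h]
    · rcases min_choice (altField φ 1 Λ i) (altField φ (-1) Λ i) with h' | h' <;> rw [h'] <;>
        linarith
    · linarith
  have hsumk : Summable fun i => |k i - t * H i| := by
    refine Summable.of_nonneg_of_le (fun _ => abs_nonneg _) hdiff (Summable.mul_left _ ?_)
    refine summable_sum fun p _ => ?_
    refine (hφ.summable_sub (2 • p)).congr fun i => ?_
    rw [← hφ.neg, neg_sub]
  have hl : Summable fun x => |2 * φ x| := by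
    refine (hφ.summable.mul_left 2).congr fun x => ?_
    rw [abs_of_nonneg (by have := hφ.nonneg x; linarith)]
  -- The choice of `t` controls only the sites with `H > 0`. A hidden site with `H = 0` is harmless:
  -- both its coordinates are odd, so `φ` vanishes there, and `k` is squeezed between 0 and `t * H =
  -- 0`.
  have hpos : ∀ x, ¬ IsEvenSite x → (2 * φ x ≠ 0 ∨ k x ≠ t * H x) → 0 < H x := by
    intro x hx hne
    rcases hne with hne | hne
    · refine hφ.evenField_pos hx ?_
      by_contra hcon
      push Not at hcon
      rw [Int.not_even_iff_odd, Int.not_even_iff_odd] at hcon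
      exact hne (by rw [show x = (x.1, x.2) from rfl, hφ.odd_odd _ _ hcon.1 hcon.2, mul_zero])
    · refine lt_of_le_of_ne (hH0 x) fun h0 => hne ?_
      have := hk0 x hx
      have h2 : k x ≤ t * H x := min_le_right _ _
      rw [← h0, mul_zero] at h2 ⊢
      exact le_antisymm h2 this
  have lim1 := hφ.tendsto_boxAv_perturbed (u := fun i => t * H i) (k := k)
    (l := fun x => 2 * φ x) hl hsumk fun x hx hne => ht x hx (hpos x hx hne)
  have lim2 := hφ.tendsto_boxAv_perturbed (u := fun i => t * H i) (k := k)
    (l := fun x => -(2 * φ x)) (by simpa only [abs_neg] using hl) hsumk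
    fun x hx hne => ht x hx (hpos x hx (by simpa only [ne_eq, neg_eq_zero] using hne))
  have hp := hφ.pos_fst
  filter_upwards [eventually_ge_atTop 1,
    lim1.eventually (gt_mem_nhds (show (0 : ℝ) < φ (1, 0) / 2 by linarith)),
    lim2.eventually (lt_mem_nhds (show -(φ (1, 0) / 2) < (0 : ℝ) by linarith))]
    with n hn1 hn2 hn3 v₁ v₂ hv₁ hv₂
  -- The plus boundary state has a jump of at least `2 φ (1, 0)`; passing to the minus boundary
  -- field costs at most `φ (1, 0) / 2` in each of the two moments. Monotonicity then replaces `k`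
  -- minus the boundary field by `v₁` and `v₂`.
  have hcore := hφ.le_boxAv_expLin_sub hK hk0 hn1
  have hlin : ∀ l : Site → ℝ, (∀ x, 0 ≤ l x) → Monotone fun τ : oddPart (box n) → Bool =>
      expLin n l (glue (oddPart (box n)) τ plusConfig) := fun l hl τ τ' h =>
    Real.exp_le_exp.2 (Finset.sum_le_sum fun x _ =>
      mul_le_mul_of_nonneg_left (monotone_glue_spin _ _ x h) (hl x))
  have m2 : boxAv φ n k (-1) (expLin n fun x => 2 * φ x) ≤
      gibbsAv (oddPart (box n)) (pairCoupling φ) v₂ plusConfig (expLin n fun x => 2 * φ x) := by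
    refine gibbsAv_mono_field (fun i _ j _ => hφ.nonneg _) (fun i hi => ?_)
      (hlin _ fun x => by have := hφ.nonneg x; linarith)
    have : k i ≤ altField φ (-1) Λ i := (min_le_left _ _).trans (min_le_right _ _)
    have := hv₂ i hi
    linarith
  have m1 : gibbsAv (oddPart (box n)) (pairCoupling φ) v₁ plusConfig
      (expLin n fun x => -(2 * φ x)) ≤ boxAv φ n k (-1) (expLin n fun x => -(2 * φ x)) := by
    have := gibbsAv_mono_field (Λ := oddPart (box n)) (c := pairCoupling φ) (ω := plusConfig)
      (v := fun i => k i + -1 * outerField φ (box n) i) (v' := v₁)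
      (f := fun σ => -expLin n (fun x => -(2 * φ x)) σ) (fun i _ j _ => hφ.nonneg _)
      (fun i hi => by
        have : k i ≤ altField φ 1 Λ i := (min_le_left _ _).trans (min_le_left _ _)
        have := hv₁ i hi
        linarith)
      (fun τ τ' h => neg_le_neg (Real.exp_le_exp.2 (Finset.sum_le_sum fun x _ => by
        have h1 := monotone_glue_spin (oddPart (box n)) plusConfig x h
        have h2 := hφ.nonneg x
        simp only at h1
        nlinarith)))
    have hneg : ∀ v, gibbsAv (oddPart (box n)) (pairCoupling φ) v plusConfig
        (fun σ => -expLin n (fun x => -(2 * φ x)) σ) =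
        -gibbsAv (oddPart (box n)) (pairCoupling φ) v plusConfig
          (expLin n fun x => -(2 * φ x)) := fun v => by
      simpa using gibbsAv_const_mul (Λ := oddPart (box n)) (c := pairCoupling φ) (v := v)
        (ω := plusConfig) (f := expLin n fun x => -(2 * φ x)) (-1)
    rw [hneg, hneg] at this
    exact neg_le_neg_iff.1 this
  linarith

/-! ### The kernels of the Ising model as finite-volume Gibbs states -/

section
variable {φ : Site → ℝ} {Λ Λ' : Finset Site}

/-- The field created at `i` by the spins of `ω` outside `Λ`. -/
noncomputable def kernelField (φ : Site → ℝ) (Λ : Finset Site) (ω : Config) (i : Site) : ℝ :=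
  ∑' j : Site, if j ∈ Λ then 0 else φ (j - i) * spin (ω j)

lemma tsum_ite_mem_zero {f : Site → ℝ} (hf : Summable f) (D : Finset Site) :
    ∑' j, (if j ∈ D then 0 else f j) = ∑' j, f j - ∑ j ∈ D, f j := by
  have h1 : ∀ j, (if j ∈ D then 0 else f j) = f j - if j ∈ D then f j else 0 := fun j => by
    split_ifs <;> simp
  have h2 : Summable fun j => if j ∈ D then f j else 0 :=
    summable_of_ne_finset_zero (s := D) fun j hj => if_neg hj
  simp only [h1]
  rw [hf.tsum_sub h2, tsum_eq_sum (s := D) fun j hj => if_neg hj]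
  congr 1
  exact Finset.sum_congr rfl fun j hj => if_pos hj

lemma summable_ite_mem_zero {f : Site → ℝ} (hf : Summable f) (D : Finset Site) :
    Summable fun j => if j ∈ D then 0 else f j :=
  Summable.of_norm_bounded hf.norm fun j => by split_ifs <;> simp

lemma IsAxisInteraction.summable_spin (hφ : IsAxisInteraction φ) (ω : Config) (i : Site) :
    Summable fun j => φ (j - i) * spin (ω j) :=
  Summable.of_norm_bounded (hφ.summable_sub i) fun j => by
    rw [Real.norm_eq_abs, abs_mul, abs_spin, mul_one, abs_of_nonneg (hφ.nonneg _)]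

lemma kernelField_congr {ω ω' : Config} (h : ∀ j ∉ Λ, ω j = ω' j) (i : Site) :
    kernelField φ Λ ω i = kernelField φ Λ ω' i :=
  tsum_congr fun j => by
    split_ifs with hj
    · rfl
    · rw [h j hj]

lemma kernelField_glue (τ : Λ → Bool) (ω : Config) :
    kernelField φ Λ (glue Λ τ ω) = kernelField φ Λ ω :=
  funext fun i => kernelField_congr (fun _ hj => glue_of_notMem hj _ _) i

lemma IsAxisInteraction.kernelField_eq_innerField (hφ : IsAxisInteraction φ) (h : Λ ⊆ Λ')
    (ω : Config) :
    kernelField φ Λ ω = innerField Λ Λ' (pairCoupling φ) (kernelField φ Λ' ω) ω := by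
  ext i
  have hs := hφ.summable_spin ω i
  rw [innerField, kernelField, kernelField, tsum_ite_mem_zero hs, tsum_ite_mem_zero hs,
    ← Finset.sum_sdiff h]
  simp only [pairCoupling]
  ring

lemma IsAxisInteraction.abs_kernelField_le (hφ : IsAxisInteraction φ) (ω : Config) (i : Site) :
    |kernelField φ Λ ω i| ≤ ∑' d, φ d := by
  rw [← tsum_sub_eq i, ← Real.norm_eq_abs]
  refine tsum_of_norm_bounded (hφ.summable_sub i).hasSum fun j => ?_
  split_ifs
  · simpa using hφ.nonneg _
  · rw [Real.norm_eq_abs, abs_mul, abs_spin, mul_one, abs_of_nonneg (hφ.nonneg _)]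

lemma IsAxisInteraction.outerField_eq (hφ : IsAxisInteraction φ) (D : Finset Site) (i : Site) :
    outerField φ D i = ∑' j, if j ∈ D then 0 else 2 * φ (j - i) := by
  rw [tsum_ite_mem_zero ((hφ.summable_sub i).mul_left 2), tsum_mul_left, tsum_sub_eq,
    ← Finset.mul_sum, outerField]
  ring

/-- The kernel of the specification as a finite-volume state. -/
noncomputable def kernelAv (φ : Site → ℝ) (Λ : Finset Site) (ω : Config) (f : Config → ℝ) : ℝ :=
  gibbsAv Λ (pairCoupling φ) (kernelField φ Λ ω) ω f

/-- Consistency of the kernels. -/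
lemma IsAxisInteraction.kernelAv_tower (hφ : IsAxisInteraction φ) (h : Λ ⊆ Λ') (ω : Config)
    (f : Config → ℝ) :
    kernelAv φ Λ' ω f = kernelAv φ Λ' ω fun σ => kernelAv φ Λ σ f := by
  unfold kernelAv
  rw [gibbsAv_tower hφ.symm h]
  refine gibbsAv_congr (fun _ _ => rfl) fun τ => ?_
  rw [hφ.kernelField_eq_innerField h, kernelField_glue]

/-- Inside the box the fixed spins follow the pattern. Outside it a pattern value and an arbitrary
spin differ by at most 2, which explains the factor 2 in `outerField`. -/
lemma IsAxisInteraction.altField_sub_le_kernelField (hφ : IsAxisInteraction φ) {ε : ℝ}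
    (hε : |ε| = 1) (L : Finset Site) {n : ℕ} {η : Config}
    (hη : ∀ j ∈ box n, IsEvenSite j → spin (η j) = altPattern ε L j) (i : Site) :
    altField φ ε L i - outerField φ (box n) i ≤ kernelField φ (oddPart (box n)) η i := by
  rw [hφ.outerField_eq, altField, ← (hφ.summable_altField hε L i).tsum_sub
    (summable_ite_mem_zero ((hφ.summable_sub i).mul_left 2) _)]
  refine Summable.tsum_le_tsum (fun j => ?_) ((hφ.summable_altField hε L i).sub
    (summable_ite_mem_zero ((hφ.summable_sub i).mul_left 2) _))
    (summable_ite_mem_zero (hφ.summable_spin η i) _)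
  have h0 := hφ.nonneg (j - i)
  have h1 := (abs_le.1 (abs_altPattern_le hε L j)).2
  have h2 := neg_one_le_spin (η j)
  by_cases hj : j ∈ box n
  · by_cases he : IsEvenSite j
    · simp [mem_oddPart, hj, he, hη j hj he]
    · simp [mem_oddPart, hj, he]
  · simp only [mem_oddPart, hj, false_and, if_false]
    split_ifs <;> nlinarith

/-! ### The spin at the origin -/

lemma spinSum_singleton (x : Site) (f : Config → ℝ) (ω : Config) :
    spinSum {x} f ω = f (Function.update ω x true) + f (Function.update ω x false) := by
  unfold spinSum
  have hg : ∀ b : Bool, glue {x} (fun _ => b) ω = Function.update ω x b := fun b => by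
    ext i
    by_cases hi : i = x
    · subst hi; simp [glue]
    · simp [glue, hi]
  rw [← (Equiv.funUnique ({x} : Finset Site) Bool).symm.sum_comp]
  rw [Fintype.sum_bool]
  congr 1
  · exact congrArg f (hg true)
  · exact congrArg f (hg false)

lemma spinSum_base (hf : DependsOn f (Λ : Set Site)) (ω ω' : Config) :
    spinSum Λ f ω = spinSum Λ f ω' :=
  Finset.sum_congr rfl fun τ _ => hf fun i hi => by rw [glue_of_mem hi, glue_of_mem hi]

lemma dependsOn_weight (c : Site → Site → ℝ) (v : Site → ℝ) :
    DependsOn (weight Λ c v) (Λ : Set Site) := fun _ _ h =>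
  congrArg Real.exp (energy_congr (fun _ _ => rfl) h)

/-- Undoing the extra field `l` inside an expectation expresses a ratio of partition functions as an
exponential moment. -/
lemma gibbsAv_exp_sub_field {c : Site → Site → ℝ} {v v' l : Site → ℝ} {ω : Config}
    (h : ∀ i, v' i = v i + l i) :
    gibbsAv Λ c v' ω (fun σ => Real.exp (∑ x ∈ Λ, -l x * spin (σ x))) =
      spinSum Λ (weight Λ c v) ω / spinSum Λ (weight Λ c v') ω := by
  rw [gibbsAv]
  congr 1
  refine spinSum_congr fun τ => ?_
  rw [weight, weight, ← Real.exp_add]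
  congr 1
  simp only [energy, h, add_mul, neg_mul, Finset.sum_add_distrib, Finset.sum_neg_distrib]
  ring

lemma odds_eq {A x Zt Zf : ℝ} (hA : 0 < A) (hZt : 0 < Zt) (hZf : 0 < Zf) :
    A * (1 * (Real.exp x * Zt) + 0 * (Real.exp (-x) * Zf)) /
        (A * (1 * (Real.exp x * Zt) + 1 * (Real.exp (-x) * Zf))) =
      1 / (1 + Real.exp (-2 * x) * (Zf / Zt)) := by
  have he : Real.exp (-2 * x) = Real.exp (-x) / Real.exp x := by
    rw [← Real.exp_sub]; congr 1; ring
  rw [he]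
  have h2 := Real.exp_pos x
  have h3 := Real.exp_pos (-x)
  have h4 : 0 < Real.exp x * Zt + Real.exp (-x) * Zf := by positivity
  rw [zero_mul, add_zero, one_mul, one_mul]
  field_simp

lemma IsAxisInteraction.innerField_update (hφ : IsAxisInteraction φ) (V : Finset Site)
    (ω : Config) (b : Bool) :
    innerField V (insert 0 V) (pairCoupling φ) (kernelField φ (insert 0 V) ω)
      (Function.update ω 0 b) = kernelField φ V (Function.update ω 0 b) := by
  rw [hφ.kernelField_eq_innerField (Finset.subset_insert 0 V)]
  congr 1
  ext i
  refine kernelField_congr (fun j hj => ?_) i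
  rw [Function.update_of_ne]
  rintro rfl
  exact hj (Finset.mem_insert_self _ _)

lemma weight_singleton_update (v : Site → ℝ) (ω : Config) (b : Bool) :
    weight {0} (pairCoupling φ) v (Function.update ω 0 b) =
      Real.exp (1 / 2 * φ 0) * Real.exp (v 0 * spin b) := by
  rw [weight, energy, ← Real.exp_add]
  simp only [Finset.sum_singleton, Function.update_self, pairCoupling, sub_self]
  rw [mul_assoc (φ 0), spin_mul_self, mul_one]

/-- Splitting off the spin at the origin. -/
lemma IsAxisInteraction.spinSum_insert_origin (hφ : IsAxisInteraction φ) {V : Finset Site}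
    (h0 : (0 : Site) ∉ V) (ω : Config) (F : Config → ℝ) (a : Bool → ℝ)
    (hF : ∀ b (τ : V → Bool), F (glue V τ (Function.update ω 0 b)) = a b) :
    spinSum (insert 0 V) (fun σ => F σ * weight (insert 0 V) (pairCoupling φ)
        (kernelField φ (insert 0 V) ω) σ) ω = Real.exp (1 / 2 * φ 0) *
      (a true * (Real.exp (kernelField φ (insert 0 V) ω 0) * spinSum V (weight V (pairCoupling φ)
          (kernelField φ V (Function.update ω 0 true))) plusConfig) +
        a false * (Real.exp (-kernelField φ (insert 0 V) ω 0) * spinSum V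
          (weight V (pairCoupling φ) (kernelField φ V (Function.update ω 0 false)))
          plusConfig)) := by
  have hdiff : insert 0 V \ V = {0} := by
    rw [Finset.insert_sdiff_of_notMem _ h0, Finset.sdiff_self]
    rfl
  have hsub := Finset.subset_insert 0 V
  have hb : ∀ b, spinSum V (fun σ => F σ * weight (insert 0 V) (pairCoupling φ)
        (kernelField φ (insert 0 V) ω) σ) (Function.update ω 0 b) =
      a b * (Real.exp (1 / 2 * φ 0) * Real.exp (kernelField φ (insert 0 V) ω 0 * spin b) *
        spinSum V (weight V (pairCoupling φ) (kernelField φ V (Function.update ω 0 b)))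
          plusConfig) := fun b => by
    rw [spinSum_base (dependsOn_weight _ _) plusConfig (Function.update ω 0 b),
      ← spinSum_const_mul, ← spinSum_const_mul]
    refine spinSum_congr fun τ => ?_
    rw [hF, weight_glue_of_subset hφ.symm hsub, hdiff, hφ.innerField_update,
      weight_singleton_update]
  rw [spinSum_sdiff hsub, hdiff, spinSum_singleton, hb, hb, spin_true, spin_false, mul_one,
    mul_neg_one]
  ring

/-- The probability of a plus spin at the origin, given all spins outside `V` but the one at the
origin. -/
lemma IsAxisInteraction.kernelAv_origin (hφ : IsAxisInteraction φ) {V : Finset Site}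
    (h0 : (0 : Site) ∉ V) (ω : Config) :
    kernelAv φ (insert 0 V) ω (Set.indicator {σ : Config | σ 0 = true} fun _ => 1) =
      1 / (1 + Real.exp (-2 * kernelField φ (insert 0 V) ω 0) *
        gibbsAv V (pairCoupling φ) (kernelField φ V (Function.update ω 0 true)) plusConfig
          (fun σ => Real.exp (∑ x ∈ V, -(2 * φ x) * spin (σ x)))) := by
  have hnum := hφ.spinSum_insert_origin h0 ω (Set.indicator {σ : Config | σ 0 = true} fun _ => 1)
    (fun b => if b then 1 else 0) (fun b τ => by
      have : glue V τ (Function.update ω 0 b) 0 = b := by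
        rw [glue_of_notMem h0, Function.update_self]
      cases b <;> simp [Set.indicator, this])
  have hden := hφ.spinSum_insert_origin h0 ω (fun _ => 1) (fun _ => 1) (fun _ _ => rfl)
  have hden' : ∀ W : Config → ℝ, spinSum (insert 0 V) (fun σ => 1 * W σ) ω =
      spinSum (insert 0 V) W ω := fun W => spinSum_congr fun _ => one_mul _
  have hdiff : insert 0 V \ V = {0} := by
    rw [Finset.insert_sdiff_of_notMem _ h0, Finset.sdiff_self]
    rfl
  rw [hden'] at hden
  -- Changing the origin from minus to plus adds `2 φ x` to the field at each hidden site, so the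
  -- ratio of the two partition functions is the moment of `exp (-∑ 2 φ x σ_x)` in the plus one.
  rw [gibbsAv_exp_sub_field (l := fun x => 2 * φ x)
    (v := kernelField φ V (Function.update ω 0 false)) fun i => by
      rw [← hφ.innerField_update, ← hφ.innerField_update]
      simp only [innerField, hdiff, Finset.sum_singleton, Function.update_self, spin_true,
        spin_false, pairCoupling, zero_sub, hφ.neg]
      ring]
  rw [kernelAv, gibbsAv, hnum, hden, ← odds_eq (Real.exp_pos (1 / 2 * φ 0)) partition_pos
    partition_pos]
  simp only [if_true, Bool.false_eq_true, if_false]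

/-- Flipping all spins. -/
def flipAll (ω : Config) : Config := fun i => !ω i

lemma spin_not (b : Bool) : spin (!b) = -spin b := by cases b <;> simp

lemma gibbsAv_flip (c : Site → Site → ℝ) (v : Site → ℝ) (f : Config → ℝ)
    (hf : DependsOn f (Λ : Set Site)) :
    gibbsAv Λ c v plusConfig f = gibbsAv Λ c (fun i => -v i) plusConfig fun σ => f (flipAll σ) := by
  have hsum : ∀ F : Config → ℝ, DependsOn F (Λ : Set Site) → spinSum Λ F plusConfig =
      spinSum Λ (fun σ => F (flipAll σ)) plusConfig := fun F hF => by
    unfold spinSum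
    rw [← Equiv.sum_comp (Function.Involutive.toPerm (fun (τ : Λ → Bool) i => !τ i)
      fun τ => by ext i; simp)]
    refine Finset.sum_congr rfl fun τ _ => hF fun i hi => ?_
    rw [glue_of_mem hi, flipAll, glue_of_mem hi]
    rfl
  have hw : ∀ σ, weight Λ c v (flipAll σ) = weight Λ c (fun i => -v i) σ := fun σ => by
    rw [weight, weight]
    congr 1
    simp only [energy, flipAll, spin_not]
    congr 2
    · refine Finset.sum_congr rfl fun i _ => Finset.sum_congr rfl fun j _ => by ring
    · ext i; ring
  unfold gibbsAv
  rw [hsum _ (dependsOn_weight c v), hsum (fun σ => f σ * weight Λ c v σ) fun σ σ' h => by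
    simp only [hf h, dependsOn_weight c v h]]
  simp only [hw]

lemma kernelField_flipAll (ω : Config) (i : Site) :
    kernelField φ Λ (flipAll ω) i = -kernelField φ Λ ω i := by
  rw [kernelField, kernelField, ← tsum_neg]
  refine tsum_congr fun j => ?_
  split_ifs
  · simp
  · rw [flipAll, spin_not]; ring

/-- The even spins of `ω` in the box are alternating on `L` (except at the origin) and equal to `b`
off `L`. -/
def IsAltSurrounded (L : Finset Site) (b : Bool) (n : ℕ) (ω : Config) : Prop :=
  ∀ p : Site, p ≠ 0 → 2 • p ∈ box n → ω (2 • p) = if p ∈ L then altConfig p else b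

lemma half_two_nsmul (p : Site) : ((2 • p).1 / 2, (2 • p).2 / 2) = p := by
  ext
  · simp only [two_nsmul, Prod.fst_add]; omega
  · simp only [two_nsmul, Prod.snd_add]; omega

lemma IsEvenSite.exists_half {j : Site} (hj : IsEvenSite j) : ∃ p : Site, j = 2 • p := by
  obtain ⟨⟨a, ha⟩, ⟨b, hb⟩⟩ := hj
  exact ⟨(a, b), by rw [two_nsmul]; exact Prod.ext ha hb⟩

lemma IsAltSurrounded.spin_eq_altPattern {L : Finset Site} (h0 : 0 ∈ L) {n : ℕ} {ω : Config}
    (h : IsAltSurrounded L true n ω) (j : Site) (hj : j ∈ box n) (he : IsEvenSite j) :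
    spin (Function.update ω 0 true j) = altPattern 1 L j := by
  obtain ⟨p, rfl⟩ := he.exists_half
  rw [altPattern, half_two_nsmul]
  by_cases hp : p = 0
  · subst hp
    simp [h0, altConfig]
  · have hp2 : (2 • p : Site) ≠ 0 := by
      intro h'
      apply hp
      have := half_two_nsmul p
      rw [h'] at this
      rw [← this]; rfl
    rw [Function.update_of_ne hp2, h p hp hj]
    split_ifs <;> simp

/-- The global flip makes minus surroundings plus and reverses the alternating part; the origin, set
to plus, becomes minus, in agreement with `ε = -1`. -/
lemma IsAltSurrounded.spin_flip_eq_altPattern {L : Finset Site} (h0 : 0 ∈ L) {n : ℕ} {ω : Config}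
    (h : IsAltSurrounded L false n ω) (j : Site) (hj : j ∈ box n) (he : IsEvenSite j) :
    spin (flipAll (Function.update ω 0 true) j) = altPattern (-1) L j := by
  rw [flipAll, spin_not]
  obtain ⟨p, rfl⟩ := he.exists_half
  rw [altPattern, half_two_nsmul]
  by_cases hp : p = 0
  · subst hp
    simp [h0, altConfig]
  · have hp2 : (2 • p : Site) ≠ 0 := by
      intro h'
      apply hp
      have := half_two_nsmul p
      rw [h'] at this
      rw [← this]; rfl
    rw [Function.update_of_ne hp2, h p hp hj]
    split_ifs <;> simp

/-- The difference of the fields at the origin. -/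
lemma IsAxisInteraction.kernelField_origin_sub (hφ : IsAxisInteraction φ) {L : Finset Site}
    {n : ℕ} {ω₁ ω₂ : Config} (h₁ : IsAltSurrounded L true n ω₁)
    (h₂ : IsAltSurrounded L false n ω₂) :
    kernelField φ (insert 0 (oddPart (box n))) ω₂ 0 - outerField φ (box n) 0 ≤
      kernelField φ (insert 0 (oddPart (box n))) ω₁ 0 := by
  rw [hφ.outerField_eq, kernelField, kernelField]
  have s1 := summable_ite_mem_zero (hφ.summable_spin ω₁ 0) (insert 0 (oddPart (box n)))
  have s2 := summable_ite_mem_zero (hφ.summable_spin ω₂ 0) (insert 0 (oddPart (box n)))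
  have s3 := summable_ite_mem_zero ((hφ.summable_sub 0).mul_left 2) (box n)
  rw [← s2.tsum_sub s3]
  refine Summable.tsum_le_tsum (fun j => ?_) (s2.sub s3) s1
  have h0 := hφ.nonneg (j - 0)
  by_cases hj : j ∈ insert 0 (oddPart (box n))
  · simp only [hj, if_true]
    split_ifs <;> linarith
  · simp only [hj, if_false]
    by_cases hjb : j ∈ box n
    · have he : IsEvenSite j := by
        by_contra he
        exact hj (Finset.mem_insert_of_mem (mem_oddPart.2 ⟨hjb, he⟩))
      obtain ⟨p, rfl⟩ := he.exists_half
      have hp : p ≠ 0 := fun hp => hj (by rw [hp]; simp)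
      rw [h₁ p hp hjb, h₂ p hp hjb]
      simp only [hjb, if_true, sub_zero]
      refine mul_le_mul_of_nonneg_left ?_ (by simpa using h0)
      split_ifs <;> norm_num
    · simp only [hjb, if_false]
      have := neg_one_le_spin (ω₁ j)
      have := spin_le_one (ω₂ j)
      nlinarith

/-! ### From a jump of exponential moments to a jump of probabilities -/

lemma one_div_sub_one_div_ge {x₁ x₂ X d : ℝ} (h1 : 0 ≤ x₁) (h2 : 0 ≤ x₂) (h1X : x₁ ≤ X)
    (h2X : x₂ ≤ X) (hd0 : 0 ≤ d) (hd : x₁ + d ≤ x₂) :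
    d / (1 + X) ^ 2 ≤ 1 / (1 + x₁) - 1 / (1 + x₂) := by
  rw [div_sub_div _ _ (by linarith) (by linarith)]
  have : d / (1 + X) ^ 2 ≤ (x₂ - x₁) / ((1 + x₁) * (1 + x₂)) := by
    refine div_le_div₀ (by linarith) (by linarith) (by nlinarith) ?_
    rw [sq]
    exact mul_le_mul (by linarith) (by linarith) (by linarith) (by linarith)
  refine this.trans (le_of_eq ?_)
  congr 1
  ring

/-- The odds are `exp (-2 f) * A`. The two fields at the origin can be in the wrong order by at most
`κ`, which by `hn` costs no more than half of the gap `a`. The odds thus differ by at least `exp (-2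
T) * (a / 2)`, and `x ↦ 1 / (1 + x)` has slope of size at least `(1 + exp (4 T))⁻²` on their range.
-/
lemma odds_jump {A₁ A₂ f₁ f₂ κ T a : ℝ} (ha : 0 < a) (hκ : 0 ≤ κ) (hf : f₂ - κ ≤ f₁)
    (hf₁ : |f₁| ≤ T) (hf₂ : |f₂| ≤ T) (hA : A₁ + a ≤ A₂) (hA₁0 : 0 ≤ A₁)
    (hA₁le : A₁ ≤ Real.exp (2 * T)) (hA₂le : A₂ ≤ Real.exp (2 * T))
    (hn : (Real.exp (2 * κ) - 1) * Real.exp (2 * T) < a / 2) :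
    1 / (1 + Real.exp (-2 * f₂) * A₂) +
        Real.exp (-2 * T) * (a / 2) / (1 + Real.exp (4 * T)) ^ 2 ≤
      1 / (1 + Real.exp (-2 * f₁) * A₁) := by
  rw [add_comm, ← le_sub_iff_add_le]
  have hA₂0 : 0 ≤ A₂ := by linarith
  have hexp : ∀ f : ℝ, |f| ≤ T → Real.exp (-2 * f) ≤ Real.exp (2 * T) := fun f hf =>
    Real.exp_le_exp.2 (by have := (abs_le.1 hf).1; linarith)
  have h4 : Real.exp (4 * T) = Real.exp (2 * T) * Real.exp (2 * T) := by
    rw [← Real.exp_add]; congr 1; ring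
  refine one_div_sub_one_div_ge (by positivity) (by positivity) ?_ ?_ (by positivity) ?_
  · rw [h4]; exact mul_le_mul (hexp f₁ hf₁) hA₁le hA₁0 (Real.exp_pos _).le
  · rw [h4]; exact mul_le_mul (hexp f₂ hf₂) hA₂le hA₂0 (Real.exp_pos _).le
  · have e1 : Real.exp (-2 * f₁) ≤ Real.exp (2 * κ) * Real.exp (-2 * f₂) := by
      rw [← Real.exp_add, Real.exp_le_exp]; linarith
    have e2 : Real.exp (-2 * T) ≤ Real.exp (-2 * f₂) :=
      Real.exp_le_exp.2 (by have := (abs_le.1 hf₂).2; linarith)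
    have e3 : (Real.exp (2 * κ) - 1) * A₁ ≤ a / 2 := by
      refine (mul_le_mul_of_nonneg_left hA₁le ?_).trans hn.le
      have := Real.one_le_exp (show 0 ≤ 2 * κ by linarith)
      linarith
    have e4 : Real.exp (2 * κ) * A₁ + a / 2 ≤ A₂ := by linarith
    have e5 : 0 < Real.exp (-2 * f₂) := Real.exp_pos _
    calc Real.exp (-2 * f₁) * A₁ + Real.exp (-2 * T) * (a / 2)
        ≤ Real.exp (2 * κ) * Real.exp (-2 * f₂) * A₁ + Real.exp (-2 * f₂) * (a / 2) := by
          gcongr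
      _ = Real.exp (-2 * f₂) * (Real.exp (2 * κ) * A₁ + a / 2) := by ring
      _ ≤ Real.exp (-2 * f₂) * A₂ := by gcongr

/-- The jump of the conditional probability of a plus spin at the origin. -/
lemma IsAxisInteraction.exists_jump (hφ : IsAxisInteraction φ) {K : ℝ} (hK : IsStrong φ K) :
    ∃ δ > 0, ∀ L : Finset Site, 0 ∈ L → ∃ n, L ⊆ box n ∧ ∀ ω₁ ω₂ : Config,
      IsAltSurrounded L true n ω₁ → IsAltSurrounded L false n ω₂ →
      kernelAv φ (insert 0 (oddPart (box n))) ω₂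
          (Set.indicator {σ : Config | σ 0 = true} fun _ => 1) + δ ≤
        kernelAv φ (insert 0 (oddPart (box n))) ω₁
          (Set.indicator {σ : Config | σ 0 = true} fun _ => 1) := by
  set T := ∑' d, φ d with hT
  set a := φ (1, 0) with ha
  have ha0 : 0 < a := hφ.pos_fst
  -- The constant depends only on the interaction, not on `L`; this uniformity is what makes the
  -- discontinuity essential.
  refine ⟨Real.exp (-2 * T) * (a / 2) / (1 + Real.exp (4 * T)) ^ 2, by positivity, fun L hL => ?_⟩
  have hout : Tendsto (fun n => outerField φ (box n) 0) atTop (𝓝 0) := by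
    have hbox : Tendsto box atTop atTop := tendsto_atTop_atTop.2 fun F => by
      obtain ⟨n, hn⟩ := exists_subset_box F
      exact ⟨n, fun m hm => hn.trans (box_mono hm)⟩
    have h1 : Tendsto (fun n => ∑ j ∈ box n, φ j) atTop (𝓝 T) :=
      hφ.summable.hasSum.comp hbox
    have h2 := (h1.const_sub T).const_mul 2
    simpa [outerField] using h2
  have hsmall : Tendsto (fun n => (Real.exp (2 * outerField φ (box n) 0) - 1) *
      Real.exp (2 * T)) atTop (𝓝 0) := by
    have h1 : Tendsto (fun n => Real.exp (2 * outerField φ (box n) 0)) atTop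
        (𝓝 (Real.exp (2 * 0))) := (Real.continuous_exp.tendsto _).comp (hout.const_mul 2)
    have h2 := (h1.sub_const 1).mul_const (Real.exp (2 * T))
    simpa using h2
  obtain ⟨N, hN⟩ := exists_subset_box L
  obtain ⟨n, hjump, hn, hLn⟩ := ((hφ.exp_moment_jump hK L).and
    ((hsmall.eventually (gt_mem_nhds (show (0 : ℝ) < a / 2 by linarith))).and
      (eventually_ge_atTop N))).exists
  refine ⟨n, hN.trans (box_mono hLn), fun ω₁ ω₂ h₁ h₂ => ?_⟩
  -- A global flip brings the minus-surrounded state to one with plus surroundings and the negated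
  -- alternating pattern, and inverts the exponential.
  have hflip : gibbsAv (oddPart (box n)) (pairCoupling φ)
      (kernelField φ (oddPart (box n)) (Function.update ω₂ 0 true)) plusConfig
      (expLin n fun x => -(2 * φ x)) = gibbsAv (oddPart (box n)) (pairCoupling φ)
      (kernelField φ (oddPart (box n)) (flipAll (Function.update ω₂ 0 true))) plusConfig
      (expLin n fun x => 2 * φ x) := by
    rw [gibbsAv_flip _ _ _ fun σ σ' h => by
      simp only [expLin]
      congr 1
      exact Finset.sum_congr rfl fun x hx => by rw [h x hx]]
    refine gibbsAv_congr (fun i _ => (kernelField_flipAll _ i).symm) fun τ => ?_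
    simp only [expLin, flipAll, spin_not, neg_mul, mul_neg, neg_neg]
  have hA : gibbsAv (oddPart (box n)) (pairCoupling φ)
      (kernelField φ (oddPart (box n)) (Function.update ω₁ 0 true)) plusConfig
      (expLin n fun x => -(2 * φ x)) + a ≤ gibbsAv (oddPart (box n)) (pairCoupling φ)
      (kernelField φ (oddPart (box n)) (Function.update ω₂ 0 true)) plusConfig
      (expLin n fun x => -(2 * φ x)) := by
    rw [hflip]
    exact hjump _ _
      (fun i _ => hφ.altField_sub_le_kernelField (by simp) L (h₁.spin_eq_altPattern hL) i)
      (fun i _ => hφ.altField_sub_le_kernelField (by simp) L (h₂.spin_flip_eq_altPattern hL) i)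
  have hl : Summable fun x => |-(2 * φ x)| := by
    refine (hφ.summable.mul_left 2).congr fun x => ?_
    rw [abs_neg, abs_of_nonneg (by have := hφ.nonneg x; linarith)]
  have hlT : ∑' x, |-(2 * φ x)| = 2 * T := by
    rw [hT, ← tsum_mul_left]
    refine tsum_congr fun x => ?_
    rw [abs_neg, abs_of_nonneg (by have := hφ.nonneg x; linarith)]
  have hAle : ∀ v, gibbsAv (oddPart (box n)) (pairCoupling φ) v plusConfig (expLin n fun x => -(2 * φ x)) ≤
      Real.exp (2 * T) := fun v => gibbsAv_le_const fun τ => by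
    rw [← hlT]; exact expLin_le hl n _
  have hA0 : ∀ v, 0 ≤ gibbsAv (oddPart (box n)) (pairCoupling φ) v plusConfig (expLin n fun x => -(2 * φ x)) :=
    fun v => gibbsAv_nonneg fun τ => (Real.exp_pos _).le
  have hV : (0 : Site) ∉ oddPart (box n) := fun h => (mem_oddPart.1 h).2 (by simp [IsEvenSite])
  rw [hφ.kernelAv_origin hV, hφ.kernelAv_origin hV]
  exact odds_jump ha0 (hφ.outerField_nonneg _ _) (hφ.kernelField_origin_sub h₁ h₂)
    (hφ.abs_kernelField_le ω₁ 0) (hφ.abs_kernelField_le ω₂ 0) hA (hA0 _) (hAle _) (hAle _) hn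

end

/-! ### The interaction of the model -/

section
variable {J α β : ℝ}

/-- The interaction of the model at inverse temperature `β` as a function of the displacement. -/
noncomputable def isingInteraction (J α β : ℝ) (d : Site) : ℝ := β * coupling J α 0 d

lemma mul_coupling_eq (J α β : ℝ) (i j : Site) :
    β * coupling J α i j = pairCoupling (isingInteraction J α β) i j := by
  have h1 : (i.1 = j.1 ∧ |i.2 - j.2| = 1) ↔
      ((0 : ℤ) = j.1 - i.1 ∧ |0 - (j.2 - i.2)| = 1) := by
    rw [zero_sub, neg_sub]
    exact and_congr_left fun _ => by omega
  have h2 : (i.2 = j.2 ∧ i.1 ≠ j.1) ↔ ((0 : ℤ) = j.2 - i.2 ∧ (0 : ℤ) ≠ j.1 - i.1) := by omega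
  simp only [pairCoupling, isingInteraction, coupling, Prod.fst_sub, Prod.snd_sub, Prod.fst_zero,
    Prod.snd_zero, h1, h2]
  push_cast
  rw [show (0 : ℝ) - ((j.1 : ℝ) - i.1) = i.1 - j.1 by ring]

lemma summable_coupling (hα : 1 < α) : Summable (coupling J α 0) := by
  refine Summable.add ?_ ?_
  · refine summable_of_ne_finset_zero (s := {(0, 1), (0, -1)}) fun d hd => if_neg fun h => hd ?_
    obtain ⟨a, b⟩ := d
    simp only [Prod.fst_zero, Prod.snd_zero, zero_sub, abs_neg] at h
    obtain ⟨rfl, h⟩ := h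
    rcases (abs_eq one_pos.le).1 h with rfl | rfl <;> simp
  · have hinj : Function.Injective fun n : ℤ => ((n, 0) : Site) := fun a b h => by
      simpa using h
    rw [← hinj.summable_iff (fun d hd => if_neg fun h => hd ⟨d.1, by
      ext
      · rfl
      · exact h.1⟩)]
    refine Summable.of_norm_bounded ((Real.summable_abs_int_rpow hα).mul_left |J|) fun n => ?_
    simp only [Function.comp, Prod.fst_zero, Prod.snd_zero, true_and, Int.cast_zero, zero_sub,
      abs_neg]
    split_ifs
    · rw [norm_mul, Real.norm_eq_abs, Real.norm_eq_abs,
        abs_of_nonneg (Real.rpow_nonneg (abs_nonneg _) _)]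
    · rw [norm_zero]; positivity

lemma isAxisInteraction_isingInteraction (hJ : 0 < J) (hα : 1 < α) (hβ : 0 < β) :
    IsAxisInteraction (isingInteraction J α β) where
  nonneg d := by
    unfold isingInteraction coupling
    positivity
  reflect_fst a b := by
    simp [isingInteraction, coupling, eq_comm (a := (0 : ℤ))]
  reflect_snd a b := by
    simp [isingInteraction, coupling, eq_comm (a := (0 : ℤ))]
  summable := (summable_coupling hα).mul_left β
  odd_odd a b ha hb := by
    have ha' : (0 : ℤ) ≠ a := by rintro rfl; simp at ha
    have hb' : (0 : ℤ) ≠ b := by rintro rfl; simp at hb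
    simp [isingInteraction, coupling, ha', hb']
  pos_fst := by
    simp [isingInteraction, coupling]; positivity
  pos_snd := by
    simp [isingInteraction, coupling]; positivity

/-- The inverse temperature above which the Peierls estimate applies. -/
noncomputable def betaBound (J α : ℝ) : ℝ := Real.log 3240 / (J * 2 ^ (-α))

lemma betaBound_pos (hJ : 0 < J) : 0 < betaBound J α :=
  div_pos (Real.log_pos (by norm_num)) (by positivity)

/-- The weaker of the two couplings on the odd columns is the horizontal one at distance 2, `β J
2^(-α)`. -/
lemma isStrong_isingInteraction (hJ : 0 < J) (hα : 1 < α) (hβ : betaBound J α < β) :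
    IsStrong (isingInteraction J α β) (β * (J * 2 ^ (-α))) where
  nonneg := by
    have := (betaBound_pos (α := α) hJ).trans hβ
    positivity
  large := by
    have hlog : Real.log 3240 ≤ β * (J * 2 ^ (-α)) := ((div_lt_iff₀ (by positivity)).1 hβ).le
    rw [Real.exp_neg, ← div_eq_mul_inv, div_le_one (Real.exp_pos _)]
    exact (Real.log_le_iff_le_exp (by norm_num)).1 hlog
  le_fst := by simp [isingInteraction, coupling]
  le_snd := by
    have hβ0 := (betaBound_pos (α := α) hJ).trans hβ
    have h : (2 : ℝ) ^ (-α) ≤ 1 := Real.rpow_le_one_of_one_le_of_nonpos (by norm_num) (by linarith)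
    simp only [isingInteraction, coupling]
    simp
    nlinarith [mul_pos hβ0 hJ]

/-! ### Integrals with respect to the kernels -/

lemma neg_mul_hamiltonian (J α β : ℝ) (Λ : Finset Site) (σ : Config) :
    -β * hamiltonian J α Λ σ = energy Λ (pairCoupling (isingInteraction J α β))
      (kernelField (isingInteraction J α β) Λ σ) σ := by
  have hk : ∀ i, kernelField (isingInteraction J α β) Λ σ i * spin (σ i) =
      β * ∑' j : {j : Site // j ∉ Λ}, coupling J α i j * spin (σ i) * spin (σ j) := fun i => by
    rw [kernelField, ← tsum_mul_right, ← tsum_mul_left]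
    have := tsum_subtype {j : Site | j ∉ Λ}
      fun j => β * (coupling J α i j * spin (σ i) * spin (σ j))
    refine Eq.trans ?_ this.symm
    refine tsum_congr fun j => ?_
    by_cases hj : j ∈ Λ
    · simp [hj]
    · have h : isingInteraction J α β (j - i) = β * coupling J α i j := (mul_coupling_eq ..).symm
      simp only [hj, if_false, Set.indicator, Set.mem_ofPred_eq, not_false_eq_true, if_true, h]
      ring
  rw [hamiltonian, energy]
  simp only [hk, ← mul_coupling_eq, mul_assoc β, ← Finset.mul_sum]
  ring

lemma exp_neg_mul_hamiltonian (J α β : ℝ) (Λ : Finset Site) (τ : Λ → Bool) (ω : Config) :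
    Real.exp (-β * hamiltonian J α Λ (glue Λ τ ω)) =
      weight Λ (pairCoupling (isingInteraction J α β))
        (kernelField (isingInteraction J α β) Λ ω) (glue Λ τ ω) := by
  rw [neg_mul_hamiltonian, kernelField_glue, weight]

lemma partitionFn_eq (J α β : ℝ) (Λ : Finset Site) (ω : Config) :
    partitionFn J α β Λ ω = spinSum Λ (weight Λ (pairCoupling (isingInteraction J α β))
        (kernelField (isingInteraction J α β) Λ ω)) ω := by
  simp only [partitionFn, exp_neg_mul_hamiltonian, spinSum]

lemma partitionFn_pos (J α β : ℝ) (Λ : Finset Site) (ω : Config) : 0 < partitionFn J α β Λ ω := by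
  rw [partitionFn_eq]; exact partition_pos

lemma isProbabilityMeasure_isingKernel (J α β : ℝ) (Λ : Finset Site) (ω : Config) :
    IsProbabilityMeasure (isingKernel J α β Λ ω) := by
  constructor
  simp only [isingKernel, Measure.coe_finsetSum, Finset.sum_apply, Measure.smul_apply,
    measure_univ, smul_eq_mul, mul_one]
  rw [← ENNReal.ofReal_sum_of_nonneg fun τ _ =>
    div_nonneg (Real.exp_pos _).le (partitionFn_pos ..).le, ← Finset.sum_div]
  change ENNReal.ofReal (partitionFn J α β Λ ω / _) = 1
  rw [div_self (partitionFn_pos ..).ne', ENNReal.ofReal_one]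

lemma integral_isingKernel (J α β : ℝ) (Λ : Finset Site) (ω : Config) (f : Config → ℝ) :
    ∫ σ, f σ ∂(isingKernel J α β Λ ω) = kernelAv (isingInteraction J α β) Λ ω f := by
  rw [isingKernel, integral_finsetSum_measure fun τ _ =>
    (integrable_dirac (by simp)).smul_measure ENNReal.ofReal_ne_top]
  simp only [integral_smul_measure, integral_dirac, smul_eq_mul, kernelAv, gibbsAv, spinSum,
    Finset.sum_div]
  refine Finset.sum_congr rfl fun τ _ => ?_
  rw [ENNReal.toReal_ofReal (div_nonneg (Real.exp_pos _).le (partitionFn_pos ..).le),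
    exp_neg_mul_hamiltonian, partitionFn_eq, spinSum]
  ring

lemma isingKernel_real (J α β : ℝ) (Λ : Finset Site) (ω : Config) {A : Set Config}
    (hA : MeasurableSet A) : (isingKernel J α β Λ ω).real A =
      kernelAv (isingInteraction J α β) Λ ω (A.indicator fun _ => 1) := by
  rw [← integral_isingKernel, integral_indicator hA, setIntegral_const, smul_eq_mul, mul_one]

end

/-! ### Consequences of the DLR equations -/

lemma integrable_indicator_one {μ : Measure Config} [IsFiniteMeasure μ] {A : Set Config}
    (hA : MeasurableSet A) : Integrable (A.indicator fun _ => (1 : ℝ)) μ :=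
  (integrable_const 1).indicator hA

section
variable {γ : KernelFamily} {μ : Measure Config} {Λ : Finset Site} {A B : Set Config}

lemma integrable_kernel_of_mem_DLR (hμ : μ ∈ DLR γ) (hA : MeasurableSet A) :
    Integrable (fun ω => (γ Λ ω).real A) μ :=
  integrable_condExp.congr (hμ.2 Λ A hA)

lemma setIntegral_kernel_of_mem_DLR (hμ : μ ∈ DLR γ) (hA : MeasurableSet A)
    (hB : MeasurableSet[sigmaOn (Λ : Set Site)ᶜ] B) :
    ∫ ω in B, (γ Λ ω).real A ∂μ = μ.real (A ∩ B) := by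
  have := hμ.1
  rw [← setIntegral_congr_ae₀ (cylinderEvents_le_pi B hB).nullMeasurableSet
    ((hμ.2 Λ A hA).mono fun ω h _ => h), setIntegral_condExp cylinderEvents_le_pi
    (integrable_indicator_one hA) hB, integral_indicator hA, setIntegral_const, smul_eq_mul,
    mul_one, measureReal_restrict_apply hA]

end

/-! ### Lower and upper bounds for conditional expectations -/

/-- Apply the hypothesis to the part of `N` where the conditional expectation is below `c`; it must
be null. In this form only integrals over events of the conditioning σ-algebra are needed, with no
formula for the conditional expectation. -/
lemma ae_le_condExp {X : Type*} {m m₀ : MeasurableSpace X} {μ : Measure X} [IsFiniteMeasure μ]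
    (hm : m ≤ m₀) {f : X → ℝ} (hf : Integrable f μ) {N : Set X} (hN : MeasurableSet[m] N) {c : ℝ}
    (h : ∀ B, MeasurableSet[m] B → B ⊆ N → c * μ.real B ≤ ∫ x in B, f x ∂μ) :
    ∀ᵐ x ∂(μ.restrict N), c ≤ (μ[f | m]) x := by
  set B := N ∩ (μ[f | m]) ⁻¹' Set.Iio c
  have hB : MeasurableSet[m] B := hN.inter
    (stronglyMeasurable_condExp.measurable measurableSet_Iio)
  have hintg : IntegrableOn (fun x => c - (μ[f | m]) x) B μ :=
    (integrable_const c).integrableOn.sub integrable_condExp.integrableOn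
  have hnn : 0 ≤ᵐ[μ.restrict B] fun x => c - (μ[f | m]) x :=
    (ae_restrict_mem (hm _ hB)).mono fun x hx => sub_nonneg.2 (le_of_lt hx.2)
  have hle : ∫ x in B, (c - (μ[f | m]) x) ∂μ ≤ 0 := by
    rw [integral_sub (integrable_const c) integrable_condExp.integrableOn,
      setIntegral_condExp hm hf hB, setIntegral_const, smul_eq_mul, mul_comm]
    linarith [h B hB Set.inter_subset_left]
  have hzero := (setIntegral_eq_zero_iff_of_nonneg_ae hnn hintg).1
    (le_antisymm hle (setIntegral_nonneg_of_ae_restrict hnn))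
  have hBzero : μ B = 0 := by
    rw [← Measure.restrict_eq_zero, ← ae_eq_bot]
    refine Filter.eventually_false_iff_eq_bot.1 ?_
    filter_upwards [hzero, ae_restrict_mem (hm _ hB)] with x h0 hx
    have h1 : c - (μ[f | m]) x = 0 := h0
    have h2 : (μ[f | m]) x < c := hx.2
    linarith
  rw [ae_restrict_iff' (hm _ hN)]
  filter_upwards [measure_eq_zero_iff_ae_notMem.1 hBzero] with x hx hxN
  by_contra hlt
  exact hx ⟨hxN, not_le.1 hlt⟩

lemma ae_condExp_le {X : Type*} {m m₀ : MeasurableSpace X} {μ : Measure X} [IsFiniteMeasure μ]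
    (hm : m ≤ m₀) {f : X → ℝ} (hf : Integrable f μ) {N : Set X} (hN : MeasurableSet[m] N) {c : ℝ}
    (h : ∀ B, MeasurableSet[m] B → B ⊆ N → ∫ x in B, f x ∂μ ≤ c * μ.real B) :
    ∀ᵐ x ∂(μ.restrict N), (μ[f | m]) x ≤ c := by
  have h1 := ae_le_condExp hm hf.neg hN (c := -c) fun B hB hBN => by
    simp only [Pi.neg_apply, integral_neg]
    linarith [h B hB hBN]
  filter_upwards [h1, ae_restrict_of_ae (condExp_neg f m)] with x hx hx'
  rw [hx'] at hx
  simpa using hx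

/-! ### Local functions and essential discontinuities -/

lemma measurableSet_nbhd (Λ : Finset Site) (ω : Config) : MeasurableSet (nbhd Λ ω) := by
  have : nbhd Λ ω = ⋂ i ∈ Λ, (fun σ : Config => σ i) ⁻¹' {ω i} := by
    ext σ; simp [nbhd]
  rw [this]
  exact Finset.measurableSet_biInter _ fun i _ =>
    measurable_pi_apply i (measurableSet_singleton _)

lemma isOpen_nbhd (Λ : Finset Site) (ω : Config) : IsOpen (nbhd Λ ω) := by
  have : nbhd Λ ω = ⋂ i ∈ Λ, (fun σ : Config => σ i) ⁻¹' {ω i} := by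
    ext σ; simp [nbhd]
  rw [this]
  exact isOpen_biInter_finset fun i _ => (isOpen_discrete _).preimage (continuous_apply i)

lemma glue_restrict_of_dependsOn {f : Config → ℝ} {D : Finset Site}
    (hf : DependsOn f (D : Set Site)) (σ ω : Config) : f (glue D (fun i => σ i) ω) = f σ :=
  hf fun _ hi => glue_of_mem hi _ _

/-- A local function is a combination of indicators of cylinders. -/
lemma eq_sum_indicator_nbhd {f : Config → ℝ} {D : Finset Site} (hf : DependsOn f (D : Set Site)) :
    f = ∑ τ : D → Bool, f (glue D τ plusConfig) •
      (nbhd D (glue D τ plusConfig)).indicator fun _ => (1 : ℝ) := by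
  ext σ
  rw [Finset.sum_apply, Finset.sum_eq_single fun i : D => σ i]
  · rw [Pi.smul_apply, Set.indicator_of_mem, smul_eq_mul, mul_one, glue_restrict_of_dependsOn hf]
    intro i hi
    rw [glue_of_mem hi]
  · intro τ _ hτ
    rw [Pi.smul_apply, Set.indicator_of_notMem, smul_zero]
    intro h
    refine hτ (funext fun i => ?_)
    rw [h i i.2, glue_of_mem i.2]
  · simp

/-- The DLR equations concern events; a local function is a finite combination of cylinder
indicators, so linearity suffices. -/
lemma condExp_eq_integral_kernel {γ : KernelFamily} {ν : Measure Config} (hγ : IsSpecification γ)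
    (hν : ν ∈ DLR γ) (Λ : Finset Site) {f : Config → ℝ} (hf : IsLocal f) :
    ν[f | sigmaOn (Λ : Set Site)ᶜ] =ᵐ[ν] fun ω => ∫ σ, f σ ∂(γ Λ ω) := by
  obtain ⟨D, hD⟩ := hf
  have := hν.1
  have hprob := hγ.isProbability
  have hintg : ∀ τ : D → Bool, Integrable (f (glue D τ plusConfig) •
      (nbhd D (glue D τ plusConfig)).indicator fun _ => (1 : ℝ)) ν := fun τ =>
    (integrable_indicator_one (measurableSet_nbhd _ _)).smul _
  have h1 := condExp_finsetSum (μ := ν) (s := Finset.univ) (fun τ _ => hintg τ)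
    (sigmaOn (Λ : Set Site)ᶜ)
  rw [← eq_sum_indicator_nbhd hD] at h1
  have h2 : ∀ᵐ ω ∂ν, ∀ τ : D → Bool, (ν[f (glue D τ plusConfig) •
      (nbhd D (glue D τ plusConfig)).indicator fun _ => (1 : ℝ) | sigmaOn (Λ : Set Site)ᶜ]) ω =
      f (glue D τ plusConfig) * (γ Λ ω).real (nbhd D (glue D τ plusConfig)) :=
    ae_all_iff.2 fun τ => by
      filter_upwards [condExp_smul (μ := ν) (f (glue D τ plusConfig))
        ((nbhd D (glue D τ plusConfig)).indicator fun _ => (1 : ℝ)) (sigmaOn (Λ : Set Site)ᶜ),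
        hν.2 Λ _ (measurableSet_nbhd D (glue D τ plusConfig))] with ω ha hb
      rw [ha, Pi.smul_apply, hb, smul_eq_mul]
  filter_upwards [h1, h2] with ω h1 h2
  rw [h1, Finset.sum_apply]
  simp only [h2]
  conv_rhs => rw [eq_sum_indicator_nbhd hD]
  simp only [Finset.sum_apply, Pi.smul_apply, smul_eq_mul]
  rw [integral_finsetSum _ fun τ _ =>
    (integrable_indicator_one (measurableSet_nbhd _ _)).const_mul _]
  refine Finset.sum_congr rfl fun τ _ => ?_
  rw [integral_const_mul, integral_indicator (measurableSet_nbhd _ _), setIntegral_const,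
    smul_eq_mul, mul_one]

/-- A quasilocal measure has no points of essential discontinuity. -/
lemma IsEssentialDiscontinuity.not_isQuasilocal {ν : Measure Config} {ω : Config}
    (h : IsEssentialDiscontinuity ν ω) : ¬ IsQuasilocal ν := by
  rintro ⟨γ, hγ, hq, hν⟩
  obtain ⟨Λ₀, f, δ, hf, hδ, H⟩ := h
  obtain ⟨Λ₁, hΛ₁⟩ := hq Λ₀ f hf δ hδ
  -- Enlarging the window to `Λ₁` makes the kernel expectation of `f` vary by at most `δ` on it,
  -- while positivity of the two open sets supplies points at which it varies by more.
  obtain ⟨N₁, N₂, ho₁, hN₁, hp₁, ho₂, hN₂, hp₂, hae⟩ := H (Λ₀ ∪ Λ₁) Finset.subset_union_left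
  have hE := condExp_eq_integral_kernel hγ hν Λ₀ hf
  have ne₁ : (ae (ν.restrict N₁)).NeBot := by
    rw [ae_neBot, Ne, Measure.restrict_eq_zero]; exact hp₁.ne'
  have ne₂ : (ae (ν.restrict N₂)).NeBot := by
    rw [ae_neBot, Ne, Measure.restrict_eq_zero]; exact hp₂.ne'
  obtain ⟨ω₁, ⟨h₁, hE₁⟩, hm₁⟩ := ((hae.and (ae_restrict_of_ae hE)).and
    (ae_restrict_mem ho₁.measurableSet)).exists
  obtain ⟨ω₂, ⟨h₂, hE₂⟩, hm₂⟩ := ((h₁.and (ae_restrict_of_ae hE)).and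
    (ae_restrict_mem ho₂.measurableSet)).exists
  rw [hE₁, hE₂] at h₂
  refine absurd h₂ (not_lt.2 (hΛ₁ ω₂ ω₁ fun i hi => ?_))
  rw [hN₁ hm₁ i (Finset.mem_union_right _ hi), hN₂ hm₂ i (Finset.mem_union_right _ hi)]

lemma IsGibbs.isQuasilocal {ν : Measure Config} (h : IsGibbs ν) : IsQuasilocal ν := by
  obtain ⟨γ, hγ, -, hq, hν⟩ := h
  exact ⟨γ, hγ, hq, hν⟩

/-! ### The decimated measures -/

section
variable {J α β : ℝ} {μ : Measure Config}

lemma measurable_decimation : Measurable decimation :=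
  measurable_pi_iff.2 fun _ => measurable_pi_apply _

lemma kernelAv_nbhd_pos (φ : Site → ℝ) (D : Finset Site) (η ω : Config) :
    0 < kernelAv φ D ω ((nbhd D η).indicator fun _ => 1) := by
  refine div_pos (lt_of_lt_of_le ?_ (Finset.single_le_sum (f := fun τ : D → Bool =>
    (nbhd D η).indicator (fun _ => (1 : ℝ)) (glue D τ ω) * weight D (pairCoupling φ)
      (kernelField φ D ω) (glue D τ ω)) (fun τ _ => mul_nonneg
      (Set.indicator_nonneg (fun _ _ => zero_le_one) _) (weight_pos _).le)
      (Finset.mem_univ fun i : D => η i))) partition_pos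
  have : glue D (fun i => η i) ω ∈ nbhd D η := fun i hi => glue_of_mem hi _ _
  rw [Set.indicator_of_mem this, one_mul]
  exact weight_pos _

/-- Finite energy. -/
lemma measure_nbhd_pos (hμ : μ ∈ DLR (isingKernel J α β)) (D : Finset Site) (η : Config) :
    0 < μ (nbhd D η) := by
  have := hμ.1
  have hA := measurableSet_nbhd D η
  have h1 := setIntegral_kernel_of_mem_DLR (Λ := D) hμ hA MeasurableSet.univ
  rw [setIntegral_univ, Set.inter_univ] at h1
  have hpos : ∀ ω, 0 < (isingKernel J α β D ω).real (nbhd D η) := fun ω => by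
    rw [isingKernel_real _ _ _ _ _ hA]; exact kernelAv_nbhd_pos _ _ _ _
  have h2 : 0 < ∫ ω, (isingKernel J α β D ω).real (nbhd D η) ∂μ := by
    rw [integral_pos_iff_support_of_nonneg (fun ω => (hpos ω).le)
      (integrable_kernel_of_mem_DLR hμ hA)]
    rw [Function.support_eq_univ fun ω => (hpos ω).ne', measure_univ]
    exact one_pos
  rw [h1] at h2
  exact (ENNReal.toReal_pos_iff.1 h2).1

lemma decimate_nbhd_pos (hμ : μ ∈ DLR (isingKernel J α β)) (D : Finset Site) (η : Config) :
    0 < decimate μ (nbhd D η) := by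
  rw [decimate, Measure.map_apply measurable_decimation (measurableSet_nbhd D η)]
  refine lt_of_lt_of_le (measure_nbhd_pos hμ (D.image fun p => (2 * p.1, 2 * p.2))
    fun j => η (j.1 / 2, j.2 / 2)) (measure_mono fun σ hσ p hp => ?_)
  rw [decimation, hσ _ (Finset.mem_image_of_mem _ hp)]
  simp

lemma measurableSet_preimage_decimation {V : Finset Site}
    (hV : ∀ p : Site, p ≠ 0 → (2 * p.1, 2 * p.2) ∉ V) {B : Set Config}
    (hB : MeasurableSet[sigmaOn (({0} : Finset Site) : Set Site)ᶜ] B) :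
    MeasurableSet[sigmaOn (V : Set Site)ᶜ] (decimation ⁻¹' B) := by
  have h : Measurable[sigmaOn (V : Set Site)ᶜ, sigmaOn (({0} : Finset Site) : Set Site)ᶜ]
      decimation := by
    refine measurable_cylinderEvents_iff.2 fun p hp => ?_
    exact measurable_cylinderEvent_apply (hV p (by simpa using hp))
  exact h hB

/-- The event of a plus spin at the origin. -/
abbrev plusAtOrigin : Set Config := {σ | σ 0 = true}

lemma measurableSet_plusAtOrigin : MeasurableSet plusAtOrigin :=
  measurableSet_eq_fun (measurable_pi_apply (0 : Site)) measurable_const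

/-- An event depending on the decimated spins off the origin pulls back to an event outside `V`, so
the kernel on `V`, which resamples the origin and hidden spins only, computes the decimated
integrals. -/
lemma setIntegral_decimate (hμ : μ ∈ DLR (isingKernel J α β)) {V : Finset Site}
    (hV : ∀ p : Site, p ≠ 0 → (2 * p.1, 2 * p.2) ∉ V) {B : Set Config}
    (hB : MeasurableSet[sigmaOn (({0} : Finset Site) : Set Site)ᶜ] B) :
    ∫ σ in B, plusAtOrigin.indicator (fun _ => (1 : ℝ)) σ ∂(decimate μ) =
      ∫ ω in decimation ⁻¹' B, (isingKernel J α β V ω).real plusAtOrigin ∂μ := by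
  have := hμ.1
  have hB' := cylinderEvents_le_pi B hB
  rw [setIntegral_kernel_of_mem_DLR hμ measurableSet_plusAtOrigin
    (measurableSet_preimage_decimation hV hB), integral_indicator measurableSet_plusAtOrigin,
    setIntegral_const, smul_eq_mul, mul_one, measureReal_restrict_apply measurableSet_plusAtOrigin,
    decimate, map_measureReal_apply measurable_decimation (measurableSet_plusAtOrigin.inter hB')]
  rfl

/-- The alternating pattern on `L`, surrounded by the spin value `b`. -/
def altInside (L : Finset Site) (b : Bool) : Config := fun p => if p ∈ L then altConfig p else b

lemma isAltSurrounded_of_mem_nbhd {L : Finset Site} {b : Bool} {n : ℕ} {ω : Config}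
    (h : decimation ω ∈ nbhd ((box n).erase 0) (altInside L b)) : IsAltSurrounded L b n ω := by
  intro p hp hpn
  have hmem : p ∈ (box n).erase 0 := by
    refine Finset.mem_erase.2 ⟨hp, ?_⟩
    rw [mem_box] at hpn ⊢
    simp only [two_nsmul, Prod.fst_add, Prod.snd_add, abs_le] at hpn ⊢
    omega
  have := h p hmem
  rw [decimation, altInside] at this
  rw [← this, two_nsmul]
  congr 1
  ext <;> simp [two_mul]

lemma measurableSet_nbhd_erase (D : Finset Site) (η : Config) :
    MeasurableSet[sigmaOn (({0} : Finset Site) : Set Site)ᶜ] (nbhd (D.erase 0) η) := by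
  have : nbhd (D.erase 0) η = ⋂ i ∈ D.erase 0, (fun σ : Config => σ i) ⁻¹' {η i} := by
    ext σ; simp [nbhd]
  rw [this]
  refine Finset.measurableSet_biInter _ fun i hi => ?_
  refine measurable_cylinderEvent_apply (m := fun _ => inferInstance) (X := fun _ : Site => Bool)
    ?_ (measurableSet_singleton _)
  simpa using (Finset.mem_erase.1 hi).1

lemma two_mul_notMem_insert_oddPart {p : Site} (hp : p ≠ 0) (n : ℕ) :
    (2 * p.1, 2 * p.2) ∉ insert (0 : Site) (oddPart (box n)) := by
  rw [Finset.mem_insert, mem_oddPart, not_or]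
  refine ⟨fun h => hp ?_, fun h => h.2 ⟨even_two_mul _, even_two_mul _⟩⟩
  have h1 := congrArg Prod.fst h
  have h2 := congrArg Prod.snd h
  ext
  · simpa using h1
  · simpa using h2

/-- The two open sets are the cylinders that alternate on `L` and are plus, respectively minus, on
the rest of a large box. They have positive measure by finite energy, and the kernel jump holds for
every configuration in them. -/
lemma isEssentialDiscontinuity_decimate
    (hφ : IsAxisInteraction (isingInteraction J α β)) {K : ℝ}
    (hK : IsStrong (isingInteraction J α β) K) (hμ : μ ∈ DLR (isingKernel J α β)) :
    IsEssentialDiscontinuity (decimate μ) altConfig := by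
  obtain ⟨δ, hδ, hjump⟩ := hφ.exists_jump hK
  have := hμ.1
  have hprob : IsProbabilityMeasure (decimate μ) :=
    Measure.isProbabilityMeasure_map measurable_decimation.aemeasurable
  refine ⟨{0}, plusAtOrigin.indicator fun _ => 1, δ / 2,
    ⟨{0}, fun σ σ' h => ?_⟩, half_pos hδ, fun L hL => ?_⟩
  · simp only [Set.indicator, plusAtOrigin, Set.mem_ofPred_eq, h 0 (by simp)]
  obtain ⟨n, hLn, hn⟩ := hjump L (Finset.singleton_subset_iff.1 hL)
  have hsub : ∀ b, nbhd (box n) (altInside L b) ⊆ nbhd L altConfig := fun b σ hσ i hi => by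
    rw [hσ i (hLn hi), altInside, if_pos hi]
  have hsub' : ∀ b, nbhd (box n) (altInside L b) ⊆ nbhd ((box n).erase 0) (altInside L b) :=
    fun b σ hσ i hi => hσ i (Finset.mem_of_mem_erase hi)
  refine ⟨nbhd (box n) (altInside L true), nbhd (box n) (altInside L false), isOpen_nbhd _ _,
    hsub _, decimate_nbhd_pos hμ _ _, isOpen_nbhd _ _, hsub _, decimate_nbhd_pos hμ _ _, ?_⟩
  set V := insert (0 : Site) (oddPart (box n)) with hVdef
  set g : Config → ℝ := fun ω => (isingKernel J α β V ω).real plusAtOrigin with hg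
  have hgn : ∀ ω₁ ω₂ : Config, IsAltSurrounded L true n ω₁ → IsAltSurrounded L false n ω₂ →
      g ω₂ + δ ≤ g ω₁ := fun ω₁ ω₂ h₁ h₂ => by
    rw [hg]
    dsimp only
    rw [isingKernel_real _ _ _ _ _ measurableSet_plusAtOrigin,
      isingKernel_real _ _ _ _ _ measurableSet_plusAtOrigin]
    exact hn ω₁ ω₂ h₁ h₂
  have hexists : ∀ b, ∃ ω, IsAltSurrounded L b n ω := fun b =>
    ⟨fun j => altInside L b (j.1 / 2, j.2 / 2), fun p _ _ => by
      dsimp only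
      rw [half_two_nsmul, altInside]⟩
  -- The jump is uniform over pairs, so the supremum over minus surroundings is a level separating
  -- the two families.
  obtain ⟨c, hc₁, hc₂⟩ : ∃ c, (∀ ω, IsAltSurrounded L true n ω → c + δ ≤ g ω) ∧
      ∀ ω, IsAltSurrounded L false n ω → g ω ≤ c := by
    obtain ⟨ω₁, h₁⟩ := hexists true
    obtain ⟨ω₂, h₂⟩ := hexists false
    refine ⟨sSup (g '' {ω | IsAltSurrounded L false n ω}), fun ω hω => ?_, fun ω hω => ?_⟩
    · rw [← le_sub_iff_add_le]
      refine csSup_le ⟨_, ω₂, h₂, rfl⟩ ?_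
      rintro _ ⟨ω', hω', rfl⟩
      have := hgn ω ω' hω hω'
      linarith
    · refine le_csSup ⟨g ω₁, ?_⟩ ⟨ω, hω, rfl⟩
      rintro _ ⟨ω', hω', rfl⟩
      have := hgn ω₁ ω' h₁ hω'
      linarith
  have hVp : ∀ p : Site, p ≠ 0 → (2 * p.1, 2 * p.2) ∉ V := fun p hp =>
    two_mul_notMem_insert_oddPart hp n
  have hgint : Integrable g μ := integrable_kernel_of_mem_DLR hμ measurableSet_plusAtOrigin
  have hreal : ∀ B, MeasurableSet B → (decimate μ).real B = μ.real (decimation ⁻¹' B) := fun B hB =>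
    map_measureReal_apply measurable_decimation hB
  have hfint : Integrable (plusAtOrigin.indicator fun _ => (1 : ℝ)) (decimate μ) :=
    integrable_indicator_one measurableSet_plusAtOrigin
  -- The conditional expectation is tested on cylinders with the origin removed, as these belong to
  -- the conditioning σ-algebra; the bound is then restricted to the smaller cylinders.
  have hlow := ae_le_condExp (c := c + δ) cylinderEvents_le_pi hfint
    (measurableSet_nbhd_erase (box n) (altInside L true)) fun B hB hBN => by
      have hB' := cylinderEvents_le_pi B hB
      rw [setIntegral_decimate hμ hVp hB, hreal B hB']
      refine setIntegral_ge_of_const_le_real (measurable_decimation hB') (measure_ne_top _ _)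
        (fun ω hω => ?_) hgint.integrableOn
      exact hc₁ ω (isAltSurrounded_of_mem_nbhd (hBN hω))
  have hupp := ae_condExp_le (c := c) cylinderEvents_le_pi hfint
    (measurableSet_nbhd_erase (box n) (altInside L false)) fun B hB hBN => by
      have hB' := cylinderEvents_le_pi B hB
      rw [setIntegral_decimate hμ hVp hB, hreal B hB', mul_comm, ← smul_eq_mul,
        ← setIntegral_const]
      refine setIntegral_mono_on hgint.integrableOn integrableOn_const
        (measurable_decimation hB') (fun ω hω => ?_)
      exact hc₂ ω (isAltSurrounded_of_mem_nbhd (hBN hω))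
  filter_upwards [ae_restrict_of_ae_restrict_of_subset (hsub' true) hlow] with ω₁ h₁
  filter_upwards [ae_restrict_of_ae_restrict_of_subset (hsub' false) hupp] with ω₂ h₂
  refine lt_of_lt_of_le ?_ (le_abs_self _)
  linarith

end

/-! ### Convergence of the finite-volume states with plus boundary condition -/

section
variable {φ : Site → ℝ} {Λ Λ' : Finset Site} {f : Config → ℝ}

lemma le_plusConfig (ω : Config) : ω ≤ plusConfig := fun _ => Bool.le_true _

/-- The boundary condition enters twice: in the argument of `f`, handled by pointwise monotonicity,
and in the field, handled by FKG. -/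
lemma IsAxisInteraction.kernelAv_le_plus (hφ : IsAxisInteraction φ) (hf : Monotone f)
    (ω : Config) : kernelAv φ Λ ω f ≤ kernelAv φ Λ plusConfig f := by
  have hfield : ∀ i ∈ Λ, kernelField φ Λ ω i ≤ kernelField φ Λ plusConfig i := fun i _ => by
    refine Summable.tsum_le_tsum (fun j => ?_) (summable_ite_mem_zero (hφ.summable_spin ω i) Λ)
      (summable_ite_mem_zero (hφ.summable_spin plusConfig i) Λ)
    split_ifs
    · exact le_rfl
    · exact mul_le_mul_of_nonneg_left (spin_mono (le_plusConfig ω j)) (hφ.nonneg _)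
  have hF : DependsOn (fun σ : Config => f (glue Λ (fun i => σ i) plusConfig)) (Λ : Set Site) :=
    fun σ σ' h => by
      dsimp only
      congr 2
      exact funext fun i => h i i.2
  have hglue : ∀ (τ : Λ → Bool) (η : Config), glue Λ (fun i => glue Λ τ η i) plusConfig =
      glue Λ τ plusConfig := fun τ η => by
    congr 1
    exact funext fun i => glue_of_mem i.2 _ _
  have h := gibbsAv_mono_field (ω := plusConfig) (c := pairCoupling φ) (f := f)
    (fun i _ j _ => hφ.nonneg _) hfield fun τ τ' h => hf (glue_mono Λ h le_rfl)
  refine le_trans ?_ h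
  calc kernelAv φ Λ ω f
      ≤ gibbsAv Λ (pairCoupling φ) (kernelField φ Λ ω) ω
          fun σ => f (glue Λ (fun i => σ i) plusConfig) := gibbsAv_mono fun τ => by
        rw [hglue]
        exact hf (glue_mono Λ le_rfl (le_plusConfig ω))
    _ = gibbsAv Λ (pairCoupling φ) (kernelField φ Λ ω) plusConfig
          fun σ => f (glue Λ (fun i => σ i) plusConfig) := gibbsAv_base hF _ _
    _ = _ := gibbsAv_congr (fun _ _ => rfl) fun τ => by rw [hglue]

lemma IsAxisInteraction.kernelAv_plus_antitone (hφ : IsAxisInteraction φ) (hf : Monotone f) :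
    Antitone fun Λ => kernelAv φ Λ plusConfig f := fun Λ Λ' h => by
  dsimp only
  rw [hφ.kernelAv_tower h]
  exact gibbsAv_le_const fun τ => hφ.kernelAv_le_plus hf _

lemma exists_abs_le_of_dependsOn {D : Finset Site} (hf : DependsOn f (D : Set Site)) :
    ∃ M, 0 ≤ M ∧ ∀ σ, |f σ| ≤ M :=
  ⟨∑ τ : D → Bool, |f (glue D τ plusConfig)|, Finset.sum_nonneg fun _ _ => abs_nonneg _, fun σ => by
    rw [← glue_restrict_of_dependsOn hf σ plusConfig]
    exact Finset.single_le_sum (f := fun τ : D → Bool => |f (glue D τ plusConfig)|)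
      (fun _ _ => abs_nonneg _) (Finset.mem_univ fun i : D => σ i)⟩

lemma monotone_sum_spin (D : Finset Site) : Monotone fun σ : Config => ∑ x ∈ D, spin (σ x) :=
  fun _ _ h => Finset.sum_le_sum fun x _ => spin_mono (h x)

/-- Raising any spin of `D` increases the added term by at least `2 M`, as much as `f` can drop. So
every local function is a difference of increasing ones, and its plus expectations converge. -/
lemma monotone_add_sum_spin {D : Finset Site} (hf : DependsOn f (D : Set Site)) {M : ℝ}
    (hM0 : 0 ≤ M) (hM : ∀ σ, |f σ| ≤ M) :
    Monotone fun σ => f σ + M * ∑ x ∈ D, spin (σ x) := fun σ σ' h => by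
  dsimp only
  by_cases heq : ∀ x ∈ D, σ x = σ' x
  · rw [hf heq, Finset.sum_congr rfl fun x hx => by rw [heq x hx]]
  · push Not at heq
    obtain ⟨x, hx, hne⟩ := heq
    have h2 : ∑ y ∈ D, spin (σ y) + 2 ≤ ∑ y ∈ D, spin (σ' y) := by
      rw [← Finset.add_sum_erase D _ hx, ← Finset.add_sum_erase D (fun y => spin (σ' y)) hx]
      have h3 : ∑ y ∈ D.erase x, spin (σ y) ≤ ∑ y ∈ D.erase x, spin (σ' y) :=
        monotone_sum_spin _ h
      have h4 : spin (σ x) + 2 ≤ spin (σ' x) := by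
        have := h x
        revert this hne
        cases σ x <;> cases σ' x <;> norm_num
      linarith
    have h5 := (abs_le.1 (hM σ)).2
    have h6 := (abs_le.1 (hM σ')).1
    nlinarith

lemma IsAxisInteraction.exists_tendsto_of_monotone (hφ : IsAxisInteraction φ) (hf : Monotone f)
    {M : ℝ} (hM : ∀ σ, -M ≤ f σ) :
    ∃ a, Tendsto (fun Λ => kernelAv φ Λ plusConfig f) atTop (𝓝 a) :=
  ⟨_, tendsto_atTop_ciInf (hφ.kernelAv_plus_antitone hf) ⟨-M, by
    rintro _ ⟨Λ, rfl⟩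
    exact const_le_gibbsAv fun τ => hM _⟩⟩

lemma IsAxisInteraction.exists_tendsto_kernelAv_plus (hφ : IsAxisInteraction φ) (hf : IsLocal f) :
    ∃ a, Tendsto (fun Λ => kernelAv φ Λ plusConfig f) atTop (𝓝 a) := by
  obtain ⟨D, hD⟩ := hf
  obtain ⟨M, hM0, hM⟩ := exists_abs_le_of_dependsOn hD
  have hS : ∀ σ : Config, -(D.card : ℝ) ≤ ∑ x ∈ D, spin (σ x) := fun σ => by
    have := Finset.card_nsmul_le_sum D (fun x => spin (σ x)) (-1) fun x _ => neg_one_le_spin _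
    simpa using this
  obtain ⟨a, ha⟩ := hφ.exists_tendsto_of_monotone (monotone_add_sum_spin hD hM0 hM)
    (M := M + M * D.card) fun σ => by
      have h1 := (abs_le.1 (hM σ)).1
      have h2 := mul_le_mul_of_nonneg_left (hS σ) hM0
      linarith
  obtain ⟨b, hb⟩ := hφ.exists_tendsto_of_monotone (monotone_sum_spin D) hS
  refine ⟨a - M * b, (ha.sub (hb.const_mul M)).congr fun Λ => ?_⟩
  simp only [kernelAv]
  rw [gibbsAv_add, gibbsAv_const_mul]
  ring

/-! ### Continuity of the kernels -/

lemma continuous_glue (Λ : Finset Site) (τ : Λ → Bool) : Continuous (glue Λ τ) :=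
  continuous_pi fun i => by
    by_cases hi : i ∈ Λ
    · simp only [glue_of_mem hi]; exact continuous_const
    · simp only [glue_of_notMem hi]; exact continuous_apply i

lemma continuous_spin_apply (i : Site) : Continuous fun σ : Config => spin (σ i) :=
  (continuous_of_discreteTopology (f := spin)).comp (continuous_apply i)

lemma IsLocal.continuous (hf : IsLocal f) : Continuous f := by
  obtain ⟨D, hD⟩ := hf
  have h : f = (fun τ : D → Bool => f (glue D τ plusConfig)) ∘ fun σ (i : D) => σ i :=
    funext fun σ => (glue_restrict_of_dependsOn hD σ plusConfig).symm
  rw [h]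
  exact continuous_of_discreteTopology.comp (continuous_pi fun i => continuous_apply _)

lemma IsAxisInteraction.continuous_kernelField (hφ : IsAxisInteraction φ) (Λ : Finset Site)
    (i : Site) : Continuous fun ω => kernelField φ Λ ω i := by
  refine continuous_tsum (fun j => ?_) (hφ.summable_sub i) fun j ω => ?_
  · split_ifs
    · exact continuous_const
    · exact continuous_const.mul (continuous_spin_apply j)
  · split_ifs
    · simpa using hφ.nonneg _
    · rw [Real.norm_eq_abs, abs_mul, abs_spin, mul_one, abs_of_nonneg (hφ.nonneg _)]

lemma IsAxisInteraction.continuous_weight (hφ : IsAxisInteraction φ) (Λ : Finset Site)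
    (τ : Λ → Bool) : Continuous fun ω =>
      weight Λ (pairCoupling φ) (kernelField φ Λ ω) (glue Λ τ ω) := by
  have hs : ∀ i, Continuous fun ω => spin (glue Λ τ ω i) := fun i =>
    (continuous_spin_apply i).comp (continuous_glue Λ τ)
  have hk := hφ.continuous_kernelField Λ
  unfold weight energy
  fun_prop

lemma IsAxisInteraction.continuous_partition (hφ : IsAxisInteraction φ) (Λ : Finset Site) :
    Continuous fun ω => spinSum Λ (weight Λ (pairCoupling φ) (kernelField φ Λ ω)) ω :=
  continuous_finsetSum _ fun τ _ => hφ.continuous_weight Λ τ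

lemma IsAxisInteraction.continuous_kernelAv (hφ : IsAxisInteraction φ) (Λ : Finset Site)
    (hf : Continuous f) : Continuous fun ω => kernelAv φ Λ ω f :=
  (continuous_finsetSum _ fun τ _ => (hf.comp (continuous_glue Λ τ)).mul
    (hφ.continuous_weight Λ τ)).div (hφ.continuous_partition Λ) fun _ => partition_pos.ne'

lemma IsAxisInteraction.measurable_kernelAv (hφ : IsAxisInteraction φ) (Λ : Finset Site)
    (hf : Measurable f) : Measurable fun ω => kernelAv φ Λ ω f :=
  (Finset.measurable_fun_sum _ fun τ _ => (hf.comp (continuous_glue Λ τ).measurable).mul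
    (hφ.continuous_weight Λ τ).measurable).div (hφ.continuous_partition Λ).measurable

lemma kernelAv_glue (τ : Λ → Bool) (ω : Config) :
    kernelAv φ Λ (glue Λ τ ω) f = kernelAv φ Λ ω f := by
  unfold kernelAv
  rw [kernelField_glue, gibbsAv, gibbsAv, spinSum_glue, spinSum_glue]

lemma measurable_glue_compl (Λ : Finset Site) (τ : Λ → Bool) :
    Measurable[sigmaOn (Λ : Set Site)ᶜ] (glue Λ τ) := by
  refine @measurable_pi_iff _ _ _ (sigmaOn (Λ : Set Site)ᶜ) _ _ |>.2 fun i => ?_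
  by_cases hi : i ∈ Λ
  · simp only [glue_of_mem hi]; exact measurable_const
  · simp only [glue_of_notMem hi]
    exact measurable_cylinderEvent_apply (by simpa using hi)

lemma IsAxisInteraction.measurable_kernelAv_compl (hφ : IsAxisInteraction φ) (Λ : Finset Site)
    (hf : Measurable f) : Measurable[sigmaOn (Λ : Set Site)ᶜ] fun ω => kernelAv φ Λ ω f := by
  have h := (hφ.measurable_kernelAv Λ hf).comp (measurable_glue_compl Λ fun _ => true)
  simpa only [Function.comp_def, kernelAv_glue] using h

/-- The events left invariant by `glue Λ τ` contain the generators of the σ-algebra of the spins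
outside `Λ`. -/
lemma glue_mem_iff {B : Set Config} (hB : MeasurableSet[sigmaOn (Λ : Set Site)ᶜ] B)
    (τ : Λ → Bool) (ω : Config) : glue Λ τ ω ∈ B ↔ ω ∈ B := by
  have hle : sigmaOn (Λ : Set Site)ᶜ ≤ MeasurableSpace.invariants (glue Λ τ) := by
    refine iSup₂_le fun i hi => ?_
    rintro _ ⟨S, hS, rfl⟩
    rw [MeasurableSpace.measurableSet_invariants]
    refine ⟨measurable_pi_apply i hS, ?_⟩
    ext σ
    rw [Set.mem_preimage, Set.mem_preimage, Set.mem_preimage,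
      glue_of_notMem (by simpa using hi)]
  exact Set.ext_iff.1 (MeasurableSpace.measurableSet_invariants.1 (hle B hB)).2 ω

end

/-! ### The plus phase -/

section
variable {J α β : ℝ}

lemma measure_ext_of_local {μ ν : Measure Config} [IsProbabilityMeasure μ]
    [IsProbabilityMeasure ν] (h : ∀ A : Set Config, MeasurableSet A →
      IsLocal (A.indicator fun _ => 1) → μ.real A = ν.real A) : μ = ν := by
  refine ext_of_generate_finite _ generateFrom_measurableCylinders.symm
    isPiSystem_measurableCylinders (fun A hA => ?_) (by simp)
  obtain ⟨D, S, hS, rfl⟩ := (mem_measurableCylinders A).1 hA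
  refine (measureReal_eq_measureReal_iff).1 (h _ (hS.cylinder D) ⟨D, fun σ σ' hσ => ?_⟩)
  have h1 : D.restrict σ = D.restrict σ' := funext fun i => hσ i i.2
  have h2 : σ ∈ cylinder D S ↔ σ' ∈ cylinder D S := by
    rw [mem_cylinder, mem_cylinder, h1]
  by_cases h3 : σ ∈ cylinder D S
  · rw [Set.indicator_of_mem h3, Set.indicator_of_mem (h2.1 h3)]
  · rw [Set.indicator_of_notMem h3, Set.indicator_of_notMem (mt h2.2 h3)]

lemma integral_indicator_one_eq (μ : Measure Config) {A : Set Config} (hA : MeasurableSet A) :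
    ∫ σ, A.indicator (fun _ => (1 : ℝ)) σ ∂μ = μ.real A := by
  rw [integral_indicator hA, setIntegral_const, smul_eq_mul, mul_one]

/-- The finite-volume states with plus boundary condition. -/
noncomputable def plusState (J α β : ℝ) (Λ : Finset Site) : ProbabilityMeasure Config :=
  ⟨isingKernel J α β Λ plusConfig, isProbabilityMeasure_isingKernel J α β Λ plusConfig⟩

/-- Probability measures on the compact configuration space have cluster points. All of them give
local functions the same integrals, so there is only one, and the states converge to it. -/
lemma exists_tendsto_plusState (hφ : IsAxisInteraction (isingInteraction J α β)) :
    ∃ μ : ProbabilityMeasure Config, Tendsto (plusState J α β) atTop (𝓝 μ) := by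
  have hcl : ∀ μ : ProbabilityMeasure Config, MapClusterPt μ atTop (plusState J α β) → ∀ f a,
      IsLocal f → Tendsto (fun Λ => kernelAv (isingInteraction J α β) Λ plusConfig f) atTop
        (𝓝 a) → ∫ σ, f σ ∂(μ : Measure Config) = a := fun μ hμ f a hf ha => by
    have hcont : Tendsto (fun ν : ProbabilityMeasure Config => ∫ σ, f σ ∂(ν : Measure Config))
        (𝓝 μ) (𝓝 (∫ σ, f σ ∂(μ : Measure Config))) :=
      (ProbabilityMeasure.tendsto_iff_forall_integral_tendsto.1 tendsto_id)
        (BoundedContinuousFunction.mkOfCompact ⟨f, hf.continuous⟩)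
    have h1 := hμ.tendsto_comp hcont
    have h2 : Tendsto ((fun ν : ProbabilityMeasure Config => ∫ σ, f σ ∂(ν : Measure Config)) ∘
        plusState J α β) atTop (𝓝 a) := ha.congr fun Λ => (integral_isingKernel ..).symm
    have : ClusterPt (∫ σ, f σ ∂(μ : Measure Config)) (𝓝 a) := ClusterPt.mono h1 h2
    exact eq_of_nhds_neBot this
  obtain ⟨μ, hμ⟩ := exists_clusterPt_of_compactSpace (map (plusState J α β) atTop)
  refine ⟨μ, le_nhds_of_unique_clusterPt fun ν hν => ?_⟩
  have hν' : IsProbabilityMeasure (ν : Measure Config) := ν.2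
  have hμ' : IsProbabilityMeasure (μ : Measure Config) := μ.2
  refine Subtype.ext (measure_ext_of_local (μ := (ν : Measure Config))
    (ν := (μ : Measure Config)) fun A hA hf => ?_)
  obtain ⟨a, ha⟩ := hφ.exists_tendsto_kernelAv_plus hf
  rw [← integral_indicator_one_eq _ hA, ← integral_indicator_one_eq _ hA,
    hcl ν hν _ a hf ha, hcl μ hμ _ a hf ha]

lemma measurable_isingKernel (hφ : IsAxisInteraction (isingInteraction J α β)) (Λ : Finset Site) :
    Measurable (isingKernel J α β Λ) := by
  refine Measure.measurable_of_measurable_coe _ fun A hA => ?_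
  have h : ∀ ω, isingKernel J α β Λ ω A = ENNReal.ofReal
      (kernelAv (isingInteraction J α β) Λ ω (A.indicator fun _ => 1)) := fun ω => by
    have := isProbabilityMeasure_isingKernel J α β Λ ω
    rw [← isingKernel_real _ _ _ _ _ hA, ofReal_measureReal]
  simp only [h]
  exact (hφ.measurable_kernelAv Λ (measurable_const.indicator hA)).ennreal_ofReal

lemma bind_isingKernel_real (hφ : IsAxisInteraction (isingInteraction J α β)) (μ : Measure Config)
    (Λ : Finset Site) {A : Set Config} (hA : MeasurableSet A) :
    (μ.bind (isingKernel J α β Λ)).real A =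
      ∫ ω, kernelAv (isingInteraction J α β) Λ ω (A.indicator fun _ => 1) ∂μ := by
  have hm := measurable_isingKernel hφ Λ
  simp only [← isingKernel_real _ _ _ _ _ hA]
  rw [Measure.real, Measure.bind_apply hA hm.aemeasurable]
  exact (integral_toReal ((Measure.measurable_coe hA).comp hm).aemeasurable
    (.of_forall fun ω => by
      have := isProbabilityMeasure_isingKernel J α β Λ ω
      exact measure_lt_top _ _)).symm

lemma tendsto_integral_plusState {μ : ProbabilityMeasure Config}
    (hμ : Tendsto (plusState J α β) atTop (𝓝 μ)) {f : Config → ℝ} (hf : Continuous f) :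
    Tendsto (fun Λ => kernelAv (isingInteraction J α β) Λ plusConfig f) atTop
      (𝓝 (∫ σ, f σ ∂(μ : Measure Config))) :=
  ((ProbabilityMeasure.tendsto_iff_forall_integral_tendsto.1 hμ)
    (BoundedContinuousFunction.mkOfCompact ⟨f, hf⟩)).congr fun _ => integral_isingKernel ..

/-- The limit is invariant under the kernels. -/
lemma bind_isingKernel_of_tendsto (hφ : IsAxisInteraction (isingInteraction J α β))
    {μ : ProbabilityMeasure Config} (hμ : Tendsto (plusState J α β) atTop (𝓝 μ))
    (Λ : Finset Site) : (μ : Measure Config).bind (isingKernel J α β Λ) = μ := by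
  have hm := measurable_isingKernel hφ Λ
  have hp := isProbabilityMeasure_isingKernel J α β Λ
  have : IsProbabilityMeasure ((μ : Measure Config).bind (isingKernel J α β Λ)) :=
    isProbabilityMeasure_bind hm.aemeasurable (.of_forall hp)
  refine measure_ext_of_local fun A hA hf => ?_
  rw [bind_isingKernel_real hφ _ Λ hA, ← integral_indicator_one_eq _ hA]
  -- The kernel maps a local function to a continuous one, so weak convergence applies to both; the
  -- two expectations agree once the volume contains `Λ`.
  refine tendsto_nhds_unique ?_ (tendsto_integral_plusState hμ hf.continuous)
  refine (tendsto_integral_plusState hμ (hφ.continuous_kernelAv Λ hf.continuous)).congr' ?_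
  filter_upwards [eventually_ge_atTop Λ] with Λ' h
  exact (hφ.kernelAv_tower h _ _).symm

/-- Invariance is applied to `A ∩ B` with `B` an event outside `Λ`: the kernel leaves `B` untouched,
so its value is that on `A` times the indicator of `B`. -/
lemma mem_DLR_of_tendsto (hφ : IsAxisInteraction (isingInteraction J α β))
    {μ : ProbabilityMeasure Config} (hμ : Tendsto (plusState J α β) atTop (𝓝 μ)) :
    (μ : Measure Config) ∈ DLR (isingKernel J α β) := by
  refine ⟨inferInstance, fun Λ A hA => ?_⟩
  have hmeas := hφ.measurable_kernelAv_compl Λ (f := A.indicator fun _ => 1)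
    (measurable_const.indicator hA)
  simp only [isingKernel_real _ _ _ _ _ hA]
  have hintg : Integrable (fun ω => kernelAv (isingInteraction J α β) Λ ω (A.indicator fun _ => 1))
      (μ : Measure Config) := by
    refine Integrable.of_bound (hφ.measurable_kernelAv Λ
      (measurable_const.indicator hA)).aestronglyMeasurable 1 (.of_forall fun ω => ?_)
    refine abs_gibbsAv_le fun τ => ?_
    by_cases h : glue Λ τ ω ∈ A <;> simp [h]
  refine (ae_eq_condExp_of_forall_setIntegral_eq cylinderEvents_le_pi
    (integrable_indicator_one hA) (fun _ _ _ => hintg.integrableOn) (fun B hB _ => ?_)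
    hmeas.aestronglyMeasurable).symm
  have hB' := cylinderEvents_le_pi B hB
  rw [integral_indicator hA, setIntegral_const, smul_eq_mul, mul_one,
    measureReal_restrict_apply hA, ← integral_indicator hB']
  conv_rhs => rw [← bind_isingKernel_of_tendsto hφ hμ Λ,
    bind_isingKernel_real hφ _ Λ (hA.inter hB')]
  refine integral_congr_ae (.of_forall fun ω => ?_)
  by_cases hω : ω ∈ B
  · dsimp only
    rw [Set.indicator_of_mem hω]
    refine gibbsAv_congr (fun _ _ => rfl) fun τ => ?_
    have := (glue_mem_iff hB τ ω).2 hω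
    by_cases h : glue Λ τ ω ∈ A <;> simp [h, this]
  · dsimp only
    rw [Set.indicator_of_notMem hω, ← gibbsAv_const (Λ := Λ) 0]
    refine gibbsAv_congr (fun _ _ => rfl) fun τ => ?_
    have := mt (glue_mem_iff hB τ ω).1 hω
    simp [this]

/-- Existence of the plus phase. -/
lemma exists_isPlusPhase (hφ : IsAxisInteraction (isingInteraction J α β)) :
    ∃ μ ∈ DLR (isingKernel J α β), IsPlusPhase J α β μ := by
  obtain ⟨μ, hμ⟩ := exists_tendsto_plusState hφ
  refine ⟨μ, mem_DLR_of_tendsto hφ hμ, inferInstance, fun f => ?_⟩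
  simp only [integral_isingKernel]
  exact tendsto_integral_plusState hμ f.continuous

end

end Ising

/-! ### The theorem -/

theorem mainTheorem2 (J α : ℝ) (hJ : 0 < J) (hα₁ : 1 < α) (hα₂ : α ≤ 2) :
    ∃ βc : ℝ, 0 < βc ∧ ∀ β : ℝ, βc < β →
      (∃ μp ∈ Ising.DLR (Ising.isingKernel J α β), Ising.IsPlusPhase J α β μp ∧
        Ising.IsEssentialDiscontinuity (Ising.decimate μp) Ising.altConfig ∧
        ¬ Ising.IsQuasilocal (Ising.decimate μp) ∧
        ¬ Ising.IsGibbs (Ising.decimate μp)) ∧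
      ∀ μ ∈ Ising.DLR (Ising.isingKernel J α β),
        Ising.IsEssentialDiscontinuity (Ising.decimate μ) Ising.altConfig ∧
        ¬ Ising.IsQuasilocal (Ising.decimate μ) ∧
        ¬ Ising.IsGibbs (Ising.decimate μ) := by
  refine ⟨Ising.betaBound J α, Ising.betaBound_pos hJ, fun β hβ => ?_⟩
  have hφ := Ising.isAxisInteraction_isingInteraction hJ hα₁ ((Ising.betaBound_pos hJ).trans hβ)
  have hK := Ising.isStrong_isingInteraction hJ hα₁ hβ
  have main : ∀ μ ∈ Ising.DLR (Ising.isingKernel J α β),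
      Ising.IsEssentialDiscontinuity (Ising.decimate μ) Ising.altConfig ∧
      ¬ Ising.IsQuasilocal (Ising.decimate μ) ∧ ¬ Ising.IsGibbs (Ising.decimate μ) := fun μ hμ => by
    have h := Ising.isEssentialDiscontinuity_decimate hφ hK hμ
    exact ⟨h, h.not_isQuasilocal, fun hG => h.not_isQuasilocal hG.isQuasilocal⟩
  obtain ⟨μp, hμp, hplus⟩ := Ising.exists_isPlusPhase hφ
  exact ⟨⟨μp, hμp, hplus, main μp hμp⟩, main⟩
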